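/- Let $d\ge 1$, and for $\hbar>0$ let $\widehat H_\hbar=-\frac{\hbar^2}{2}\Delta+\frac12\|x\|^2$ be the isotropic harmonic oscillator on $L^2(\mathbb R^d)$, with eigenvalues $E_N(\hbar)=\hbar(N+\frac d2)$, $N=0,1,2,\dots$. Let $\Pi_{\hbar,E_N(\hbar)}(x,y)$ be the continuous integral kernel of the orthogonal projection onto the eigenspace $\{\psi\in L^2(\mathbb R^d):\widehat H_\hbar\psi=E_N(\hbar)\psi\}$. For $(x,\xi)\in\mathbb R^d\times\mathbb R^d$ put $$W_{\hbar,E_N(\hbar)}(x,\xi)=\int_{\mathbb R^d}\Pi_{\hbar,E_N(\hbar)}\Big(x+\frac v2,x-\frac v2\Big)e^{-\frac i\hbar v\cdot\xi}\frac{dv}{(2\pi\hbar)^d},\qquad H(x,\xi)=\tfrac12(\|x\|^2+\|\xi\|^2).$$ Fix $E>0$ and an even Schwartz function $f$ on $\mathbb R$, write $\widehat f(t)=\int_{\mathbb R} f(s)e^{-ist}\,ds$, and let $$W_{\hbar,E,f}(x,\xi)=\sum_{N\ge0}f\big(\hbar^{-1}(E-E_N(\hbar))\big)\,W_{\hbar,E_N(\hbar)}(x,\xi).$$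 The kernels $\Pi_{\hbar,E_N(\hbar)}$ exist and are unique, and the integrals and the sum converge absolutely. Fix $(x,\xi)$ and write $H=H(x,\xi)$; asymptotics are as $\hbar\to0^+$. 1. If $H>E$, then $W_{\hbar,E,f}(x,\xi)=O(\hbar^{\infty})$, that is, $O(\hbar^M)$ for every $M\in\mathbb N$. 2. If $0<H<E$, set $H_E=H/E$ and, for $k\in\mathbb Z$, $$t_{+,\pm,k}=4\pi k\pm2\cos^{-1}\big(H_E^{1/2}\big),\qquad t_{-,\pm,k}=4\pi\big(k+\tfrac12\big)\pm2\cos^{-1}\big(H_E^{1/2}\big).$$ Then for every $\delta>0$ $$W_{\hbar,E,f}(x,\xi)=\frac{\hbar^{-d+\frac12}}{(2\pi)^{d+\frac12}E^{1/2}H_E^{d/2}(H_E^{-1}-1)^{1/4}}\left[\sum_{\pm_1,\pm_2\in\{+,-\}}\frac{e^{\mp_2 i\left(\frac\pi4+\frac{2H}{\hbar}(H_E^{-1}-1)^{1/2}\right)}}{(\pm_1 1)^d}\sum_{k\in\mathbb Z}\widehat f(t_{\pm_1,\pm_2,k})\,e^{\frac{iE}{\hbar}t_{\pm_1,\pm_2,k}}+O_\delta(\hbar^{1-\delta})\right],$$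 where the sums over $k$ converge absolutely and the implicit constant depends on $\delta$ (and on the fixed data $d,E,f,x,\xi$). -/

import Mathlib

open MeasureTheory Filter Topology Asymptotics
open scoped SchwartzMap

noncomputable section

namespace WignerWeyl

/-- Configuration space `ℝ^d` with its Euclidean norm. -/
abbrev Config (d : ℕ) : Type := EuclideanSpace ℝ (Fin d)

/-- The Hilbert space `L²(ℝ^d, dx)`. -/
abbrev L2 (d : ℕ) : Type := Lp ℂ 2 (volume : Measure (Config d))

/-- The potential `‖x‖² / 2`. -/
def potential (d : ℕ) (x : Config d) : ℂ := ((‖x‖ ^ 2 / 2 : ℝ) : ℂ)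

/-- The potential is of temperate growth, so that multiplication by it is the genuine operation on
tempered distributions. -/
theorem potential_hasTemperateGrowth (d : ℕ) : (potential d).HasTemperateGrowth := by
  have h : (fun x : Config d => ((2 : ℝ)⁻¹ * ‖x‖ ^ 2 : ℝ)).HasTemperateGrowth := by
    fun_prop
  have h2 := Complex.ofRealCLM.hasTemperateGrowth.comp h
  convert h2 using 1
  funext x
  simp [potential, Function.comp]
  ring

/-- The isotropic harmonic oscillator `Ĥ_ħ = -(ħ²/2) Δ + ‖x‖²/2`, acting on tempered
distributions on `ℝ^d`. -/
def oscillator (d : ℕ) (ħ : ℝ) : 𝓢'(Config d, ℂ) →L[ℂ] 𝓢'(Config d, ℂ) :=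
  (-((ħ : ℂ) ^ 2 / 2)) • LineDeriv.laplacianCLM ℂ (Config d) 𝓢'(Config d, ℂ)
    + TemperedDistribution.smulLeftCLM ℂ (potential d)

/-- The eigenspace `{ψ ∈ L²(ℝ^d) : Ĥ_ħ ψ = e ψ}`, the equation being understood in the sense of
distributions. -/
def eigenspace (d : ℕ) (ħ e : ℝ) : Submodule ℂ (L2 d) :=
  (((oscillator d ħ - (e : ℂ) • ContinuousLinearMap.id ℂ 𝓢'(Config d, ℂ)) ∘L
    Lp.toTemperedDistributionCLM ℂ (volume : Measure (Config d)) 2) :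
      L2 d →L[ℂ] 𝓢'(Config d, ℂ)).ker

theorem mem_eigenspace (d : ℕ) (ħ e : ℝ) (ψ : L2 d) :
    ψ ∈ eigenspace d ħ e ↔
      oscillator d ħ (Lp.toTemperedDistribution ψ) = (e : ℂ) • Lp.toTemperedDistribution ψ := by
  simp [eigenspace, sub_eq_zero]

instance (d : ℕ) (ħ e : ℝ) : CompleteSpace (eigenspace d ħ e) := by
  unfold eigenspace
  infer_instance

/-- The eigenvalues `E_N(ħ) = ħ (N + d/2)`. -/
def eigenvalue (d : ℕ) (ħ : ℝ) (N : ℕ) : ℝ := ħ * (N + d / 2)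

/-- The orthogonal projection of `L²(ℝ^d)` onto the eigenspace of the eigenvalue `E_N(ħ)`. -/
def eigenprojection (d : ℕ) (ħ : ℝ) (N : ℕ) : L2 d →L[ℂ] L2 d :=
  (eigenspace d ħ (eigenvalue d ħ N)).starProjection

/-- `K` is the continuous integral (Schwartz) kernel of the operator `T`. -/
def IsContinuousKernel {d : ℕ} (T : L2 d →L[ℂ] L2 d) (K : Config d → Config d → ℂ) : Prop :=
  Continuous (fun p : Config d × Config d => K p.1 p.2) ∧
    ∀ ψ : L2 d, ∀ᵐ x : Config d,
      Integrable (fun y => K x y * ψ y) ∧ T ψ x = ∫ y, K x y * ψ y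

open Classical in
/-- The continuous integral kernel of `T` (and `0` if there is none). -/
def continuousKernel {d : ℕ} (T : L2 d →L[ℂ] L2 d) : Config d → Config d → ℂ :=
  if h : ∃ K, IsContinuousKernel T K then h.choose else 0

/-- The integrand `Π(x + v/2, x - v/2) e^{-(i/ħ) v·ξ}` in the Wigner transform of the `N`-th
eigenspace projection. -/
def wignerIntegrand (d : ℕ) (ħ : ℝ) (N : ℕ) (x ξ v : Config d) : ℂ :=
  continuousKernel (eigenprojection d ħ N) (x + (2 : ℝ)⁻¹ • v) (x - (2 : ℝ)⁻¹ • v) *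
    Complex.exp (-(Complex.I / ħ) * (inner ℝ v ξ : ℝ))

/-- The Wigner distribution `W_{ħ,E_N(ħ)}(x,ξ)` of the `N`-th eigenspace projection. -/
def wigner (d : ℕ) (ħ : ℝ) (N : ℕ) (x ξ : Config d) : ℂ :=
  (∫ v, wignerIntegrand d ħ N x ξ v) / ((2 * Real.pi * ħ) ^ d : ℝ)

/-- The `N`-th term of the `ħ`-localized Weyl sum. -/
def weylTerm (d : ℕ) (ħ E : ℝ) (f : 𝓢(ℝ, ℂ)) (x ξ : Config d) (N : ℕ) : ℂ :=
  f (ħ⁻¹ * (E - eigenvalue d ħ N)) * wigner d ħ N x ξ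

/-- The `ħ`-localized Wigner-Weyl sum `W_{ħ,E,f}(x,ξ)`. -/
def weylSum (d : ℕ) (ħ E : ℝ) (f : 𝓢(ℝ, ℂ)) (x ξ : Config d) : ℂ :=
  ∑' N : ℕ, weylTerm d ħ E f x ξ N

/-- The classical Hamiltonian `H(x,ξ) = (‖x‖² + ‖ξ‖²) / 2`. -/
def hamiltonian {d : ℕ} (x ξ : Config d) : ℝ := (‖x‖ ^ 2 + ‖ξ‖ ^ 2) / 2

/-- The Fourier transform `f̂(t) = ∫ f(s) e^{-ist} ds`, for which
`f(s) = ∫ f̂(t) e^{ist} dt / (2π)`. -/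
def fourierHat (f : 𝓢(ℝ, ℂ)) (t : ℝ) : ℂ :=
  ∫ s : ℝ, f s * Complex.exp (-(Complex.I * s * t))

/-- The critical times `t_{σ₁,σ₂,k}`, with `h` in the role of `H_E = H/E`:
`4πk ± 2 arccos √h` for `σ₁ = 1` and `4π(k + 1/2) ± 2 arccos √h` for `σ₁ = -1`, where `±` is
`σ₂`. -/
def criticalTime (h : ℝ) (σ₁ σ₂ : ℤˣ) (k : ℤ) : ℝ :=
  4 * Real.pi * (if σ₁ = 1 then (k : ℝ) else k + 1 / 2)
    + ((σ₂ : ℤ) : ℝ) * (2 * Real.arccos (Real.sqrt h))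

/-- The term `f̂(t) e^{iEt/ħ}` at the critical time `t = t_{σ₁,σ₂,k}`. -/
def criticalTerm (ħ E h : ℝ) (f : 𝓢(ℝ, ℂ)) (σ₁ σ₂ : ℤˣ) (k : ℤ) : ℂ :=
  fourierHat f (criticalTime h σ₁ σ₂ k) *
    Complex.exp (Complex.I * E / ħ * criticalTime h σ₁ σ₂ k)

/-- The phase `π/4 + (2H/ħ) (H_E⁻¹ - 1)^{1/2}`, where `H = E h`. -/
def stationaryPhase (ħ E h : ℝ) : ℝ :=
  Real.pi / 4 + 2 * (E * h) / ħ * Real.sqrt (h⁻¹ - 1)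

/-- The sum over all critical times
`∑_{σ₁,σ₂} e^{-σ₂ i (π/4 + (2H/ħ)(H_E⁻¹-1)^{1/2})} / σ₁^d ∑_k f̂(t_{σ₁,σ₂,k}) e^{iE t_{σ₁,σ₂,k}/ħ}`. -/
def criticalSum (d : ℕ) (ħ E h : ℝ) (f : 𝓢(ℝ, ℂ)) : ℂ :=
  ∑ σ₁ : ℤˣ, ∑ σ₂ : ℤˣ,
    Complex.exp (-(((σ₂ : ℤ) : ℂ) * Complex.I * stationaryPhase ħ E h)) / ((σ₁ : ℤ) : ℂ) ^ d *
      ∑' k : ℤ, criticalTerm ħ E h f σ₁ σ₂ k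

/-- The amplitude
`ħ^{-d+1/2} / ((2π)^{d+1/2} E^{1/2} H_E^{d/2} (H_E⁻¹ - 1)^{1/4})`. -/
def amplitude (d : ℕ) (ħ E h : ℝ) : ℝ :=
  ħ ^ (-(d : ℝ) + 1 / 2) /
    ((2 * Real.pi) ^ ((d : ℝ) + 1 / 2) * E ^ (1 / 2 : ℝ) * h ^ ((d : ℝ) / 2) *
      (h⁻¹ - 1) ^ (1 / 4 : ℝ))

end WignerWeyl

end

/-! The products of Hermite functions are eigenfunctions and are total: if ψ is orthogonal to all of
them, then ψ times the Gaussian has vanishing Fourier transform. So each eigenprojection has an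
explicit finite-rank kernel. Its Wigner transform factors over the coordinates. Ladder relations
give a three-term recurrence for each factor, that is, a first-order equation for its generating
series, and logarithmic derivatives add over the coordinates. Hence `W_N = (πħ)^{-d} L_N(4H/ħ)`,
where `∑ L_N(y) z^N = exp(-(y/2)(1-z)/(1+z)) (1+z)^{-d}` (`wigner_eq_laguerreFun`,
`hasSum_laguerreFun`).

Write `E/ħ - d/2 = n₀ + ε` with `n₀` an integer and `0 ≤ ε < 1`. Up to the prefactor the Weyl sum is
a pairing `∑_m a(m) L_{n₀+m}` with `a(m) = f(ε - m)`. Multiplied by ħ, the recurrence near `n₀` has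
constant coefficients up to terms of order ħ. Summation by parts then shows that a pairing with a
sequence `Tκ`, `T = E(S + S⁻¹) + 2E - 4H` with `S` the shift, is ħ times a pairing with another
rapidly decaying sequence (`pairing_second_order`).

If `H > E`, the characteristic roots of `T` lie off the unit circle, so `T` can be solved for every
rapidly decaying sequence. Each step gains a factor ħ, and iteration from the crude bound `ħ^{-d}`
gives `O(ħ^∞)`.

If `0 < H < E`, the roots are `μ = e^{2iθ}` and its inverse, where `cos²θ = H/E`. Then `Tκ = a` is
solvable with rapid decay once the two moments `∑ μ^{±m} a(m)` vanish. So, modulo lower order, a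
pairing depends only on these two moments, and it is enough to know one test family `b` with a
nonzero moment at `μ` and none at `μ⁻¹`, together with its conjugate (`norm_pairing_sub_le`).

The test family consists of lattice samples of a function whose Fourier transform is a bump near `t
= 2θ` inside `(0, π)`. By Abel summation its pairing is an oscillatory integral with phase `(Et - 2H
tan(t/2))/ħ`, which has a nondegenerate maximum at `2θ`. The bump is chosen in the Morse coordinate
of this phase, so that the integral becomes exactly a Fresnel integral (`exists_test_family`).
Finally, Poisson summation turns the two moments of `f(ε - m)` into the sums over critical times;
the parity of the dual index separates the two values of `σ₁`. -/

noncomputable section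

namespace WignerWeyl

/-! ### Hermite functions on the line and their Wigner integrals -/

open Polynomial in
/-- The Hermite polynomials of the harmonic oscillator with Planck constant `ħ`, normalized so that
`(x - ħ d/dx)^n e^{-x²/2ħ} = H_n(x) e^{-x²/2ħ}`. -/
def hermitePoly (ħ : ℝ) : ℕ → ℝ[X]
  | 0 => 1
  | n + 1 => C 2 * X * hermitePoly ħ n - C ħ * derivative (hermitePoly ħ n)

/-- The (unnormalized) Hermite functions on the line. -/
def hermiteFun (ħ : ℝ) (n : ℕ) (x : ℝ) : ℝ :=
  (hermitePoly ħ n).eval x * Real.exp (-(x ^ 2 / (2 * ħ)))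

/-- The squared `L²` norms of the Hermite functions. -/
def hermiteNormSq (ħ : ℝ) (n : ℕ) : ℝ := (2 * ħ) ^ n * n.factorial * √(Real.pi * ħ)

theorem hermiteNormSq_pos {ħ : ℝ} (h : 0 < ħ) (n : ℕ) : 0 < hermiteNormSq ħ n := by
  unfold hermiteNormSq; positivity

theorem derivative_hermitePoly_succ (ħ : ℝ) (n : ℕ) :
    Polynomial.derivative (hermitePoly ħ (n + 1)) =
      Polynomial.C (2 * (n + 1 : ℝ)) * hermitePoly ħ n := by
  induction n with
  | zero => simp [hermitePoly]
  | succ n ih =>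
    rw [hermitePoly, Polynomial.derivative_sub, Polynomial.derivative_mul, Polynomial.derivative_mul,
      ih, Polynomial.derivative_mul, hermitePoly]
    simp only [Polynomial.derivative_mul, Polynomial.derivative_C, Polynomial.derivative_X, map_mul,
      map_add, map_natCast, map_one, Nat.cast_add, Nat.cast_one, Polynomial.derivative_natCast,
      Polynomial.derivative_one]
    ring

theorem eval_derivative_hermitePoly (ħ : ℝ) (n : ℕ) (x : ℝ) :
    (Polynomial.derivative (hermitePoly ħ n)).eval x = 2 * n * (hermitePoly ħ (n - 1)).eval x := by
  cases n with
  | zero => simp [hermitePoly]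
  | succ n => simp [derivative_hermitePoly_succ]

theorem eval_hermitePoly_succ (ħ : ℝ) (n : ℕ) (x : ℝ) :
    (hermitePoly ħ (n + 1)).eval x =
      2 * x * (hermitePoly ħ n).eval x - 2 * ħ * n * (hermitePoly ħ (n - 1)).eval x := by
  simp [hermitePoly, eval_derivative_hermitePoly]
  ring

theorem hermiteFun_succ (ħ : ℝ) (n : ℕ) (x : ℝ) :
    hermiteFun ħ (n + 1) x = 2 * x * hermiteFun ħ n x - 2 * ħ * n * hermiteFun ħ (n - 1) x := by
  simp only [hermiteFun, eval_hermitePoly_succ]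
  ring

/-- The derivative of a Hermite function, through the annihilation operator. -/
theorem hasDerivAt_hermiteFun {ħ : ℝ} (h : 0 < ħ) (n : ℕ) (x : ℝ) :
    HasDerivAt (hermiteFun ħ n) (2 * n * hermiteFun ħ (n - 1) x - x / ħ * hermiteFun ħ n x) x := by
  have h1 := (hermitePoly ħ n).hasDerivAt x
  have h2 : HasDerivAt (fun x : ℝ => Real.exp (-(x ^ 2 / (2 * ħ))))
      (Real.exp (-(x ^ 2 / (2 * ħ))) * (-(x / ħ))) x := by
    refine HasDerivAt.exp ?_
    refine ((hasDerivAt_pow 2 x).div_const (2 * ħ)).fun_neg.congr_deriv ?_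
    field_simp
    norm_num
  have h3 := h1.mul h2
  refine h3.congr_deriv ?_
  rw [eval_derivative_hermitePoly]
  simp only [hermiteFun]
  ring

theorem hasDerivAt_hermiteFun' {ħ : ℝ} (h : 0 < ħ) (n : ℕ) (x : ℝ) :
    HasDerivAt (hermiteFun ħ n) ((x * hermiteFun ħ n x - hermiteFun ħ (n + 1) x) / ħ) x := by
  refine (hasDerivAt_hermiteFun h n x).congr_deriv ?_
  rw [hermiteFun_succ]
  field_simp
  ring

theorem continuous_hermiteFun (ħ : ℝ) (n : ℕ) : Continuous (hermiteFun ħ n) := by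
  unfold hermiteFun
  fun_prop

theorem integrable_eval_mul_exp_neg_mul_sq (P : Polynomial ℝ) {b : ℝ} (hb : 0 < b) :
    Integrable fun v : ℝ => P.eval v * Real.exp (-b * v ^ 2) := by
  induction P using Polynomial.induction_on' with
  | add p q hp hq =>
    simp only [Polynomial.eval_add, add_mul]
    exact hp.add hq
  | monomial n a =>
    have h := integrable_rpow_mul_exp_neg_mul_sq hb (s := n) (by
      have : (0 : ℝ) ≤ n := n.cast_nonneg
      linarith)
    simp only [Real.rpow_natCast] at h
    simpa [Polynomial.eval_monomial, mul_assoc] using h.const_mul a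

theorem integrable_hermiteFun_mul {ħ : ℝ} (h : 0 < ħ) (m n : ℕ) :
    Integrable fun x => hermiteFun ħ m x * hermiteFun ħ n x := by
  have := integrable_eval_mul_exp_neg_mul_sq (hermitePoly ħ m * hermitePoly ħ n)
    (b := 1 / ħ) (by positivity)
  refine this.congr (ae_of_all _ fun x => ?_)
  simp only [hermiteFun, Polynomial.eval_mul]
  have : Real.exp (-(1 / ħ) * x ^ 2) =
      Real.exp (-(x ^ 2 / (2 * ħ))) * Real.exp (-(x ^ 2 / (2 * ħ))) := by
    rw [← Real.exp_add]
    congr 1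
    field_simp
    ring
  rw [this]
  ring

/-- Integration by parts: the creation operator on one factor becomes the annihilation operator on
the other. Orthogonality follows by lowering both indices. -/
theorem integral_hermiteFun_succ_mul {ħ : ℝ} (h : 0 < ħ) (m n : ℕ) :
    ∫ x, hermiteFun ħ (m + 1) x * hermiteFun ħ n x =
      2 * ħ * n * ∫ x, hermiteFun ħ m x * hermiteFun ħ (n - 1) x := by
  have key : ∀ x, HasDerivAt (fun x => ħ * (hermiteFun ħ m x * hermiteFun ħ n x))
      (2 * ħ * n * (hermiteFun ħ m x * hermiteFun ħ (n - 1) x)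
        - hermiteFun ħ (m + 1) x * hermiteFun ħ n x) x := fun x => by
    refine (((hasDerivAt_hermiteFun' h m x).mul (hasDerivAt_hermiteFun h n x)).const_mul
      ħ).congr_deriv ?_
    field_simp
    ring
  have h1 := (integrable_hermiteFun_mul h m (n - 1)).const_mul (2 * ħ * n)
  have h2 := integrable_hermiteFun_mul h (m + 1) n
  have := integral_eq_zero_of_hasDerivAt_of_integrable key (h1.sub h2)
    ((integrable_hermiteFun_mul h m n).const_mul ħ)
  rw [integral_sub h1 h2, integral_const_mul] at this
  linarith

theorem integral_hermiteFun_mul {ħ : ℝ} (h : 0 < ħ) (m n : ℕ) :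
    ∫ x, hermiteFun ħ m x * hermiteFun ħ n x = if m = n then hermiteNormSq ħ n else 0 := by
  induction m generalizing n with
  | zero =>
    cases n with
    | zero =>
      have : ∀ x : ℝ, hermiteFun ħ 0 x * hermiteFun ħ 0 x = Real.exp (-(1 / ħ) * x ^ 2) := by
        intro x
        simp only [hermiteFun, hermitePoly, Polynomial.eval_one, one_mul, ← Real.exp_add]
        congr 1
        field_simp
        ring
      simp only [this, integral_gaussian]
      simp [hermiteNormSq]
    | succ n =>
      have := integral_hermiteFun_succ_mul h n 0
      simp only [mul_comm (hermiteFun ħ (n + 1) _)] at this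
      simp [this]
  | succ m ih =>
    rw [integral_hermiteFun_succ_mul h, ih]
    cases n with
    | zero => simp
    | succ n =>
      by_cases hmn : m = n
      · simp [hmn, hermiteNormSq, Nat.factorial_succ, pow_succ]
        ring
      · simp [hmn]

/-- The one-dimensional cross Wigner integrals of the Hermite functions. -/
def hermiteWigner (ħ x ξ : ℝ) (m n : ℕ) : ℂ :=
  ∫ v : ℝ, (hermiteFun ħ m (x + v / 2) * hermiteFun ħ n (x - v / 2) : ℝ) *
    Complex.exp (-(Complex.I / ħ) * (v * ξ : ℝ))

theorem norm_exp_phase (ħ t : ℝ) : ‖Complex.exp (-(Complex.I / ħ) * (t : ℂ))‖ = 1 := by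
  have : -(Complex.I / ħ) * (t : ℂ) = ((-(t / ħ) : ℝ) : ℂ) * Complex.I := by
    push_cast; ring
  rw [this, Complex.norm_exp_ofReal_mul_I]

theorem integrable_hermiteFun_mul_sub {ħ : ℝ} (h : 0 < ħ) (x : ℝ) (m n : ℕ) :
    Integrable fun v => hermiteFun ħ m (x + v / 2) * hermiteFun ħ n (x - v / 2) := by
  have := (integrable_eval_mul_exp_neg_mul_sq
    ((hermitePoly ħ m).comp (Polynomial.C x + Polynomial.C (1 / 2) * Polynomial.X) *
      (hermitePoly ħ n).comp (Polynomial.C x - Polynomial.C (1 / 2) * Polynomial.X))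
    (b := 1 / (4 * ħ)) (by positivity)).const_mul (Real.exp (-(x ^ 2 / ħ)))
  refine this.congr (ae_of_all _ fun v => ?_)
  simp only [hermiteFun, Polynomial.eval_mul, Polynomial.eval_comp, Polynomial.eval_add,
    Polynomial.eval_sub, Polynomial.eval_C, Polynomial.eval_X]
  have : Real.exp (-((x + v / 2) ^ 2 / (2 * ħ))) * Real.exp (-((x - v / 2) ^ 2 / (2 * ħ))) =
      Real.exp (-(x ^ 2 / ħ)) * Real.exp (-(1 / (4 * ħ)) * v ^ 2) := by
    rw [← Real.exp_add, ← Real.exp_add]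
    congr 1
    field_simp
    ring
  have e1 : x + 1 / 2 * v = x + v / 2 := by ring
  have e2 : x - 1 / 2 * v = x - v / 2 := by ring
  rw [e1, e2]
  linear_combination (-(hermitePoly ħ m).eval (x + v / 2) * (hermitePoly ħ n).eval (x - v / 2)) *
    this

theorem integrable_hermiteWigner {ħ : ℝ} (h : 0 < ħ) (x ξ : ℝ) (m n : ℕ) :
    Integrable fun v : ℝ => ((hermiteFun ħ m (x + v / 2) * hermiteFun ħ n (x - v / 2) : ℝ) : ℂ) *
      Complex.exp (-(Complex.I / ħ) * (v * ξ : ℝ)) := by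
  refine Integrable.mul_bdd (c := 1) (integrable_hermiteFun_mul_sub h x m n).ofReal ?_
    (ae_of_all _ fun v => (norm_exp_phase _ _).le)
  exact Continuous.aestronglyMeasurable (by fun_prop)

theorem hasDerivAt_exp_phase (ħ ξ v : ℝ) :
    HasDerivAt (fun v : ℝ => Complex.exp (-(Complex.I / ħ) * (v * ξ : ℝ)))
      (Complex.exp (-(Complex.I / ħ) * (v * ξ : ℝ)) * (-(Complex.I / ħ) * ξ)) v := by
  have h1 : HasDerivAt (fun v : ℝ => ((v * ξ : ℝ) : ℂ)) ((ξ : ℝ) : ℂ) v := by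
    simpa using ((hasDerivAt_id v).mul_const ξ).ofReal_comp
  simpa using (h1.const_mul (-(Complex.I / ħ))).cexp

/-- The integral of the derivative of `2ħ h_m(x + v/2) h_n(x - v/2) e^{-ivξ/ħ}` is zero.
Differentiating the left factor in creation form and the right one in annihilation form produces the
ladder relation. -/
theorem hermiteWigner_succ_left {ħ : ℝ} (h : 0 < ħ) (x ξ : ℝ) (m n : ℕ) :
    hermiteWigner ħ x ξ (m + 1) n = 2 * (x - Complex.I * ξ) * hermiteWigner ħ x ξ m n
      - 2 * ħ * n * hermiteWigner ħ x ξ m (n - 1) := by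
  have hħ : (ħ : ℂ) ≠ 0 := by exact_mod_cast h.ne'
  have key : ∀ v : ℝ, HasDerivAt (fun v : ℝ => 2 * (ħ : ℂ) *
        ((hermiteFun ħ m (x + v / 2) * hermiteFun ħ n (x - v / 2) : ℝ) *
          Complex.exp (-(Complex.I / ħ) * (v * ξ : ℝ))))
      (2 * (x - Complex.I * ξ) *
        ((hermiteFun ħ m (x + v / 2) * hermiteFun ħ n (x - v / 2) : ℝ) *
          Complex.exp (-(Complex.I / ħ) * (v * ξ : ℝ)))
        - 2 * ħ * n * ((hermiteFun ħ m (x + v / 2) * hermiteFun ħ (n - 1) (x - v / 2) : ℝ) *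
          Complex.exp (-(Complex.I / ħ) * (v * ξ : ℝ)))
        - ((hermiteFun ħ (m + 1) (x + v / 2) * hermiteFun ħ n (x - v / 2) : ℝ) *
          Complex.exp (-(Complex.I / ħ) * (v * ξ : ℝ)))) v := fun v => by
    have a1 : HasDerivAt (fun v : ℝ => x + v / 2) (1 / 2) v :=
      ((hasDerivAt_id v).div_const 2).const_add x
    have a2 : HasDerivAt (fun v : ℝ => x - v / 2) (-(1 / 2)) v :=
      ((hasDerivAt_id v).div_const 2).const_sub x
    have d1 := (hasDerivAt_hermiteFun' h m (x + v / 2)).comp v a1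
    have d2 := (hasDerivAt_hermiteFun h n (x - v / 2)).comp v a2
    refine (((d1.mul d2).ofReal_comp.mul (hasDerivAt_exp_phase ħ ξ v)).const_mul
      (2 * (ħ : ℂ))).congr_deriv ?_
    simp only [Function.comp, Pi.mul_apply]
    push_cast
    field_simp
    ring
  have i1 := (integrable_hermiteWigner h x ξ m n).const_mul (2 * (x - Complex.I * ξ))
  have i2 := (integrable_hermiteWigner h x ξ m (n - 1)).const_mul (2 * ħ * n : ℂ)
  have i3 := integrable_hermiteWigner h x ξ (m + 1) n
  have := integral_eq_zero_of_hasDerivAt_of_integrable key ((i1.sub i2).sub i3)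
    ((integrable_hermiteWigner h x ξ m n).const_mul (2 * (ħ : ℂ)))
  have e1 := integral_sub (i1.sub i2) i3
  have e2 := integral_sub i1 i2
  simp only [Pi.sub_apply] at e1 e2
  rw [e1, e2, integral_const_mul, integral_const_mul] at this
  simp only [hermiteWigner]
  linear_combination -this

theorem hermiteWigner_succ_right {ħ : ℝ} (h : 0 < ħ) (x ξ : ℝ) (m n : ℕ) :
    hermiteWigner ħ x ξ m (n + 1) = 2 * (x + Complex.I * ξ) * hermiteWigner ħ x ξ m n
      - 2 * ħ * m * hermiteWigner ħ x ξ (m - 1) n := by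
  have hħ : (ħ : ℂ) ≠ 0 := by exact_mod_cast h.ne'
  have key : ∀ v : ℝ, HasDerivAt (fun v : ℝ => 2 * (ħ : ℂ) *
        ((hermiteFun ħ m (x + v / 2) * hermiteFun ħ n (x - v / 2) : ℝ) *
          Complex.exp (-(Complex.I / ħ) * (v * ξ : ℝ))))
      (((hermiteFun ħ m (x + v / 2) * hermiteFun ħ (n + 1) (x - v / 2) : ℝ) *
          Complex.exp (-(Complex.I / ħ) * (v * ξ : ℝ)))
        - 2 * (x + Complex.I * ξ) *
        ((hermiteFun ħ m (x + v / 2) * hermiteFun ħ n (x - v / 2) : ℝ) *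
          Complex.exp (-(Complex.I / ħ) * (v * ξ : ℝ)))
        + 2 * ħ * m * ((hermiteFun ħ (m - 1) (x + v / 2) * hermiteFun ħ n (x - v / 2) : ℝ) *
          Complex.exp (-(Complex.I / ħ) * (v * ξ : ℝ)))) v := fun v => by
    have a1 : HasDerivAt (fun v : ℝ => x + v / 2) (1 / 2) v :=
      ((hasDerivAt_id v).div_const 2).const_add x
    have a2 : HasDerivAt (fun v : ℝ => x - v / 2) (-(1 / 2)) v :=
      ((hasDerivAt_id v).div_const 2).const_sub x
    have d1 := (hasDerivAt_hermiteFun h m (x + v / 2)).comp v a1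
    have d2 := (hasDerivAt_hermiteFun' h n (x - v / 2)).comp v a2
    refine (((d1.mul d2).ofReal_comp.mul (hasDerivAt_exp_phase ħ ξ v)).const_mul
      (2 * (ħ : ℂ))).congr_deriv ?_
    simp only [Function.comp, Pi.mul_apply]
    push_cast
    field_simp
    ring
  have i1 := integrable_hermiteWigner h x ξ m (n + 1)
  have i2 := (integrable_hermiteWigner h x ξ m n).const_mul (2 * (x + Complex.I * ξ))
  have i3 := (integrable_hermiteWigner h x ξ (m - 1) n).const_mul (2 * ħ * m : ℂ)
  have := integral_eq_zero_of_hasDerivAt_of_integrable key ((i1.sub i2).add i3)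
    ((integrable_hermiteWigner h x ξ m n).const_mul (2 * (ħ : ℂ)))
  have e1 := integral_add (i1.sub i2) i3
  have e2 := integral_sub i1 i2
  simp only [Pi.sub_apply] at e1 e2
  rw [e1, e2, integral_const_mul, integral_const_mul] at this
  simp only [hermiteWigner]
  linear_combination this

/-- The normalized diagonal Wigner integrals. -/
def diagWigner (ħ x ξ : ℝ) (n : ℕ) : ℂ := hermiteWigner ħ x ξ n n / (hermiteNormSq ħ n : ℝ)

theorem diagWigner_zero {ħ : ℝ} (h : 0 < ħ) (x ξ : ℝ) :
    diagWigner ħ x ξ 0 = 2 * Complex.exp (-((x ^ 2 + ξ ^ 2) / ħ)) := by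
  have e1 : hermiteWigner ħ x ξ 0 0 = Complex.exp (-(x ^ 2 / ħ)) *
      ∫ v : ℝ, Complex.exp (Complex.I * (-(ξ / ħ) : ℂ) * v) *
        Complex.exp (-(1 / (4 * ħ) : ℂ) * v ^ 2) := by
    rw [← integral_const_mul, hermiteWigner]
    congr 1
    funext v
    simp only [hermiteFun, hermitePoly, Polynomial.eval_one, one_mul]
    push_cast
    simp only [← Complex.exp_add]
    congr 1
    have hħ : (ħ : ℂ) ≠ 0 := by exact_mod_cast h.ne'
    field_simp
    ring
  have hre : (0 : ℝ) < (1 / (4 * ħ) : ℂ).re := by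
    have : (1 / (4 * ħ) : ℂ) = ((1 / (4 * ħ) : ℝ) : ℂ) := by push_cast; ring
    rw [this, Complex.ofReal_re]
    positivity
  rw [diagWigner, e1, fourierIntegral_gaussian hre]
  have hħ : (ħ : ℂ) ≠ 0 := by exact_mod_cast h.ne'
  have e2 : ((Real.pi : ℂ) / (1 / (4 * ħ))) ^ (1 / 2 : ℂ) = 2 * (√(Real.pi * ħ) : ℝ) := by
    have : ((Real.pi : ℂ) / (1 / (4 * ħ))) = ((2 ^ 2 * (Real.pi * ħ) : ℝ) : ℂ) := by
      push_cast; field_simp; ring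
    rw [this, show (1 / 2 : ℂ) = ((1 / 2 : ℝ) : ℂ) by push_cast; ring,
      ← Complex.ofReal_cpow (by positivity), ← Real.sqrt_eq_rpow, Real.sqrt_mul (by norm_num),
      Real.sqrt_sq (by norm_num)]
    push_cast; ring
  rw [e2]
  have e3 : ((√(Real.pi * ħ) : ℝ) : ℂ) ≠ 0 := by
    have := Real.pi_pos
    exact_mod_cast (Real.sqrt_pos.2 (by positivity)).ne'
  have e4 : Complex.exp (-((x ^ 2 + ξ ^ 2) / ħ)) =
      Complex.exp (-(x ^ 2 / ħ)) * Complex.exp (-(-(ξ / ħ) : ℂ) ^ 2 / (4 * (1 / (4 * ħ)))) := by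
    rw [← Complex.exp_add]
    congr 1
    field_simp
    ring
  rw [e4]
  simp only [hermiteNormSq, pow_zero, Nat.factorial_zero, Nat.cast_one, one_mul]
  field_simp

/-- The three-term recurrence of the Laguerre functions. -/
theorem diagWigner_succ {ħ : ℝ} (h : 0 < ħ) (x ξ : ℝ) (n : ℕ) :
    (n + 1 : ℂ) * diagWigner ħ x ξ (n + 1) =
      (2 * (x ^ 2 + ξ ^ 2) / ħ - (2 * n + 1)) * diagWigner ħ x ξ n - n * diagWigner ħ x ξ (n - 1) := by
  have hħ : (ħ : ℂ) ≠ 0 := by exact_mod_cast h.ne'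
  have hν : ∀ n, ((hermiteNormSq ħ n : ℝ) : ℂ) ≠ 0 := fun n => by
    exact_mod_cast (hermiteNormSq_pos h n).ne'
  have hs : ∀ n : ℕ, ((hermiteNormSq ħ (n + 1) : ℝ) : ℂ) =
      2 * ħ * (n + 1) * (hermiteNormSq ħ n : ℝ) := fun n => by
    simp only [hermiteNormSq, Nat.factorial_succ, pow_succ]; push_cast; ring
  have h1 := hermiteWigner_succ_left h x ξ n (n + 1)
  have h2 := hermiteWigner_succ_right h x ξ n n
  have hI := Complex.I_sq
  have h3 : hermiteWigner ħ x ξ (n + 1) (n + 1) =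
      (4 * (x ^ 2 + ξ ^ 2) - 2 * ħ * (2 * n + 1)) * hermiteWigner ħ x ξ n n
        - 4 * ħ ^ 2 * n ^ 2 * hermiteWigner ħ x ξ (n - 1) (n - 1) := by
    rw [h1, h2]
    cases n with
    | zero =>
      simp only [zero_add, Nat.cast_zero, Nat.cast_one]
      linear_combination (-4 * (ξ : ℂ) ^ 2 * hermiteWigner ħ x ξ 0 0) * hI
    | succ k =>
      -- Raising both indices leaves one off-diagonal term. This relation, one degree lower,
      -- expresses its product with `x - iξ` through diagonal integrals.
      have h4 := hermiteWigner_succ_left h x ξ k (k + 1)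
      simp only [Nat.add_sub_cancel] at h4 ⊢
      push_cast at h4 ⊢
      linear_combination (-4 * (ξ : ℂ) ^ 2 * hermiteWigner ħ x ξ (k + 1) (k + 1)) * hI
        + (2 * ħ * (k + 1)) * h4
  have hn : (n + 1 : ℂ) ≠ 0 := by exact_mod_cast n.succ_ne_zero
  simp only [diagWigner]
  rw [h3, hs]
  cases n with
  | zero =>
    have := hν 0
    simp only [Nat.cast_zero]
    field_simp
    ring
  | succ k =>
    have := hν k
    have hk : (k + 1 : ℂ) ≠ 0 := by exact_mod_cast k.succ_ne_zero
    push_cast at hn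
    simp only [Nat.add_sub_cancel, hs k]
    push_cast
    field_simp
    ring

/-! ### Gaussians and products of Hermite functions as Schwartz functions -/

theorem one_add_pow_mul_exp_neg_le {ħ : ℝ} (h : 0 < ħ) (p : ℕ) {r : ℝ} (hr : 0 ≤ r) :
    (1 + r) ^ p * Real.exp (-(r ^ 2 / (2 * ħ))) ≤ p.factorial * Real.exp (1 + ħ / 2) := by
  have h1 : (1 + r) ^ p ≤ p.factorial * Real.exp (1 + r) := by
    have := Real.pow_div_factorial_le_exp (1 + r) (by positivity) p
    rwa [div_le_iff₀' (by positivity)] at this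
  have h2 : r - r ^ 2 / (2 * ħ) ≤ ħ / 2 := by
    rw [sub_le_iff_le_add, ← sub_nonneg]
    have : ħ / 2 + r ^ 2 / (2 * ħ) - r = (ħ - r) ^ 2 / (2 * ħ) := by field_simp; ring
    rw [this]
    positivity
  calc _ ≤ p.factorial * Real.exp (1 + r) * Real.exp (-(r ^ 2 / (2 * ħ))) := by gcongr
    _ = p.factorial * Real.exp (1 + (r - r ^ 2 / (2 * ħ))) := by
      rw [mul_assoc, ← Real.exp_add]; congr 2; ring
    _ ≤ _ := by gcongr

/-- The Gaussian is the exponential of a function of temperate growth, so the Faà di Bruno bound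
makes every derivative at most a polynomial times the Gaussian itself. -/
theorem exp_neg_norm_sq_decay {V : Type*} [NormedAddCommGroup V] [InnerProductSpace ℝ V] {ħ : ℝ}
    (h : 0 < ħ) (k n : ℕ) :
    ∃ C, ∀ x : V, ‖x‖ ^ k *
      ‖iteratedFDeriv ℝ n (fun x : V => Real.exp (-(‖x‖ ^ 2 / (2 * ħ)))) x‖ ≤ C := by
  have hq : (fun x : V => -((2 * ħ)⁻¹ * ‖x‖ ^ 2)).HasTemperateGrowth := by fun_prop
  obtain ⟨k₀, C₀, hC₀, hb⟩ := hq.norm_iteratedFDeriv_le_uniform n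
  have hfun : (fun x : V => Real.exp (-(‖x‖ ^ 2 / (2 * ħ)))) =
      Real.exp ∘ fun x : V => -((2 * ħ)⁻¹ * ‖x‖ ^ 2) := by
    funext x; simp only [Function.comp]; congr 1; field_simp
  refine ⟨n.factorial * (1 + C₀) ^ n * ((k + k₀ * n).factorial * Real.exp (1 + ħ / 2)),
    fun x => ?_⟩
  have h1 : ‖iteratedFDeriv ℝ n (Real.exp ∘ fun x : V => -((2 * ħ)⁻¹ * ‖x‖ ^ 2)) x‖ ≤
      n.factorial * Real.exp (-((2 * ħ)⁻¹ * ‖x‖ ^ 2)) * ((1 + C₀) * (1 + ‖x‖) ^ k₀) ^ n := by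
    refine norm_iteratedFDeriv_comp_le (N := n) Real.contDiff_exp
      (hq.1.of_le (by exact_mod_cast le_top)) le_rfl x (fun i _ => ?_) (fun i hi hin => ?_)
    · rw [norm_iteratedFDeriv_eq_norm_iteratedDeriv, iteratedDeriv_eq_iterate, Real.iter_deriv_exp,
        Real.norm_eq_abs, abs_of_pos (Real.exp_pos _)]
    -- The composition bound asks for the `i`-th power of a common base; since the base is at least
    -- 1 and `i ≥ 1`, the first power suffices.
    · have hone : 1 ≤ (1 + ‖x‖) ^ k₀ := one_le_pow₀ (by linarith [norm_nonneg x])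
      refine (hb i hin x).trans (le_trans ?_ (le_self_pow₀ ?_ (by omega)))
      · gcongr; linarith
      · nlinarith
  rw [hfun]
  have h2 := one_add_pow_mul_exp_neg_le h (k + k₀ * n) (norm_nonneg x)
  have h3 : ‖x‖ ^ k ≤ (1 + ‖x‖) ^ k := by gcongr; linarith
  calc _ ≤ (1 + ‖x‖) ^ k * (n.factorial * Real.exp (-((2 * ħ)⁻¹ * ‖x‖ ^ 2)) *
        ((1 + C₀) * (1 + ‖x‖) ^ k₀) ^ n) := by gcongr
    _ = n.factorial * (1 + C₀) ^ n *
        ((1 + ‖x‖) ^ (k + k₀ * n) * Real.exp (-(‖x‖ ^ 2 / (2 * ħ)))) := by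
      rw [show (2 * ħ)⁻¹ * ‖x‖ ^ 2 = ‖x‖ ^ 2 / (2 * ħ) by field_simp, mul_pow, pow_add, pow_mul]
      ring
    _ ≤ _ := by gcongr

/-- The Gaussian `e^{-‖x‖²/2ħ}` as a Schwartz function. -/
def gaussianSchwartz (V : Type*) [NormedAddCommGroup V] [InnerProductSpace ℝ V] {ħ : ℝ}
    (h : 0 < ħ) : 𝓢(V, ℂ) :=
  SchwartzMap.postcompCLM Complex.ofRealCLM
    { toFun := fun x : V => Real.exp (-(‖x‖ ^ 2 / (2 * ħ)))
      smooth' := by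
        have : ContDiff ℝ ((⊤ : ℕ∞) : WithTop ℕ∞) (fun x : V => ‖x‖ ^ 2) := contDiff_norm_sq ℝ
        fun_prop
      decay' := exp_neg_norm_sq_decay h }

theorem gaussianSchwartz_apply {V : Type*} [NormedAddCommGroup V] [InnerProductSpace ℝ V] {ħ : ℝ}
    (h : 0 < ħ) (x : V) :
    gaussianSchwartz V h x = (Real.exp (-(‖x‖ ^ 2 / (2 * ħ))) : ℝ) := rfl

theorem hasTemperateGrowth_eval (P : Polynomial ℝ) :
    (fun x : ℝ => P.eval x).HasTemperateGrowth := by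
  induction P using Polynomial.induction_on' with
  | add p q hp hq =>
    simp only [Polynomial.eval_add]
    exact hp.fun_add hq
  | monomial n a =>
    simp only [Polynomial.eval_monomial]
    fun_prop

theorem hasTemperateGrowth_prod {V ι : Type*} [NormedAddCommGroup V] [NormedSpace ℝ V]
    (s : Finset ι) (f : ι → V → ℝ) (hf : ∀ i, (f i).HasTemperateGrowth) :
    (fun x => ∏ i ∈ s, f i x).HasTemperateGrowth := by
  classical
  induction s using Finset.induction_on with
  | empty => simp
  | insert i s hi ih =>
    simp only [Finset.prod_insert hi]
    exact (hf i).fun_mul ih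

variable {d : ℕ}

theorem hasTemperateGrowth_coord (j : Fin d) : (fun x : Config d => x j).HasTemperateGrowth :=
  (EuclideanSpace.proj j : Config d →L[ℝ] ℝ).hasTemperateGrowth

/-- The product `∏_j h_{n_j}(x_j)` of Hermite functions. -/
def multiHermite (ħ : ℝ) (n : Fin d → ℕ) (x : Config d) : ℝ := ∏ j, hermiteFun ħ (n j) (x j)

/-- The product of Hermite functions as a Schwartz function. -/
def hermiteSchwartz {ħ : ℝ} (h : 0 < ħ) (n : Fin d → ℕ) : 𝓢(Config d, ℂ) :=
  SchwartzMap.smulLeftCLM ℂ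
    (fun x : Config d => ((∏ j, (hermitePoly ħ (n j)).eval (x j) : ℝ) : ℂ))
    (gaussianSchwartz (Config d) h)

theorem hermiteSchwartz_apply {ħ : ℝ} (h : 0 < ħ) (n : Fin d → ℕ) (x : Config d) :
    hermiteSchwartz h n x = (multiHermite ħ n x : ℝ) := by
  have hg : (fun x : Config d =>
      ((∏ j, (hermitePoly ħ (n j)).eval (x j) : ℝ) : ℂ)).HasTemperateGrowth := by
    have h0 := hasTemperateGrowth_prod Finset.univ
      (fun j (x : Config d) => (hermitePoly ħ (n j)).eval (x j))
      fun j => (hasTemperateGrowth_eval _).comp (hasTemperateGrowth_coord j)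
    exact Complex.ofRealCLM.hasTemperateGrowth.comp h0
  rw [hermiteSchwartz, SchwartzMap.smulLeftCLM_apply_apply hg, gaussianSchwartz_apply, smul_eq_mul,
    ← Complex.ofReal_mul, multiHermite]
  simp only [hermiteFun, Finset.prod_mul_distrib, ← Real.exp_sum]
  congr 3
  rw [EuclideanSpace.real_norm_sq_eq, Finset.sum_div, Finset.sum_neg_distrib]

theorem prod_update_eq {M : Type*} [CommMonoid M] (u : ℕ → Fin d → M) (n : Fin d → ℕ) (j : Fin d)
    (k : ℕ) :
    ∏ i, u (Function.update n j k i) i = u k j * ∏ i ∈ Finset.univ.erase j, u (n i) i := by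
  rw [← Finset.mul_prod_erase _ _ (Finset.mem_univ j), Function.update_self]
  congr 1
  refine Finset.prod_congr rfl fun i hi => ?_
  rw [Function.update_of_ne (Finset.ne_of_mem_erase hi)]

theorem multiHermite_update (ħ : ℝ) (n : Fin d → ℕ) (j : Fin d) (k : ℕ) (x : Config d) :
    multiHermite ħ (Function.update n j k) x =
      hermiteFun ħ k (x j) * ∏ i ∈ Finset.univ.erase j, hermiteFun ħ (n i) (x i) :=
  prod_update_eq (fun k i => hermiteFun ħ k (x i)) n j k

theorem coord_mul_multiHermite (ħ : ℝ) (n : Fin d → ℕ) (j : Fin d) (x : Config d) :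
    x j * multiHermite ħ n x = multiHermite ħ (Function.update n j (n j + 1)) x / 2 +
      ħ * n j * multiHermite ħ (Function.update n j (n j - 1)) x := by
  conv_lhs => rw [← Function.update_eq_self j n]
  simp only [multiHermite_update, hermiteFun_succ]
  ring

theorem hasLineDerivAt_multiHermite {ħ : ℝ} (h : 0 < ħ) (n : Fin d → ℕ) (j : Fin d)
    (x : Config d) :
    HasLineDerivAt ℝ (fun x => ((multiHermite ħ n x : ℝ) : ℂ))
      ((n j * multiHermite ħ (Function.update n j (n j - 1)) x -
        (2 * ħ)⁻¹ * multiHermite ħ (Function.update n j (n j + 1)) x : ℝ) : ℂ) x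
      (EuclideanSpace.basisFun (Fin d) ℝ j) := by
  have hline : ∀ t : ℝ, multiHermite ħ n (x + t • EuclideanSpace.basisFun (Fin d) ℝ j) =
      hermiteFun ħ (n j) (x j + t) * ∏ i ∈ Finset.univ.erase j, hermiteFun ħ (n i) (x i) := by
    intro t
    conv_lhs => rw [← Function.update_eq_self j n]
    rw [multiHermite_update]
    congr 1
    · simp
    · refine Finset.prod_congr rfl fun i hi => ?_
      have : i ≠ j := Finset.ne_of_mem_erase hi
      simp [this]
  rw [HasLineDerivAt]
  simp only [hline]
  have h1 : HasDerivAt (fun t : ℝ => x j + t) 1 0 := (hasDerivAt_id (0 : ℝ)).const_add (x j)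
  have h2 := ((hasDerivAt_hermiteFun h (n j) (x j + 0)).comp (0 : ℝ) h1).mul_const
    (∏ i ∈ Finset.univ.erase j, hermiteFun ħ (n i) (x i))
  refine h2.ofReal_comp.congr_deriv ?_
  congr 1
  simp only [multiHermite_update, hermiteFun_succ, add_zero, mul_one]
  field_simp
  ring

open LineDeriv Laplacian in
theorem lineDerivOp_hermiteSchwartz {ħ : ℝ} (h : 0 < ħ) (n : Fin d → ℕ) (j : Fin d) :
    ∂_{EuclideanSpace.basisFun (Fin d) ℝ j} (hermiteSchwartz h n) =
      (n j : ℂ) • hermiteSchwartz h (Function.update n j (n j - 1)) +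
        (-(2 * ħ : ℂ)⁻¹) • hermiteSchwartz h (Function.update n j (n j + 1)) := by
  ext x
  rw [SchwartzMap.lineDerivOp_apply]
  have : (hermiteSchwartz h n : Config d → ℂ) = fun x => ((multiHermite ħ n x : ℝ) : ℂ) :=
    funext (hermiteSchwartz_apply h n)
  rw [this, (hasLineDerivAt_multiHermite h n j x).lineDeriv]
  simp [hermiteSchwartz_apply, sub_eq_add_neg]

open LineDeriv Laplacian in
-- The identity splits over coordinates. Applying the ladder relations twice to `∂_j²` and to `x_j²`
-- gives terms in `n_j ± 2`, which cancel, and a diagonal term `ħ(n_j + 1/2)`.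
theorem laplacian_hermiteSchwartz_apply {ħ : ℝ} (h : 0 < ħ) (n : Fin d → ℕ) (x : Config d) :
    (-((ħ : ℂ) ^ 2 / 2)) * (Δ (hermiteSchwartz h n)) x + potential d x * hermiteSchwartz h n x =
      (ħ * (∑ j, n j + d / 2) : ℂ) * hermiteSchwartz h n x := by
  have hħ : (ħ : ℂ) ≠ 0 := by exact_mod_cast h.ne'
  have hp : potential d x = ∑ j, ((x j : ℂ) ^ 2 / 2) := by
    simp only [potential, EuclideanSpace.real_norm_sq_eq]
    push_cast
    rw [Finset.sum_div]
  have hd : (ħ * (∑ j, n j + d / 2) : ℂ) = ∑ j, (ħ * (n j + 1 / 2) : ℂ) := by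
    rw [← Finset.mul_sum, Finset.sum_add_distrib]
    congr 1
    simp
    ring
  rw [SchwartzMap.laplacian_eq_sum (EuclideanSpace.basisFun (Fin d) ℝ), hp, hd,
    sum_apply, Finset.mul_sum, Finset.sum_mul, Finset.sum_mul,
    ← Finset.sum_add_distrib]
  refine Finset.sum_congr rfl fun j _ => ?_
  have e1 := coord_mul_multiHermite ħ n j x
  have e2 := coord_mul_multiHermite ħ (Function.update n j (n j + 1)) j x
  have e3 := coord_mul_multiHermite ħ (Function.update n j (n j - 1)) j x
  rw [lineDerivOp_hermiteSchwartz, lineDerivOp_add, lineDerivOp_smul, lineDerivOp_smul,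
    lineDerivOp_hermiteSchwartz, lineDerivOp_hermiteSchwartz]
  simp only [Function.update_idem, Function.update_self, Nat.add_sub_cancel,
    Function.update_eq_self, add_apply, smul_apply,
    hermiteSchwartz_apply, smul_eq_mul] at e1 e2 e3 ⊢
  -- Truncated subtraction is harmless: when `n_j = 0` the factor `n_j` annihilates the term.
  have e4 : (n j : ℝ) * multiHermite ħ (Function.update n j (n j - 1 + 1)) x =
      n j * multiHermite ħ n x := by
    rcases Nat.eq_zero_or_pos (n j) with h0 | h0
    · simp [h0]
    · rw [Nat.sub_add_cancel h0, Function.update_eq_self]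
  have e5 : (n j : ℝ) * ((n j - 1 : ℕ) : ℝ) = n j * (n j - 1) := by
    rcases Nat.eq_zero_or_pos (n j) with h0 | h0
    · simp [h0]
    · rw [Nat.cast_sub h0]; simp
  have e6 : (x j) ^ 2 * multiHermite ħ n x =
      multiHermite ħ (Function.update n j (n j + 1 + 1)) x / 4 +
        ħ * (n j + 1) / 2 * multiHermite ħ n x + ħ / 2 * (n j * multiHermite ħ n x) +
        ħ ^ 2 * (n j * ((n j - 1 : ℕ) : ℝ)) *
          multiHermite ħ (Function.update n j (n j - 1 - 1)) x := by
    push_cast at e2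
    linear_combination x j * e1 + (1 / 2) * e2 + ħ * n j * e3 + ħ / 2 * e4
  have e4' := congrArg (Complex.ofReal) e4
  have e6' := congrArg (Complex.ofReal) e6
  push_cast at e4' e6' ⊢
  generalize ((multiHermite ħ (Function.update n j (n j - 1 + 1)) x : ℝ) : ℂ) = A at *
  generalize ((multiHermite ħ (Function.update n j (n j - 1 - 1)) x : ℝ) : ℂ) = B at *
  generalize ((multiHermite ħ (Function.update n j (n j + 1 + 1)) x : ℝ) : ℂ) = D at *
  generalize ((multiHermite ħ n x : ℝ) : ℂ) = F at *
  generalize (((n j - 1 : ℕ) : ℂ)) = m at *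
  field_simp
  linear_combination 4 * e6' + 2 * ħ * e4'

open LineDeriv Laplacian in
/-- The Hermite functions are eigenfunctions of the oscillator. -/
theorem oscillator_hermiteSchwartz {ħ : ℝ} (h : 0 < ħ) (n : Fin d → ℕ) :
    (-((ħ : ℂ) ^ 2 / 2)) • Δ (hermiteSchwartz h n) +
      SchwartzMap.smulLeftCLM ℂ (potential d) (hermiteSchwartz h n) =
      (ħ * (∑ j, n j + d / 2) : ℂ) • hermiteSchwartz h n := by
  ext x
  rw [add_apply, smul_apply, smul_apply,
    SchwartzMap.smulLeftCLM_apply_apply (potential_hasTemperateGrowth d)]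
  exact laplacian_hermiteSchwartz_apply h n x

/-! ### Eigenspaces and totality of the Hermite functions -/

/-- Members of an eigenspace, by pairing with Schwartz functions. -/
theorem mem_eigenspace_iff_integral (ħ e : ℝ) (ψ : L2 d) :
    ψ ∈ eigenspace d ħ e ↔ ∀ g : 𝓢(Config d, ℂ),
      ∫ x, ((-((ħ : ℂ) ^ 2 / 2)) • Laplacian.laplacian g +
        SchwartzMap.smulLeftCLM ℂ (potential d) g) x * ψ x = e * ∫ x, g x * ψ x := by
  rw [mem_eigenspace]
  have key : ∀ g : 𝓢(Config d, ℂ), oscillator d ħ (Lp.toTemperedDistribution ψ) g =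
      ∫ x, ((-((ħ : ℂ) ^ 2 / 2)) • Laplacian.laplacian g +
        SchwartzMap.smulLeftCLM ℂ (potential d) g) x * ψ x := fun g => by
    have h1 : oscillator d ħ (Lp.toTemperedDistribution ψ) g = Lp.toTemperedDistribution ψ
        ((-((ħ : ℂ) ^ 2 / 2)) • Laplacian.laplacian g +
          SchwartzMap.smulLeftCLM ℂ (potential d) g) := by
      simp only [oscillator, map_add, map_smul]
      simp
    rw [h1, Lp.toTemperedDistribution_apply]
    simp only [smul_eq_mul]
  constructor
  · intro h g
    rw [← key, h]
    simp
  · intro h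
    ext g
    rw [key, h]
    simp

/-- Multiplication by a linear form, as an operator on Schwartz functions. -/
def innerMul (w : Config d) : 𝓢(Config d, ℂ) →L[ℂ] 𝓢(Config d, ℂ) :=
  SchwartzMap.smulLeftCLM ℂ (fun x : Config d => ((inner ℝ w x : ℝ) : ℂ))

theorem innerMul_apply (w : Config d) (g : 𝓢(Config d, ℂ)) (x : Config d) :
    innerMul w g x = (inner ℝ w x : ℝ) * g x := by
  have : (fun x : Config d => ((inner ℝ w x : ℝ) : ℂ)).HasTemperateGrowth :=
    Complex.ofRealCLM.hasTemperateGrowth.comp (Function.hasTemperateGrowth_inner_right w)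
  rw [innerMul, SchwartzMap.smulLeftCLM_apply_apply this, smul_eq_mul]

theorem innerMul_pow_apply (w : Config d) (k : ℕ) (g : 𝓢(Config d, ℂ)) (x : Config d) :
    (innerMul w ^ k) g x = (inner ℝ w x : ℝ) ^ k * g x := by
  induction k generalizing g with
  | zero => simp
  | succ k ih =>
    rw [pow_succ, mul_apply_eq_comp, ih, innerMul_apply]
    ring

theorem innerMul_hermiteSchwartz {ħ : ℝ} (h : 0 < ħ) (w : Config d) (n : Fin d → ℕ) :
    innerMul w (hermiteSchwartz h n) = ∑ j, ((w j / 2 : ℂ) •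
      hermiteSchwartz h (Function.update n j (n j + 1)) +
        (w j * (ħ * n j) : ℂ) • hermiteSchwartz h (Function.update n j (n j - 1))) := by
  ext x
  rw [innerMul_apply, sum_apply, PiLp.inner_apply]
  push_cast
  rw [Finset.sum_mul]
  refine Finset.sum_congr rfl fun j _ => ?_
  simp only [Pi.add_apply, Pi.smul_apply, hermiteSchwartz_apply, smul_eq_mul]
  have := congrArg Complex.ofReal (coord_mul_multiHermite ħ n j x)
  push_cast at this
  simp only [RCLike.inner_apply, conj_trivial, Complex.ofReal_mul]
  linear_combination (w j : ℂ) * this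

/-- Multiplication by a linear form sends a Hermite product to a combination of its neighbours, so
orthogonality to all of them survives any power of the linear form. -/
theorem integral_innerMul_pow_hermiteSchwartz {ħ : ℝ} (h : 0 < ħ) {ψ : L2 d}
    (hψ : ∀ n : Fin d → ℕ, ∫ x, (multiHermite ħ n x : ℝ) * ψ x = 0) (w : Config d) (k : ℕ)
    (n : Fin d → ℕ) : Lp.toTemperedDistribution ψ ((innerMul w ^ k) (hermiteSchwartz h n)) = 0 := by
  induction k generalizing n with
  | zero =>
    rw [pow_zero, one_apply_eq_self, Lp.toTemperedDistribution_apply]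
    simpa [hermiteSchwartz_apply] using hψ n
  | succ k ih =>
    rw [pow_succ, mul_apply_eq_comp, innerMul_hermiteSchwartz, map_sum, map_sum]
    refine Finset.sum_eq_zero fun j _ => ?_
    rw [map_add, map_add, map_smul, map_smul, map_smul, map_smul, ih, ih]
    simp

theorem exp_mul_gaussian_le {ħ : ℝ} (h : 0 < ħ) (c r : ℝ) :
    Real.exp (c * r) * Real.exp (-(r ^ 2 / (2 * ħ))) ≤
      Real.exp (ħ * c ^ 2) * Real.exp (-(r ^ 2 / (2 * (2 * ħ)))) := by
  rw [← Real.exp_add, ← Real.exp_add, Real.exp_le_exp, ← sub_nonneg]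
  have : ħ * c ^ 2 + -(r ^ 2 / (2 * (2 * ħ))) - (c * r + -(r ^ 2 / (2 * ħ))) =
      (2 * ħ * c - r) ^ 2 / (4 * ħ) := by field_simp; ring
  rw [this]
  positivity

/-- Completing the square absorbs the exponential at the cost of doubling ħ in the Gaussian; what
remains is a product of two `L²` functions. This is the dominating function for the exponential
series below. -/
theorem integrable_exp_mul_gaussian_mul {ħ : ℝ} (h : 0 < ħ) (ψ : L2 d) (c : ℝ) (w : Config d) :
    Integrable fun x => Real.exp (|c * inner ℝ w x|) *
      (Real.exp (-(‖x‖ ^ 2 / (2 * ħ))) * ‖ψ x‖) := by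
  have h2 : (0 : ℝ) < 2 * ħ := by positivity
  have i1 : Integrable fun x => gaussianSchwartz (Config d) h2 x * ψ x :=
    ((gaussianSchwartz (Config d) h2).memLp 2 volume).integrable_mul (Lp.memLp ψ)
  refine Integrable.mono' (i1.norm.const_mul (Real.exp (ħ * (|c| * ‖w‖) ^ 2))) ?_
    (ae_of_all _ fun x => ?_)
  · refine Continuous.aestronglyMeasurable (by fun_prop) |>.mul ?_
    exact (Continuous.aestronglyMeasurable (by fun_prop)).mul
      (Lp.aestronglyMeasurable ψ).norm
  · rw [norm_mul, norm_mul, norm_norm, Real.norm_of_nonneg (Real.exp_pos _).le,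
      Real.norm_of_nonneg (Real.exp_pos _).le, norm_mul, gaussianSchwartz_apply,
      Complex.norm_real, Real.norm_of_nonneg (Real.exp_pos _).le, ← mul_assoc, ← mul_assoc]
    refine mul_le_mul_of_nonneg_right ?_ (norm_nonneg _)
    refine le_trans ?_ (exp_mul_gaussian_le h (|c| * ‖w‖) ‖x‖)
    gcongr
    rw [abs_mul, mul_assoc]
    gcongr
    exact abs_real_inner_le_norm w x

theorem multiHermite_zero (ħ : ℝ) (x : Config d) :
    multiHermite ħ 0 x = Real.exp (-(‖x‖ ^ 2 / (2 * ħ))) := by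
  simp only [multiHermite, hermiteFun, hermitePoly, Polynomial.eval_one, one_mul,
    ← Real.exp_sum]
  rw [EuclideanSpace.real_norm_sq_eq, Finset.sum_div, Finset.sum_neg_distrib]

/-- The exponential is expanded in its power series under the integral; every term is a moment of ψ
against a power of a linear form times the Gaussian, hence zero. -/
theorem integral_exp_mul_gaussian_mul_eq_zero {ħ : ℝ} (h : 0 < ħ) {ψ : L2 d}
    (hψ : ∀ n : Fin d → ℕ, ∫ x, (multiHermite ħ n x : ℝ) * ψ x = 0) (c : ℝ) (w : Config d) :
    ∫ x, Complex.exp ((c * inner ℝ w x : ℝ) * Complex.I) *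
      ((Real.exp (-(‖x‖ ^ 2 / (2 * ħ))) : ℝ) * ψ x) = 0 := by
  have hs := hasSum_integral_of_dominated_convergence (μ := (volume : Measure (Config d)))
    (F := fun (k : ℕ) x => ((c * inner ℝ w x : ℝ) * Complex.I) ^ k / k.factorial *
      ((Real.exp (-(‖x‖ ^ 2 / (2 * ħ))) : ℝ) * ψ x))
    (f := fun x => Complex.exp ((c * inner ℝ w x : ℝ) * Complex.I) *
      ((Real.exp (-(‖x‖ ^ 2 / (2 * ħ))) : ℝ) * ψ x))
    (fun k x => |c * inner ℝ w x| ^ k / k.factorial * (Real.exp (-(‖x‖ ^ 2 / (2 * ħ))) * ‖ψ x‖))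
    (fun k => ?_) (fun k => ae_of_all _ fun x => ?_) (ae_of_all _ fun x => ?_) ?_
    (ae_of_all _ fun x => ?_)
  · refine hs.unique ?_
    convert hasSum_zero with k
    have h1 := integral_innerMul_pow_hermiteSchwartz h hψ w k 0
    rw [Lp.toTemperedDistribution_apply] at h1
    have h2 : ∀ x, ((c * inner ℝ w x : ℝ) * Complex.I) ^ k / k.factorial *
        ((Real.exp (-(‖x‖ ^ 2 / (2 * ħ))) : ℝ) * ψ x) = (c * Complex.I) ^ k / k.factorial *
          ((innerMul w ^ k) (hermiteSchwartz h 0) x • ψ x) := fun x => by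
      rw [innerMul_pow_apply, hermiteSchwartz_apply, multiHermite_zero, smul_eq_mul]
      push_cast
      ring
    simp only [h2]
    rw [integral_const_mul, h1, mul_zero]
  · refine (Continuous.aestronglyMeasurable (by fun_prop)).mul ?_
    exact (Continuous.aestronglyMeasurable (by fun_prop)).mul (Lp.aestronglyMeasurable ψ)
  · rw [norm_mul, norm_div, norm_pow, norm_mul, Complex.norm_I, mul_one, Complex.norm_real,
      Real.norm_eq_abs, norm_mul, Complex.norm_real, Real.norm_of_nonneg (Real.exp_pos _).le]
    simp
  · exact (Real.summable_pow_div_factorial _).mul_right _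
  · refine (integrable_exp_mul_gaussian_mul h ψ c w).congr (ae_of_all _ fun x => ?_)
    simp only
    rw [tsum_mul_right, Real.exp_eq_exp_ℝ, NormedSpace.exp_eq_tsum_div]
  · refine HasSum.mul_right _ ?_
    rw [Complex.exp_eq_exp_ℂ]
    exact NormedSpace.expSeries_div_hasSum_exp _

/-- A function whose Fourier transform vanishes is zero. -/
theorem ae_eq_zero_of_fourier_eq_zero {u : Config d → ℂ} (hu : Integrable u)
    (h0 : ∀ w : Config d, ∫ x, Complex.exp ((-(2 * Real.pi) * inner ℝ w x : ℝ) * Complex.I) * u x = 0) :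
    u =ᵐ[volume] 0 := by
  have hF : ∀ w, FourierTransform.fourier u w = 0 := fun w => by
    rw [Real.fourier_eq, ← h0 w]
    congr 1
    funext x
    rw [Circle.smul_def, Real.fourierChar_apply, smul_eq_mul, real_inner_comm]
    congr 3
    push_cast
    ring
  refine ae_eq_zero_of_integral_contDiff_smul_eq_zero hu.locallyIntegrable fun g hg hc => ?_
  have hc' : HasCompactSupport (Complex.ofRealCLM ∘ g) := hc.comp_left rfl
  have hg' : ContDiff ℝ ((⊤ : ℕ∞) : WithTop ℕ∞) (Complex.ofRealCLM ∘ g) := by fun_prop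
  set G : 𝓢(Config d, ℂ) := hc'.toSchwartzMap hg'
  set k : 𝓢(Config d, ℂ) := FourierTransformInv.fourierInv G
  have hk : (FourierTransform.fourier (k : Config d → ℂ)) = G := by
    rw [← SchwartzMap.fourier_coe, FourierTransform.fourier_fourierInv_eq]
  -- The test function is itself a Fourier transform, of `k`; the transform is moved from `k` onto
  -- `u`, where it vanishes.
  have := VectorFourier.integral_fourierIntegral_smul_eq_flip (L := innerₗ (Config d))
    (μ := volume) (ν := volume) (e := Real.fourierChar) Real.continuous_fourierChar continuous_inner
    k.integrable hu
  have e1 : ∫ x, G x • u x = ∫ x, k x • FourierTransform.fourier u x := by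
    rw [← hk]
    simpa using! this
  simp only [hF, smul_zero, integral_zero] at e1
  rw [← e1]
  congr 1

/-- The Hermite functions are total in `L²`. -/
theorem eq_zero_of_integral_multiHermite {ħ : ℝ} (h : 0 < ħ) {ψ : L2 d}
    (hψ : ∀ n : Fin d → ℕ, ∫ x, (multiHermite ħ n x : ℝ) * ψ x = 0) : ψ = 0 := by
  have hi : Integrable fun x => (Real.exp (-(‖x‖ ^ 2 / (2 * ħ))) : ℝ) * ψ x := by
    have := ((gaussianSchwartz (Config d) h).memLp 2 volume).integrable_mul (Lp.memLp ψ)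
    exact this
  have := ae_eq_zero_of_fourier_eq_zero hi fun w =>
    integral_exp_mul_gaussian_mul_eq_zero h hψ (-(2 * Real.pi)) w
  rw [Lp.eq_zero_iff_ae_eq_zero]
  filter_upwards [this] with x hx
  simpa [(Real.exp_pos _).ne'] using hx

/-! ### Eigenprojections and their continuous kernels -/

theorem integral_config_prod (u : Fin d → ℝ → ℂ) :
    ∫ x : Config d, ∏ j, u j (x j) = ∏ j, ∫ t, u j t := by
  rw [← integral_fintype_prod_volume_eq_prod,
    ← (PiLp.volume_preserving_ofLp (Fin d)).integral_comp (MeasurableEquiv.toLp 2 _).symm.measurableEmbedding]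

theorem integrable_config_prod {u : Fin d → ℝ → ℂ} (hu : ∀ j, Integrable (u j)) :
    Integrable fun x : Config d => ∏ j, u j (x j) := by
  have := Integrable.fintype_prod (μ := fun _ => (volume : Measure ℝ)) hu
  exact ((PiLp.volume_preserving_ofLp (Fin d)).integrable_comp_emb
    (MeasurableEquiv.toLp 2 _).symm.measurableEmbedding).2 this

/-- The squared `L²` norm of a product of Hermite functions. -/
def multiNormSq (ħ : ℝ) (n : Fin d → ℕ) : ℝ := ∏ j, hermiteNormSq ħ (n j)

theorem multiNormSq_pos {ħ : ℝ} (h : 0 < ħ) (n : Fin d → ℕ) : 0 < multiNormSq ħ n :=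
  Finset.prod_pos fun _ _ => hermiteNormSq_pos h _

theorem integral_multiHermite_mul {ħ : ℝ} (h : 0 < ħ) (m n : Fin d → ℕ) :
    ∫ x : Config d, ((multiHermite ħ m x : ℝ) : ℂ) * (multiHermite ħ n x : ℝ) =
      if m = n then ((multiNormSq ħ n : ℝ) : ℂ) else 0 := by
  have h1 : ∀ x : Config d, ((multiHermite ħ m x : ℝ) : ℂ) * (multiHermite ħ n x : ℝ) =
      ∏ j, (fun t : ℝ => ((hermiteFun ħ (m j) t * hermiteFun ħ (n j) t : ℝ) : ℂ)) (x j) := by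
    intro x
    simp only [multiHermite]
    push_cast
    rw [Finset.prod_mul_distrib]
  simp only [h1]
  rw [integral_config_prod (fun j t => ((hermiteFun ħ (m j) t * hermiteFun ħ (n j) t : ℝ) : ℂ))]
  simp only [integral_complex_ofReal, integral_hermiteFun_mul h]
  split_ifs with hmn
  · subst hmn
    simp [multiNormSq]
  · obtain ⟨j, hj⟩ := Function.ne_iff.1 hmn
    exact Finset.prod_eq_zero (Finset.mem_univ j) (by simp [hj])

/-- The product of Hermite functions as an element of `L²`. -/
def hermiteL2 {ħ : ℝ} (h : 0 < ħ) (n : Fin d → ℕ) : L2 d := (hermiteSchwartz h n).toLp 2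

theorem coeFn_hermiteL2 {ħ : ℝ} (h : 0 < ħ) (n : Fin d → ℕ) :
    hermiteL2 h n =ᵐ[volume] fun x => ((multiHermite ħ n x : ℝ) : ℂ) := by
  filter_upwards [(hermiteSchwartz h n).coeFn_toLp 2 volume] with x hx
  rw [hermiteL2, hx, hermiteSchwartz_apply]

theorem integrable_multiHermite_mul {ħ : ℝ} (h : 0 < ħ) (n : Fin d → ℕ) (ψ : L2 d) :
    Integrable fun x => ((multiHermite ħ n x : ℝ) : ℂ) * ψ x := by
  have := ((hermiteSchwartz h n).memLp 2 volume).integrable_mul (Lp.memLp ψ)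
  refine this.congr (ae_of_all _ fun x => ?_)
  simp [hermiteSchwartz_apply]

theorem inner_hermiteL2 {ħ : ℝ} (h : 0 < ħ) (n : Fin d → ℕ) (ψ : L2 d) :
    inner ℂ (hermiteL2 h n) ψ = ∫ x, ((multiHermite ħ n x : ℝ) : ℂ) * ψ x := by
  rw [L2.inner_def]
  refine integral_congr_ae ?_
  filter_upwards [coeFn_hermiteL2 h n] with x hx
  rw [hx, RCLike.inner_apply, Complex.conj_ofReal, mul_comm]

theorem inner_hermiteL2_hermiteL2 {ħ : ℝ} (h : 0 < ħ) (m n : Fin d → ℕ) :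
    inner ℂ (hermiteL2 h m) (hermiteL2 h n) = if m = n then ((multiNormSq ħ n : ℝ) : ℂ) else 0 := by
  rw [inner_hermiteL2, ← integral_multiHermite_mul h]
  refine integral_congr_ae ?_
  filter_upwards [coeFn_hermiteL2 h n] with x hx
  rw [hx]

/-- The eigenvalue equation is tested on a Schwartz function, and the symmetry of the Laplacian
moves it onto the Hermite function, where the equation holds pointwise. -/
theorem hermiteL2_mem_eigenspace {ħ : ℝ} (h : 0 < ħ) (n : Fin d → ℕ) :
    hermiteL2 h n ∈ eigenspace d ħ (eigenvalue d ħ (∑ j, n j)) := by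
  rw [mem_eigenspace_iff_integral]
  intro g
  have hcoe : ∀ u : 𝓢(Config d, ℂ), ∫ x, u x * hermiteL2 h n x =
      ∫ x, u x * hermiteSchwartz h n x := fun u => by
    refine integral_congr_ae ?_
    filter_upwards [coeFn_hermiteL2 h n] with x hx
    rw [hx, hermiteSchwartz_apply]
  have hi : ∀ u v : 𝓢(Config d, ℂ), Integrable fun x => u x * v x := fun u v =>
    (u.memLp 2 volume).integrable_mul (v.memLp 2 volume)
  rw [hcoe, hcoe, ← integral_const_mul]
  have e1 : ∀ x, ((-((ħ : ℂ) ^ 2 / 2)) • Laplacian.laplacian g +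
      SchwartzMap.smulLeftCLM ℂ (potential d) g) x * hermiteSchwartz h n x =
      -((ħ : ℂ) ^ 2 / 2) * (Laplacian.laplacian g x * hermiteSchwartz h n x) +
        SchwartzMap.smulLeftCLM ℂ (potential d) g x * hermiteSchwartz h n x := fun x => by
    simp only [add_apply, smul_apply, smul_eq_mul]
    ring
  have e2 : ∀ x, ((eigenvalue d ħ (∑ j, n j) : ℝ) : ℂ) * (g x * hermiteSchwartz h n x) =
      -((ħ : ℂ) ^ 2 / 2) * (g x * Laplacian.laplacian (hermiteSchwartz h n) x) +
        g x * SchwartzMap.smulLeftCLM ℂ (potential d) (hermiteSchwartz h n) x := fun x => by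
    have := laplacian_hermiteSchwartz_apply h n x
    rw [SchwartzMap.smulLeftCLM_apply_apply (potential_hasTemperateGrowth d), smul_eq_mul,
      eigenvalue]
    push_cast at this ⊢
    linear_combination (-g x) * this
  simp only [e1, e2]
  rw [integral_add ((hi _ _).const_mul _) (hi _ _), integral_add ((hi _ _).const_mul _) (hi _ _),
    integral_const_mul, integral_const_mul, SchwartzMap.integral_mul_laplacian_right_eq_left]
  congr 2
  funext x
  rw [SchwartzMap.smulLeftCLM_apply_apply (potential_hasTemperateGrowth d),
    SchwartzMap.smulLeftCLM_apply_apply (potential_hasTemperateGrowth d), smul_eq_mul, smul_eq_mul]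
  ring

/-- A Hermite product is a legitimate test function in the distributional eigenvalue equation of ψ;
the two eigenvalues differ, so the pairing must vanish. -/
theorem inner_hermiteL2_eq_zero {ħ : ℝ} (h : 0 < ħ) {n : Fin d → ℕ} {N : ℕ} (hn : ∑ j, n j ≠ N)
    {ψ : L2 d} (hψ : ψ ∈ eigenspace d ħ (eigenvalue d ħ N)) :
    inner ℂ (hermiteL2 h n) ψ = 0 := by
  rw [inner_hermiteL2]
  have h1 := (mem_eigenspace_iff_integral ħ _ ψ).1 hψ (hermiteSchwartz h n)
  rw [oscillator_hermiteSchwartz h] at h1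
  simp only [smul_apply, smul_eq_mul, mul_assoc, hermiteSchwartz_apply] at h1
  simp only [integral_const_mul] at h1
  by_contra h0
  have h2 : (ħ : ℂ) * ((∑ j, n j : ℕ) - N) = 0 := by
    have := mul_right_cancel₀ h0 ((mul_assoc _ _ _).trans h1)
    rw [eigenvalue] at this
    push_cast at this ⊢
    linear_combination this
  rcases mul_eq_zero.1 h2 with h3 | h3
  · exact h.ne' (by exact_mod_cast h3)
  · exact hn (by exact_mod_cast sub_eq_zero.1 h3)

/-- The multi-indices of degree `N`. -/
abbrev level (d N : ℕ) : Finset (Fin d →₀ ℕ) := Finset.finsuppAntidiag Finset.univ N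

theorem mem_level {N : ℕ} {n : Fin d →₀ ℕ} : n ∈ level d N ↔ ∑ j, n j = N := by
  simp [level]

/-- The expansion of the `N`-th eigenprojection in Hermite functions. -/
def levelSum {ħ : ℝ} (h : 0 < ħ) (N : ℕ) (ψ : L2 d) : L2 d :=
  ∑ n ∈ level d N, (((multiNormSq ħ n : ℝ) : ℂ)⁻¹ * inner ℂ (hermiteL2 h n) ψ) • hermiteL2 h n

theorem inner_hermiteL2_levelSum {ħ : ℝ} (h : 0 < ħ) (N : ℕ) (ψ : L2 d) {m : Fin d → ℕ}
    (hm : ∑ j, m j = N) :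
    inner ℂ (hermiteL2 h m) (levelSum h N ψ) = inner ℂ (hermiteL2 h m) ψ := by
  have hm' : Finsupp.equivFunOnFinite.symm m ∈ level d N := by simp [hm]
  rw [levelSum, inner_sum, Finset.sum_eq_single_of_mem _ hm']
  · rw [inner_smul_right]
    simp only [Finsupp.coe_equivFunOnFinite_symm, inner_hermiteL2_hermiteL2, if_true]
    have : ((multiNormSq ħ m : ℝ) : ℂ) ≠ 0 := by exact_mod_cast (multiNormSq_pos h m).ne'
    field_simp
  · intro n _ hn
    rw [inner_smul_right, inner_hermiteL2_hermiteL2, if_neg, mul_zero]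
    rintro rfl
    exact hn (by simp)

theorem levelSum_mem_eigenspace {ħ : ℝ} (h : 0 < ħ) (N : ℕ) (ψ : L2 d) :
    levelSum h N ψ ∈ eigenspace d ħ (eigenvalue d ħ N) := by
  refine Submodule.sum_mem _ fun n hn => Submodule.smul_mem _ _ ?_
  rw [← mem_level.1 hn]
  exact hermiteL2_mem_eigenspace h n

/-- The difference is orthogonal to every Hermite product: in degree `N` by construction, in other
degrees because eigenvalues differ. Totality then makes it zero. -/
theorem levelSum_eq_self {ħ : ℝ} (h : 0 < ħ) {N : ℕ} {ψ : L2 d}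
    (hψ : ψ ∈ eigenspace d ħ (eigenvalue d ħ N)) : levelSum h N ψ = ψ := by
  rw [← sub_eq_zero]
  refine eq_zero_of_integral_multiHermite h fun n => ?_
  rw [← inner_hermiteL2 h]
  by_cases hn : ∑ j, n j = N
  · rw [inner_sub_right, inner_hermiteL2_levelSum h N ψ hn, sub_self]
  · exact inner_hermiteL2_eq_zero h hn (Submodule.sub_mem _ (levelSum_mem_eigenspace h N ψ) hψ)

theorem eigenprojection_eq_levelSum {ħ : ℝ} (h : 0 < ħ) (N : ℕ) (ψ : L2 d) :
    eigenprojection d ħ N ψ = levelSum h N ψ := by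
  refine Submodule.eq_starProjection_of_mem_orthogonal (levelSum_mem_eigenspace h N ψ) ?_
  rw [Submodule.mem_orthogonal]
  intro φ hφ
  rw [← levelSum_eq_self h hφ, levelSum, sum_inner]
  refine Finset.sum_eq_zero fun n hn => ?_
  rw [inner_smul_left, inner_sub_right, inner_hermiteL2_levelSum h N ψ (mem_level.1 hn), sub_self,
    mul_zero]

/-- The kernel of the `N`-th eigenprojection. -/
def levelKernel (ħ : ℝ) (N : ℕ) (x y : Config d) : ℂ :=
  ∑ n ∈ level d N, (((multiNormSq ħ n)⁻¹ * (multiHermite ħ n x * multiHermite ħ n y) : ℝ) : ℂ)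

theorem continuous_multiHermite (ħ : ℝ) (n : Fin d → ℕ) : Continuous (multiHermite ħ n) := by
  unfold multiHermite
  refine continuous_finsetProd _ fun j _ => (continuous_hermiteFun ħ (n j)).comp ?_
  fun_prop

theorem isContinuousKernel_levelKernel {ħ : ℝ} (h : 0 < ħ) (N : ℕ) :
    IsContinuousKernel (eigenprojection d ħ N) (levelKernel ħ N) := by
  refine ⟨?_, fun ψ => ?_⟩
  · unfold levelKernel
    refine continuous_finsetSum _ fun n _ => Complex.continuous_ofReal.comp ?_
    have := continuous_multiHermite ħ (d := d) n
    fun_prop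
  · have hi : ∀ (x : Config d) (n : Fin d →₀ ℕ), Integrable fun y =>
        (((multiNormSq ħ n)⁻¹ * (multiHermite ħ n x * multiHermite ħ n y) : ℝ) : ℂ) * ψ y :=
      fun x n => by
        refine ((integrable_multiHermite_mul h n ψ).const_mul
          (((multiNormSq ħ n)⁻¹ * multiHermite ħ n x : ℝ) : ℂ)).congr (ae_of_all _ fun y => ?_)
        push_cast
        ring
    have h1 : ⇑(levelSum h N ψ) =ᵐ[volume] fun x => ∑ n ∈ level d N,
        (((multiNormSq ħ n : ℝ) : ℂ)⁻¹ * inner ℂ (hermiteL2 h n) ψ) *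
          ((multiHermite ħ n x : ℝ) : ℂ) := by
      -- The sum is the class of one Schwartz function, which provides a pointwise representative.
      have h2 : levelSum h N ψ = SchwartzMap.toLpCLM ℂ ℂ 2 volume (∑ n ∈ level d N,
          (((multiNormSq ħ n : ℝ) : ℂ)⁻¹ * inner ℂ (hermiteL2 h n) ψ) • hermiteSchwartz h n) := by
        rw [map_sum]
        simp only [map_smul]
        rfl
      rw [h2, SchwartzMap.toLpCLM_apply]
      filter_upwards [SchwartzMap.coeFn_toLp (∑ n ∈ level d N,
        (((multiNormSq ħ n : ℝ) : ℂ)⁻¹ * inner ℂ (hermiteL2 h n) ψ) • hermiteSchwartz h n) 2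
          volume] with x hx
      rw [hx, sum_apply]
      simp only [smul_apply, smul_eq_mul, hermiteSchwartz_apply]
    rw [eigenprojection_eq_levelSum h]
    filter_upwards [h1] with x hx
    simp only [levelKernel, Finset.sum_mul]
    refine ⟨integrable_finsetSum _ fun n _ => hi x n, ?_⟩
    rw [hx, integral_finsetSum _ fun n _ => hi x n]
    refine Finset.sum_congr rfl fun n _ => ?_
    rw [inner_hermiteL2, mul_right_comm, ← integral_const_mul]
    congr 1
    funext y
    push_cast
    ring

/-- If the continuous kernels differ by `c ≠ 0` at `(x₀, y₀)`, the real part of their difference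
over `c` exceeds 1/2 on a product of balls. Applied to the indicator of the ball around `y₀`, the
kernels would disagree for almost all `x` near `x₀`. -/
theorem IsContinuousKernel.unique {T : L2 d →L[ℂ] L2 d} {K K' : Config d → Config d → ℂ}
    (hK : IsContinuousKernel T K) (hK' : IsContinuousKernel T K') : K = K' := by
  have hc : Continuous fun p : Config d × Config d => K p.1 p.2 - K' p.1 p.2 := hK.1.sub hK'.1
  by_contra hne
  obtain ⟨x₀, hx₀⟩ := Function.ne_iff.1 hne
  obtain ⟨y₀, hy₀⟩ := Function.ne_iff.1 hx₀
  set D : Config d → Config d → ℂ := fun x y => K x y - K' x y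
  set c : ℂ := D x₀ y₀ with hcdef
  have hc0 : c ≠ 0 := sub_ne_zero.2 hy₀
  have hre : Continuous fun p : Config d × Config d => (D p.1 p.2 / c).re :=
    Complex.continuous_re.comp (hc.div_const c)
  have hopen : IsOpen {p : Config d × Config d | (1 / 2 : ℝ) < (D p.1 p.2 / c).re} :=
    isOpen_lt continuous_const hre
  have hmem : (x₀, y₀) ∈ {p : Config d × Config d | (1 / 2 : ℝ) < (D p.1 p.2 / c).re} := by
    have : D x₀ y₀ / c = 1 := div_self hc0
    simp only [Set.mem_ofPred_eq, this, Complex.one_re]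
    norm_num
  obtain ⟨ε, hε, hball⟩ := Metric.isOpen_iff.1 hopen _ hmem
  set B := Metric.ball y₀ ε
  have hBvol : volume B ≠ ⊤ := measure_ball_lt_top.ne
  have hBpos : 0 < (volume : Measure (Config d)).real B := by
    rw [Measure.real, ENNReal.toReal_pos_iff]
    exact ⟨Metric.measure_ball_pos _ _ hε, measure_ball_lt_top⟩
  set ψ : L2 d := indicatorConstLp 2 (Metric.isOpen_ball (x := y₀) (ε := ε)).measurableSet hBvol (1 : ℂ)
  have hψ : ψ =ᵐ[volume] B.indicator fun _ => (1 : ℂ) := indicatorConstLp_coeFn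
  have hae : ∀ᵐ x : Config d, ∫ y in B, D x y = 0 ∧ IntegrableOn (D x) B := by
    filter_upwards [hK.2 ψ, hK'.2 ψ] with x hx hx'
    have hmul : ∀ k : Config d → ℂ, (fun y => k y * ψ y) =ᵐ[volume] B.indicator k := fun k => by
      filter_upwards [hψ] with y hy
      rw [hy]
      by_cases hyB : y ∈ B <;> simp [hyB]
    have hB : MeasurableSet B := Metric.isOpen_ball.measurableSet
    have i1 : IntegrableOn (K x) B :=
      (integrable_indicator_iff hB).1 (hx.1.congr (hmul (K x)))
    have i2 : IntegrableOn (K' x) B :=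
      (integrable_indicator_iff hB).1 (hx'.1.congr (hmul (K' x)))
    refine ⟨?_, i1.sub i2⟩
    have e1 := hx.2.symm.trans hx'.2
    rw [integral_congr_ae (hmul (K x)), integral_congr_ae (hmul (K' x)), integral_indicator hB,
      integral_indicator hB] at e1
    rw [integral_sub i1 i2, e1, sub_self]
  have hpos : 0 < volume (Metric.ball x₀ ε) := Metric.measure_ball_pos _ _ hε
  -- The kernel identity holds only almost everywhere in `x`; a ball has positive measure and so
  -- contains a good point.
  obtain ⟨x, hx, hx0, hxi⟩ : ∃ x ∈ Metric.ball x₀ ε, ∫ y in B, D x y = 0 ∧ IntegrableOn (D x) B := by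
    by_contra hcon
    push Not at hcon
    refine hpos.ne' (measure_mono_null (fun x hx => ?_) (ae_iff.1 hae))
    simp only [Set.mem_ofPred_eq, not_and]
    exact fun h1 => hcon x hx h1
  have hlow : (1 / 2 : ℝ) * (volume : Measure (Config d)).real B ≤ ∫ y in B, (D x y / c).re := by
    have := setIntegral_mono_on (μ := (volume : Measure (Config d))) (s := B) (f := fun _ => (1 / 2 : ℝ))
      (g := fun y => (D x y / c).re) (integrableOn_const hBvol) (hxi.div_const c).re
      Metric.isOpen_ball.measurableSet (fun y hy => ?_)
    · rw [setIntegral_const, smul_eq_mul, mul_comm] at this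
      exact this
    · have : (x, y) ∈ Metric.ball (x₀, y₀) ε := by
        rw [← ball_prod_same]
        exact ⟨hx, hy⟩
      exact (hball this).le
  have hz : ∫ y in B, (D x y / c).re = 0 := by
    have h1 : ∫ y in B, (D x y / c).re = (∫ y in B, D x y / c).re :=
      integral_re (hxi.div_const c)
    rw [h1, integral_div, hx0]
    simp
  rw [hz] at hlow
  linarith

theorem continuousKernel_eigenprojection {ħ : ℝ} (h : 0 < ħ) (N : ℕ) :
    continuousKernel (eigenprojection d ħ N) = levelKernel ħ N := by
  have hex : ∃ K, IsContinuousKernel (eigenprojection d ħ N) K :=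
    ⟨_, isContinuousKernel_levelKernel h N⟩
  rw [continuousKernel, dif_pos hex]
  exact hex.choose_spec.unique (isContinuousKernel_levelKernel h N)

theorem existsUnique_isContinuousKernel {ħ : ℝ} (h : 0 < ħ) (N : ℕ) :
    ∃! K, IsContinuousKernel (eigenprojection d ħ N) K :=
  ⟨_, isContinuousKernel_levelKernel h N, fun _ hK => hK.unique (isContinuousKernel_levelKernel h N)⟩

/-! ### Wigner distributions as Laguerre functions -/

/-- The one-dimensional factors of the Wigner integrands. -/
def wignerFactor (ħ x ξ : ℝ) (n : ℕ) (t : ℝ) : ℂ :=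
  ((hermiteFun ħ n (x + t / 2) * hermiteFun ħ n (x - t / 2) : ℝ) : ℂ) *
    Complex.exp (-(Complex.I / ħ) * (t * ξ : ℝ))

theorem integrable_wignerFactor {ħ : ℝ} (h : 0 < ħ) (x ξ : ℝ) (n : ℕ) :
    Integrable (wignerFactor ħ x ξ n) :=
  integrable_hermiteWigner h x ξ n n

theorem wignerIntegrand_eq {ħ : ℝ} (h : 0 < ħ) (N : ℕ) (x ξ v : Config d) :
    wignerIntegrand d ħ N x ξ v = ∑ n ∈ level d N, ((multiNormSq ħ n : ℝ) : ℂ)⁻¹ *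
      ∏ j, wignerFactor ħ (x j) (ξ j) (n j) (v j) := by
  rw [wignerIntegrand, continuousKernel_eigenprojection h, levelKernel, Finset.sum_mul]
  refine Finset.sum_congr rfl fun n _ => ?_
  have h1 : Complex.exp (-(Complex.I / ħ) * (inner ℝ v ξ : ℝ)) =
      ∏ j, Complex.exp (-(Complex.I / ħ) * (v j * ξ j : ℝ)) := by
    rw [← Complex.exp_sum, ← Finset.mul_sum, PiLp.inner_apply]
    simp [mul_comm]
  rw [h1]
  simp only [multiHermite, wignerFactor, Finset.prod_mul_distrib]
  push_cast
  simp only [PiLp.add_apply, PiLp.sub_apply, PiLp.smul_apply, smul_eq_mul, Finset.prod_mul_distrib]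
  have e : ∀ t : ℝ, (2 : ℝ)⁻¹ * t = t / 2 := fun t => by ring
  simp only [e]
  ring

theorem integrable_wignerIntegrand {ħ : ℝ} (h : 0 < ħ) (N : ℕ) (x ξ : Config d) :
    Integrable (wignerIntegrand d ħ N x ξ) := by
  rw [funext (wignerIntegrand_eq h N x ξ)]
  exact integrable_finsetSum _ fun n _ => (integrable_config_prod fun j =>
    integrable_wignerFactor h (x j) (ξ j) (n j)).const_mul _

/-- The generating series of the Wigner functions of the eigenprojections. -/
def wignerSeries (ħ : ℝ) (x ξ : Config d) : PowerSeries ℂ :=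
  ∏ j, PowerSeries.mk (diagWigner ħ (x j) (ξ j))

/-- By Fubini each multi-index contributes a product of one-dimensional Wigner integrals; summing
these over multi-indices of degree `N` is exactly the Cauchy product formula. -/
theorem integral_wignerIntegrand {ħ : ℝ} (h : 0 < ħ) (N : ℕ) (x ξ : Config d) :
    ∫ v, wignerIntegrand d ħ N x ξ v = PowerSeries.coeff N (wignerSeries ħ x ξ) := by
  have key : ∀ n : Fin d →₀ ℕ, Integrable fun v : Config d => ((multiNormSq ħ n : ℝ) : ℂ)⁻¹ *
      ∏ j, wignerFactor ħ (x j) (ξ j) (n j) (v j) := fun n =>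
    (integrable_config_prod fun j => integrable_wignerFactor h (x j) (ξ j) (n j)).const_mul _
  have hdiag : ∀ (a b : ℝ) (m : ℕ), diagWigner ħ a b m =
      (∫ t, wignerFactor ħ a b m t) / (hermiteNormSq ħ m : ℝ) := fun _ _ _ => rfl
  simp only [wignerIntegrand_eq h N x ξ]
  rw [integral_finsetSum _ fun n _ => key n, wignerSeries, PowerSeries.coeff_prod]
  refine Finset.sum_congr rfl fun n _ => ?_
  rw [integral_const_mul, integral_config_prod (fun j => wignerFactor ħ (x j) (ξ j) (n j))]
  simp only [PowerSeries.coeff_mk, hdiag, Finset.prod_div_distrib, multiNormSq]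
  push_cast
  rw [div_eq_inv_mul]

open PowerSeries in
-- The three-term recurrence read on coefficients. Degrees 0 and 1 are separate because the
-- multiplications by `X` and `X²` drop the lowest coefficients.
theorem derivative_mk_diagWigner {ħ : ℝ} (h : 0 < ħ) (x ξ : ℝ) :
    (1 + X) ^ 2 * derivative ℂ (mk (diagWigner ħ x ξ)) =
      (C (2 * (x ^ 2 + ξ ^ 2) / ħ : ℂ) - (1 + X)) * mk (diagWigner ħ x ξ) := by
  ext N
  have e1 : (1 + X) ^ 2 * derivative ℂ (mk (diagWigner ħ x ξ)) =
      derivative ℂ (mk (diagWigner ħ x ξ)) + (C 2 * (X * derivative ℂ (mk (diagWigner ħ x ξ))) +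
        X * (X * derivative ℂ (mk (diagWigner ħ x ξ)))) := by
    rw [show (C (2 : ℂ) : PowerSeries ℂ) = 2 from map_ofNat C 2]
    ring
  have e2 : (C (2 * (x ^ 2 + ξ ^ 2) / ħ : ℂ) - (1 + X)) * mk (diagWigner ħ x ξ) =
      C (2 * (x ^ 2 + ξ ^ 2) / ħ : ℂ) * mk (diagWigner ħ x ξ) - mk (diagWigner ħ x ξ) -
        X * mk (diagWigner ħ x ξ) := by ring
  rw [e1, e2]
  rcases N with _ | _ | k
  · have := diagWigner_succ h x ξ 0
    simp only [map_add, map_sub, coeff_C_mul, coeff_zero_X_mul, coeff_derivative, coeff_mk,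
      zero_add] at this ⊢
    push_cast at this ⊢
    linear_combination this
  · have := diagWigner_succ h x ξ 1
    simp only [map_add, map_sub, coeff_C_mul, coeff_succ_X_mul, coeff_zero_X_mul, coeff_derivative,
      coeff_mk, zero_add] at this ⊢
    push_cast at this ⊢
    linear_combination this
  · have := diagWigner_succ h x ξ (k + 2)
    simp only [map_add, map_sub, coeff_C_mul, coeff_succ_X_mul, coeff_derivative, coeff_mk] at this ⊢
    push_cast at this ⊢
    linear_combination this

open PowerSeries in
-- The equation says that `F'/F = y/(1+X)² - 1/(1+X)`, and logarithmic derivatives add under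
-- products. This turns the exponent 1 of the line into the exponent `d`.
theorem derivative_prod_of_ode {ι : Type*} (s : Finset ι) (F : ι → PowerSeries ℂ) (y : ι → ℂ)
    (hF : ∀ i, (1 + X) ^ 2 * derivative ℂ (F i) = (C (y i) - (1 + X)) * F i) :
    (1 + X) ^ 2 * derivative ℂ (∏ i ∈ s, F i) =
      (C (∑ i ∈ s, y i) - (s.card : PowerSeries ℂ) * (1 + X)) * ∏ i ∈ s, F i := by
  classical
  induction s using Finset.induction_on with
  | empty => simp
  | insert i s hi ih =>
    rw [Finset.prod_insert hi, Finset.sum_insert hi, Finset.card_insert_of_notMem hi,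
      Derivation.leibniz, map_add]
    simp only [smul_eq_mul]
    push_cast
    linear_combination (F i) * ih + (∏ i ∈ s, F i) * hF i

/-- The Laguerre functions `(-1)^N e^{-y/2} L_N^{(d-1)}(y)`, through their recurrence. -/
def laguerreFun (d : ℕ) (y : ℝ) : ℕ → ℝ
  | 0 => Real.exp (-(y / 2))
  | 1 => (y - d) * Real.exp (-(y / 2))
  | n + 2 => ((y - d - 2 * (n + 1)) * laguerreFun d y (n + 1) - (n + d) * laguerreFun d y n) /
      (n + 2)

theorem laguerreFun_succ (d : ℕ) (y : ℝ) (n : ℕ) :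
    (n + 2 : ℝ) * laguerreFun d y (n + 2) =
      (y - d - 2 * (n + 1)) * laguerreFun d y (n + 1) - (n + d) * laguerreFun d y n := by
  rw [laguerreFun]
  field_simp

open PowerSeries in
-- The equation determines each coefficient from the two before it, so the constant term fixes the
-- whole series.
theorem coeff_eq_laguerreFun {d : ℕ} {y : ℝ} {F : PowerSeries ℂ} {c : ℂ}
    (h0 : coeff 0 F = c * Real.exp (-(y / 2)))
    (hF : (1 + X) ^ 2 * derivative ℂ F = (C (y : ℂ) - (d : PowerSeries ℂ) * (1 + X)) * F) (N : ℕ) :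
    coeff N F = c * laguerreFun d y N := by
  have e1 : (1 + X) ^ 2 * derivative ℂ F = derivative ℂ F + (C 2 * (X * derivative ℂ F) +
        X * (X * derivative ℂ F)) := by
    rw [show (C (2 : ℂ) : PowerSeries ℂ) = 2 from map_ofNat C 2]
    ring
  have e2 : (C (y : ℂ) - (d : PowerSeries ℂ) * (1 + X)) * F =
      C (y : ℂ) * F - C (d : ℂ) * F - C (d : ℂ) * (X * F) := by
    rw [map_natCast]; ring
  rw [e1, e2] at hF
  have hc : ∀ N, _ := fun N => congrArg (coeff N) hF
  have h1 : coeff 1 F = c * laguerreFun d y 1 := by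
    have := hc 0
    simp only [map_add, map_sub, coeff_C_mul, coeff_zero_X_mul, coeff_derivative, zero_add, h0]
      at this
    rw [laguerreFun]
    push_cast at this ⊢
    linear_combination this
  induction N using Nat.strong_induction_on with
  | _ N ih =>
    rcases N with _ | _ | k
    · simpa [laguerreFun] using h0
    · exact h1
    · have hk := ih k (by omega)
      have hk1 := ih (k + 1) (by omega)
      have hr := congrArg Complex.ofReal (laguerreFun_succ d y k)
      have hne : (k + 2 : ℂ) ≠ 0 := by exact_mod_cast (Nat.succ_ne_zero (k + 1))
      refine mul_left_cancel₀ hne ?_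
      push_cast at hr
      have := hc (k + 1)
      rcases k with _ | k
      · simp only [map_add, map_sub, coeff_C_mul, coeff_succ_X_mul, coeff_zero_X_mul,
          coeff_derivative, zero_add] at this hk hk1 hr ⊢
        push_cast at this hr ⊢
        linear_combination this - c * hr + (y - d - 2) * hk1 - d * hk
      · simp only [map_add, map_sub, coeff_C_mul, coeff_succ_X_mul, coeff_derivative] at this ⊢
        push_cast at this hr ⊢
        linear_combination this - c * hr + (y - d - 2 * (k + 2)) * hk1 - (k + 1 + d) * hk

theorem sum_coord_eq_hamiltonian (ħ : ℝ) (x ξ : Config d) :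
    ∑ j, (2 * (x j ^ 2 + ξ j ^ 2) / ħ) = 4 * hamiltonian x ξ / ħ := by
  rw [← Finset.sum_div, ← Finset.mul_sum, Finset.sum_add_distrib, hamiltonian,
    EuclideanSpace.real_norm_sq_eq, EuclideanSpace.real_norm_sq_eq]
  ring

/-- The Wigner distribution of an eigenprojection is a Laguerre function of the Hamiltonian. -/
theorem wigner_eq_laguerreFun {ħ : ℝ} (h : 0 < ħ) (N : ℕ) (x ξ : Config d) :
    wigner d ħ N x ξ =
      (laguerreFun d (4 * hamiltonian x ξ / ħ) N / (Real.pi * ħ) ^ d : ℝ) := by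
  have hs := sum_coord_eq_hamiltonian ħ x ξ
  have hode := derivative_prod_of_ode Finset.univ
    (fun j => PowerSeries.mk (diagWigner ħ (x j) (ξ j)))
    (fun j => ((2 * (x j ^ 2 + ξ j ^ 2) / ħ : ℝ) : ℂ)) (fun j => by
      have := derivative_mk_diagWigner h (x j) (ξ j)
      push_cast
      exact this)
  rw [← Complex.ofReal_sum, hs, Finset.card_univ, Fintype.card_fin] at hode
  have h0 : PowerSeries.coeff 0 (wignerSeries ħ x ξ) =
      2 ^ d * Real.exp (-(4 * hamiltonian x ξ / ħ / 2)) := by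
    rw [PowerSeries.coeff_zero_eq_constantCoeff_apply, wignerSeries, map_prod]
    simp only [← PowerSeries.coeff_zero_eq_constantCoeff_apply, PowerSeries.coeff_mk,
      diagWigner_zero h, Finset.prod_mul_distrib, Finset.prod_const, Finset.card_univ,
      Fintype.card_fin, ← Complex.exp_sum]
    congr 1
    rw [Complex.ofReal_exp, ← hs]
    congr 1
    push_cast
    rw [Finset.sum_div, ← Finset.sum_neg_distrib]
    refine Finset.sum_congr rfl fun j _ => ?_
    ring
  rw [wigner, integral_wignerIntegrand h, coeff_eq_laguerreFun h0 hode]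
  have : (Real.pi : ℂ) ≠ 0 := by exact_mod_cast Real.pi_ne_zero
  have hħ : (ħ : ℂ) ≠ 0 := by exact_mod_cast h.ne'
  push_cast
  rw [mul_assoc (2 : ℂ), mul_pow (2 : ℂ)]
  field_simp

/-! ### The generating function and polynomial bounds -/

/-- The generating function of the Laguerre functions. -/
def laguerreGen (d : ℕ) (y : ℝ) (z : ℂ) : ℂ :=
  Complex.exp (-(y / 2) * ((1 - z) / (1 + z))) * ((1 + z) ^ d)⁻¹

theorem differentiableOn_laguerreGen (d : ℕ) (y : ℝ) :
    DifferentiableOn ℂ (laguerreGen d y) {z | 1 + z ≠ 0} := by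
  unfold laguerreGen
  refine DifferentiableOn.mul (DifferentiableOn.cexp (DifferentiableOn.const_mul
    (DifferentiableOn.div (by fun_prop) (by fun_prop) fun z hz => hz) _)) ?_
  exact DifferentiableOn.inv (by fun_prop) fun z hz => pow_ne_zero _ hz

theorem isOpen_one_add_ne_zero : IsOpen {z : ℂ | 1 + z ≠ 0} :=
  isOpen_ne_fun (by fun_prop) continuous_const

theorem hasDerivAt_iteratedDeriv_laguerreGen (d : ℕ) (y : ℝ) (k : ℕ) {z : ℂ} (hz : 1 + z ≠ 0) :
    HasDerivAt (iteratedDeriv k (laguerreGen d y)) (iteratedDeriv (k + 1) (laguerreGen d y) z) z := by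
  have ha : AnalyticAt ℂ (laguerreGen d y) z :=
    (differentiableOn_laguerreGen d y).analyticAt (isOpen_one_add_ne_zero.mem_nhds hz)
  rw [iteratedDeriv_succ]
  refine DifferentiableAt.hasDerivAt ?_
  rw [iteratedDeriv_eq_iterate]
  exact (ha.iterated_deriv k).differentiableAt

theorem laguerreGen_ode (d : ℕ) (y : ℝ) {z : ℂ} (hz : 1 + z ≠ 0) :
    (1 + z) ^ 2 * iteratedDeriv 1 (laguerreGen d y) z = (y - d * (1 + z)) * laguerreGen d y z := by
  rw [iteratedDeriv_one]
  have h1 : HasDerivAt (fun z : ℂ => 1 + z) 1 z := (hasDerivAt_id z).const_add 1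
  have h2 : HasDerivAt (fun z : ℂ => 1 - z) (-1) z := (hasDerivAt_id z).const_sub 1
  have h3 := (((h2.fun_div h1 hz).const_mul (-(y / 2) : ℂ)).cexp).mul
    ((h1.fun_pow d).fun_inv (pow_ne_zero d hz))
  have h4 : deriv (laguerreGen d y) z = _ := h3.deriv
  rw [h4, laguerreGen]
  rcases d with _ | d
  · simp
    field_simp
    ring
  · push_cast
    simp only [pow_succ]
    field_simp
    ring

/-- The first-order equation holds on an open set, so it may be differentiated repeatedly. At `z =
0` the result is the Laguerre recurrence multiplied by factorials. -/
theorem iteratedDeriv_laguerreGen_recurrence (d : ℕ) (y : ℝ) (n : ℕ) {z : ℂ} (hz : 1 + z ≠ 0) :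
    (1 + z) ^ 2 * iteratedDeriv (n + 2) (laguerreGen d y) z +
      (2 * (n + 1) * (1 + z) - y + d * (1 + z)) * iteratedDeriv (n + 1) (laguerreGen d y) z +
      (n + 1) * (n + d) * iteratedDeriv n (laguerreGen d y) z = 0 := by
  have hD := hasDerivAt_iteratedDeriv_laguerreGen d y
  have hev : ∀ {w : ℂ}, 1 + w ≠ 0 → ∀ᶠ z in 𝓝 w, 1 + z ≠ 0 := fun hw =>
    isOpen_one_add_ne_zero.mem_nhds hw
  have h1 : ∀ w : ℂ, HasDerivAt (fun z : ℂ => 1 + z) 1 w := fun w => (hasDerivAt_id w).const_add 1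
  induction n generalizing z with
  | zero =>
    have e : (fun z => (1 + z) ^ 2 * iteratedDeriv 1 (laguerreGen d y) z -
        (y - d * (1 + z)) * iteratedDeriv 0 (laguerreGen d y) z) =ᶠ[𝓝 z] fun _ => 0 := by
      filter_upwards [hev hz] with w hw
      rw [laguerreGen_ode d y hw, iteratedDeriv_zero, sub_self]
    have hd := (((h1 z).fun_pow 2).fun_mul (hD 1 hz)).fun_sub
      ((((h1 z).const_mul (d : ℂ)).const_sub (y : ℂ)).fun_mul (hD 0 hz))
    have := (hd.congr_of_eventuallyEq e.symm).unique (hasDerivAt_const z (0 : ℂ))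
    simp only [zero_add, Nat.add_one_sub_one] at this ⊢
    push_cast at this ⊢
    linear_combination this
  | succ n ih =>
    have e : (fun z => (1 + z) ^ 2 * iteratedDeriv (n + 2) (laguerreGen d y) z +
      (2 * (n + 1) * (1 + z) - y + d * (1 + z)) * iteratedDeriv (n + 1) (laguerreGen d y) z +
      (n + 1) * (n + d) * iteratedDeriv n (laguerreGen d y) z) =ᶠ[𝓝 z] fun _ => 0 := by
      filter_upwards [hev hz] with w hw
      exact ih hw
    have hd := ((((h1 z).fun_pow 2).fun_mul (hD (n + 2) hz)).fun_add
      (((((h1 z).const_mul (2 * (n + 1) : ℂ)).sub_const (y : ℂ)).fun_add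
        ((h1 z).const_mul (d : ℂ))).fun_mul (hD (n + 1) hz))).fun_add
          ((hD n hz).const_mul ((n + 1) * (n + d) : ℂ))
    have := (hd.congr_of_eventuallyEq e.symm).unique (hasDerivAt_const z (0 : ℂ))
    simp only [Nat.add_one_sub_one] at this ⊢
    push_cast at this ⊢
    linear_combination this

theorem iteratedDeriv_laguerreGen_zero (d : ℕ) (y : ℝ) (n : ℕ) :
    iteratedDeriv n (laguerreGen d y) 0 = n.factorial * laguerreFun d y n := by
  have h0 : laguerreGen d y 0 = Real.exp (-(y / 2)) := by
    simp [laguerreGen]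
  induction n using Nat.strong_induction_on with
  | _ n ih =>
    rcases n with _ | _ | n
    · simp [h0, laguerreFun]
    · have := laguerreGen_ode d y (z := 0) (by simp)
      rw [h0] at this
      simp only [laguerreFun, zero_add, Nat.factorial_one]
      push_cast at this ⊢
      linear_combination this
    · have h := iteratedDeriv_laguerreGen_recurrence d y n (z := 0) (by simp)
      rw [ih n (by omega), ih (n + 1) (by omega)] at h
      have hr := congrArg Complex.ofReal (laguerreFun_succ d y n)
      simp only [Nat.factorial_succ] at h ⊢
      push_cast at h hr ⊢
      linear_combination h - (n + 1) * n.factorial * hr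

theorem one_add_ne_zero_of_norm_lt {z : ℂ} (hz : ‖z‖ < 1) : 1 + z ≠ 0 := by
  intro h
  have : z = -1 := by linear_combination h
  rw [this] at hz
  simp at hz

theorem hasSum_laguerreFun (d : ℕ) (y : ℝ) {z : ℂ} (hz : ‖z‖ < 1) :
    HasSum (fun n : ℕ => (laguerreFun d y n : ℂ) * z ^ n) (laguerreGen d y z) := by
  have hf : DifferentiableOn ℂ (laguerreGen d y) (Metric.ball 0 1) :=
    (differentiableOn_laguerreGen d y).mono fun w hw =>
      one_add_ne_zero_of_norm_lt (by simpa using hw)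
  have := Complex.hasSum_taylorSeries_on_ball hf (z := z) (by simpa using hz)
  convert! this using 2 with n
  rw [iteratedDeriv_laguerreGen_zero, sub_zero, smul_eq_mul, smul_eq_mul]
  have : (n.factorial : ℂ) ≠ 0 := by exact_mod_cast n.factorial_ne_zero
  field_simp

theorem re_one_sub_div_one_add_nonneg {z : ℂ} (hz : ‖z‖ ≤ 1) : 0 ≤ ((1 - z) / (1 + z)).re := by
  have h1 : z.re * z.re + z.im * z.im ≤ 1 := by
    rw [← Complex.normSq_apply, Complex.normSq_eq_norm_sq]
    exact pow_le_one₀ (norm_nonneg _) hz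
  rw [Complex.div_re, ← add_div]
  refine div_nonneg ?_ (Complex.normSq_nonneg _)
  simp
  nlinarith

/-- The Cayley transform sends the unit disc into the right half plane, so the exponential factor
has modulus at most one. -/
theorem norm_laguerreGen_le (d : ℕ) {y : ℝ} (hy : 0 ≤ y) {z : ℂ} (hz : ‖z‖ ≤ 1) :
    ‖laguerreGen d y z‖ ≤ (‖1 + z‖ ^ d)⁻¹ := by
  rw [laguerreGen, norm_mul, norm_inv, norm_pow, Complex.norm_exp]
  refine mul_le_of_le_one_left (by positivity) (Real.exp_le_one_iff.2 ?_)
  have h1 : (-(y / 2 : ℂ) * ((1 - z) / (1 + z))).re = -(y / 2) * ((1 - z) / (1 + z)).re := by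
    rw [show -(y / 2 : ℂ) = ((-(y / 2) : ℝ) : ℂ) by push_cast; ring, Complex.re_ofReal_mul]
  rw [h1]
  have := re_one_sub_div_one_add_nonneg hz
  nlinarith

/-- Cauchy's estimate on the circle of radius `r = (n+1)/(n+2)`: there `|1+z| ≥ 1/(n+2)`, while
`r^{-n} ≤ e < 3`. The bound is uniform in `y ≥ 0`, which matters because `y = 4H/ħ` is unbounded. -/
theorem abs_laguerreFun_le (d : ℕ) {y : ℝ} (hy : 0 ≤ y) (n : ℕ) :
    |laguerreFun d y n| ≤ 3 * ((n : ℝ) + 2) ^ d := by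
  have hn2 : (0 : ℝ) < n + 2 := by positivity
  set r : ℝ := (n + 1) / (n + 2) with hr
  have hr0 : 0 < r := by positivity
  have hr1 : r < 1 := by rw [hr, div_lt_one hn2]; linarith
  have h1r : 1 - r = ((n : ℝ) + 2)⁻¹ := by rw [hr]; field_simp; ring
  have hf : DiffContOnCl ℂ (laguerreGen d y) (Metric.ball 0 r) := by
    refine DifferentiableOn.diffContOnCl ?_
    rw [closure_ball _ hr0.ne']
    refine (differentiableOn_laguerreGen d y).mono fun w hw => ?_
    exact one_add_ne_zero_of_norm_lt (by
      simp only [mem_closedBall_zero_iff] at hw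
      linarith)
  have hC : ∀ z ∈ Metric.sphere (0 : ℂ) r, ‖laguerreGen d y z‖ ≤ ((n : ℝ) + 2) ^ d := fun z hz => by
    rw [mem_sphere_zero_iff_norm] at hz
    refine (norm_laguerreGen_le d hy (by linarith)).trans ?_
    have h2 : ((n : ℝ) + 2)⁻¹ ≤ ‖1 + z‖ := by
      have := norm_sub_norm_le (1 : ℂ) (-z)
      rw [sub_neg_eq_add, norm_neg, norm_one] at this
      linarith
    rw [← inv_pow]
    gcongr
    exact inv_le_of_inv_le₀ hn2 h2
  have h := Complex.norm_iteratedDeriv_le_of_forall_mem_sphere_norm_le n hr0 hf hC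
  rw [iteratedDeriv_laguerreGen_zero, norm_mul, Complex.norm_real, Real.norm_eq_abs,
    Complex.norm_natCast, mul_div_assoc] at h
  have h3 := le_of_mul_le_mul_left h (by positivity)
  refine h3.trans ?_
  have hpow : (r ^ n)⁻¹ ≤ 3 := by
    have e1 : r⁻¹ = 1 + 1 / (n + 1 : ℝ) := by rw [hr]; field_simp; ring
    rw [← inv_pow, e1]
    have e2 : 1 + 1 / (n + 1 : ℝ) ≤ Real.exp (1 / (n + 1 : ℝ)) := by
      linarith [Real.add_one_le_exp (1 / (n + 1 : ℝ))]
    calc (1 + 1 / (n + 1 : ℝ)) ^ n ≤ Real.exp (1 / (n + 1 : ℝ)) ^ n := by gcongr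
      _ = Real.exp (n * (1 / (n + 1 : ℝ))) := by rw [← Real.exp_nat_mul]
      _ ≤ Real.exp 1 := by
        rw [Real.exp_le_exp, mul_one_div, div_le_one (by positivity)]; linarith
      _ ≤ 3 := Real.exp_one_lt_three.le
  rw [div_eq_mul_inv, mul_comm]
  gcongr

/-! ### Rapidly decaying sequences and difference equations -/

/-- Families of sequences on `ℤ` that decay rapidly, uniformly in the index of the family. -/
def RapidDecay {ι : Type*} (a : ι → ℤ → ℂ) : Prop :=
  ∀ K : ℕ, ∃ C : ℝ, ∀ i m, ‖a i m‖ * (1 + |(m : ℝ)|) ^ K ≤ C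

theorem summable_one_add_abs_int_inv_sq : Summable fun m : ℤ => ((1 + |(m : ℝ)|) ^ 2)⁻¹ := by
  have h : Summable fun n : ℕ => ((1 + |((n : ℤ) : ℝ)|) ^ 2)⁻¹ := by
    have := (summable_nat_add_iff 1).2 (Real.summable_nat_pow_inv.2 one_lt_two)
    refine this.congr fun n => ?_
    push_cast
    rw [Nat.abs_cast, add_comm]
  exact Summable.of_nat_of_neg h (by simpa using h)

theorem summable_one_add_nat_inv_sq : Summable fun n : ℕ => ((1 + (n : ℝ)) ^ 2)⁻¹ := by
  have := (summable_nat_add_iff 1).2 (Real.summable_nat_pow_inv.2 one_lt_two)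
  refine this.congr fun n => ?_
  push_cast
  rw [add_comm]

namespace RapidDecay

variable {ι : Type*} {a b : ι → ℤ → ℂ}

theorem exists_pos (ha : RapidDecay a) (K : ℕ) :
    ∃ C : ℝ, 0 ≤ C ∧ ∀ i m, ‖a i m‖ ≤ C * ((1 + |(m : ℝ)|) ^ K)⁻¹ := by
  obtain ⟨C, hC⟩ := ha K
  refine ⟨max C 0, le_max_right _ _, fun i m => ?_⟩
  rw [← div_eq_mul_inv, le_div_iff₀ (by positivity)]
  exact (hC i m).trans (le_max_left _ _)

theorem of_bound (h : ∀ K : ℕ, ∃ C : ℝ, ∀ i m, ‖a i m‖ ≤ C * ((1 + |(m : ℝ)|) ^ K)⁻¹) :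
    RapidDecay a := fun K => by
  obtain ⟨C, hC⟩ := h K
  refine ⟨C, fun i m => ?_⟩
  rw [← le_div_iff₀ (by positivity), div_eq_mul_inv]
  exact hC i m

theorem add (ha : RapidDecay a) (hb : RapidDecay b) : RapidDecay fun i m => a i m + b i m :=
  fun K => by
    obtain ⟨C, hC⟩ := ha K
    obtain ⟨C', hC'⟩ := hb K
    refine ⟨C + C', fun i m => ?_⟩
    calc _ ≤ (‖a i m‖ + ‖b i m‖) * (1 + |(m : ℝ)|) ^ K := by gcongr; exact norm_add_le _ _
      _ ≤ _ := by rw [add_mul]; exact add_le_add (hC i m) (hC' i m)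

theorem const_mul (ha : RapidDecay a) {c : ι → ℂ} {B : ℝ} (hc : ∀ i, ‖c i‖ ≤ B) :
    RapidDecay fun i m => c i * a i m := of_bound fun K => by
  obtain ⟨C, hC0, hC⟩ := ha.exists_pos K
  refine ⟨B * C, fun i m => ?_⟩
  rw [norm_mul, mul_assoc]
  exact mul_le_mul (hc i) (hC i m) (norm_nonneg _) ((norm_nonneg _).trans (hc i))

theorem neg (ha : RapidDecay a) : RapidDecay fun i m => -a i m := by
  simpa [RapidDecay] using ha

theorem sub (ha : RapidDecay a) (hb : RapidDecay b) : RapidDecay fun i m => a i m - b i m := by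
  simpa [sub_eq_add_neg] using ha.add hb.neg

theorem int_mul (ha : RapidDecay a) : RapidDecay fun i m => (m : ℂ) * a i m := fun K => by
  obtain ⟨C, hC⟩ := ha (K + 1)
  refine ⟨C, fun i m => le_trans ?_ (hC i m)⟩
  rw [norm_mul, Complex.norm_intCast, pow_succ]
  have : |(m : ℝ)| ≤ 1 + |(m : ℝ)| := by linarith
  calc |(m : ℝ)| * ‖a i m‖ * (1 + |(m : ℝ)|) ^ K
      ≤ (1 + |(m : ℝ)|) * ‖a i m‖ * (1 + |(m : ℝ)|) ^ K := by gcongr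
    _ = _ := by ring

theorem shift (ha : RapidDecay a) (k : ℤ) : RapidDecay fun i m => a i (m + k) := of_bound fun K => by
  obtain ⟨C, hC0, hC⟩ := ha.exists_pos K
  refine ⟨C * (1 + |(k : ℝ)|) ^ K, fun i m => (hC i _).trans ?_⟩
  rw [mul_assoc]
  refine mul_le_mul_of_nonneg_left ?_ hC0
  rw [← div_eq_mul_inv, le_div_iff₀ (by positivity), inv_mul_le_iff₀ (by positivity), ← mul_pow]
  gcongr
  push_cast
  have : |(m : ℝ)| ≤ |(m : ℝ) + k| + |(k : ℝ)| := by
    have := abs_sub ((m : ℝ) + k) k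
    rwa [add_sub_cancel_right] at this
  nlinarith [abs_nonneg ((m : ℝ) + k), abs_nonneg (k : ℝ)]

theorem reflect (ha : RapidDecay a) : RapidDecay fun i m => a i (-m) := fun K => by
  obtain ⟨C, hC⟩ := ha K
  refine ⟨C, fun i m => ?_⟩
  simpa using hC i (-m)

theorem conj (ha : RapidDecay a) : RapidDecay fun i m => (starRingEnd ℂ) (a i m) := by
  simpa [RapidDecay] using ha

theorem summable_mul (ha : RapidDecay a) (i : ι) {u : ℤ → ℂ} {B : ℝ} {p : ℕ}
    (hu : ∀ m, ‖u m‖ ≤ B * (1 + |(m : ℝ)|) ^ p) : Summable fun m => a i m * u m := by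
  obtain ⟨C, hC0, hC⟩ := ha.exists_pos (p + 2)
  refine Summable.of_norm_bounded (summable_one_add_abs_int_inv_sq.mul_left (C * B)) fun m => ?_
  rw [norm_mul]
  calc ‖a i m‖ * ‖u m‖ ≤ C * ((1 + |(m : ℝ)|) ^ (p + 2))⁻¹ * (B * (1 + |(m : ℝ)|) ^ p) := by
        gcongr
        · exact hC i m
        · exact hu m
    _ = _ := by
      rw [pow_add]
      field_simp

theorem norm_tsum_mul_le (ha : RapidDecay a) (p : ℕ) : ∃ C : ℝ, 0 ≤ C ∧ ∀ i, ∀ (u : ℤ → ℂ) (B : ℝ),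
    0 ≤ B → (∀ m, ‖u m‖ ≤ B * (1 + |(m : ℝ)|) ^ p) → ‖∑' m, a i m * u m‖ ≤ C * B := by
  obtain ⟨C, hC0, hC⟩ := ha.exists_pos (p + 2)
  refine ⟨C * ∑' m : ℤ, ((1 + |(m : ℝ)|) ^ 2)⁻¹, by positivity, fun i u B hB hu => ?_⟩
  have hs := summable_one_add_abs_int_inv_sq.mul_left (C * B)
  have := tsum_of_norm_bounded (f := fun m => a i m * u m) hs.hasSum fun m => by
    rw [norm_mul]
    calc ‖a i m‖ * ‖u m‖ ≤ C * ((1 + |(m : ℝ)|) ^ (p + 2))⁻¹ * (B * (1 + |(m : ℝ)|) ^ p) := by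
          gcongr
          · exact hC i m
          · exact hu m
      _ = _ := by
        rw [pow_add]
        field_simp
  rw [tsum_mul_left] at this
  linarith

theorem summable (ha : RapidDecay a) (i : ι) : Summable (a i) := by
  simpa using ha.summable_mul i (u := fun _ => 1) (B := 1) (p := 0) (by simp)

theorem summable_nat_add (ha : RapidDecay a) (i : ι) {μ : ℂ} (hμ : ‖μ‖ ≤ 1) (N : ℤ) :
    Summable fun j : ℕ => μ ^ j * a i (N + j) := by
  have h1 : Summable fun j : ℕ => ‖a i (N + j)‖ :=
    (ha.summable i).norm.comp_injective fun p q h => by simpa using h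
  refine Summable.of_norm_bounded h1 fun j => ?_
  rw [norm_mul, norm_pow]
  exact mul_le_of_le_one_left (norm_nonneg _) (pow_le_one₀ (norm_nonneg _) hμ)

/-- The solution of `κ N - μ κ (N + 1) = a N` that vanishes at `+∞`. -/
def solution (μ : ℂ) (a : ι → ℤ → ℂ) (i : ι) (N : ℤ) : ℂ := ∑' j : ℕ, μ ^ j * a i (N + j)

theorem solution_sub (ha : RapidDecay a) {μ : ℂ} (hμ : ‖μ‖ ≤ 1) (i : ι) (N : ℤ) :
    solution μ a i N - μ * solution μ a i (N + 1) = a i N := by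
  rw [solution, (ha.summable_nat_add i hμ N).tsum_eq_zero_add, solution, ← tsum_mul_left]
  have : ∀ j : ℕ, μ ^ (j + 1) * a i (N + (j + 1 : ℕ)) = μ * (μ ^ j * a i (N + 1 + j)) := fun j => by
    rw [pow_succ, show N + ((j + 1 : ℕ) : ℤ) = N + 1 + j by push_cast; ring]
    ring
  simp only [this, pow_zero, one_mul, Nat.cast_zero, add_zero, add_sub_cancel_right]

/-- Since `1 + |N| ≤ (1 + |N+j|)(1+j)`, the decay of `a` at `N + j` gives decay at `N` up to a
polynomial in `j`, and the geometric weight sums that polynomial. -/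
theorem solution_of_norm_lt_one (ha : RapidDecay a) {μ : ℂ} (hμ : ‖μ‖ < 1) :
    RapidDecay (solution μ a) := of_bound fun K => by
  obtain ⟨C, hC0, hC⟩ := ha.exists_pos K
  have hs : Summable fun j : ℕ => ‖μ‖ ^ j * (1 + (j : ℝ)) ^ K := by
    have h1 : Summable fun j : ℕ => ((j + 1 : ℕ) : ℝ) ^ K * ‖μ‖ ^ (j + 1) :=
      (summable_nat_add_iff 1).2 (summable_pow_mul_geometric_of_norm_lt_one K
        (r := ‖μ‖) (by simpa using hμ))
    by_cases h0 : ‖μ‖ = 0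
    · refine summable_of_ne_finset_zero (s := {0}) fun j hj => ?_
      rw [h0, zero_pow (by simpa using hj), zero_mul]
    · refine (h1.mul_left (‖μ‖⁻¹)).congr fun j => ?_
      push_cast
      field_simp
      ring
  refine ⟨C * ∑' j : ℕ, ‖μ‖ ^ j * (1 + (j : ℝ)) ^ K, fun i N => ?_⟩
  have := tsum_of_norm_bounded (f := fun j : ℕ => μ ^ j * a i (N + j))
    (hs.mul_left (C * ((1 + |(N : ℝ)|) ^ K)⁻¹)).hasSum fun j => by
      rw [norm_mul, norm_pow]
      have h2 : ((1 + |((N + j : ℤ) : ℝ)|) ^ K)⁻¹ ≤ ((1 + |(N : ℝ)|) ^ K)⁻¹ * (1 + (j : ℝ)) ^ K := by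
        rw [inv_mul_eq_div, le_div_iff₀ (by positivity), inv_mul_le_iff₀ (by positivity), ← mul_pow]
        gcongr
        push_cast
        have : |(N : ℝ)| ≤ |(N : ℝ) + j| + j := by
          have := abs_sub ((N : ℝ) + j) j
          rwa [add_sub_cancel_right, Nat.abs_cast] at this
        nlinarith [abs_nonneg ((N : ℝ) + j), (Nat.cast_nonneg j : (0 : ℝ) ≤ j)]
      calc ‖μ‖ ^ j * ‖a i (N + j)‖ ≤ ‖μ‖ ^ j * (C * (((1 + |(N : ℝ)|) ^ K)⁻¹ * (1 + (j : ℝ)) ^ K)) := by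
            gcongr
            exact (hC i _).trans (by gcongr)
        _ = _ := by ring
  rw [tsum_mul_left] at this
  rw [solution]
  linarith

theorem norm_tsum_nat_le {C : ℝ} {K : ℕ} {u : ℕ → ℂ} {M : ℝ} (hC : 0 ≤ C) (hM : 0 ≤ M)
    (hu : ∀ j : ℕ, ‖u j‖ ≤ C * ((1 + (M + j)) ^ (K + 2))⁻¹) :
    ‖∑' j, u j‖ ≤ (C * ∑' j : ℕ, ((1 + (j : ℝ)) ^ 2)⁻¹) * ((1 + M) ^ K)⁻¹ := by
  have := tsum_of_norm_bounded (f := u)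
    (summable_one_add_nat_inv_sq.mul_left (C * ((1 + M) ^ K)⁻¹)).hasSum fun j => by
      refine (hu j).trans ?_
      rw [mul_assoc, pow_add, mul_inv]
      gcongr <;> linarith [(Nat.cast_nonneg j : (0 : ℝ) ≤ j)]
  rw [tsum_mul_left] at this
  linarith

/-- Without geometric damping the forward sum is a tail, hence small, only as `N → +∞`. The
vanishing moment lets it be replaced, as `N → -∞`, by minus the complementary tail. -/
theorem solution_of_moment (ha : RapidDecay a) {μ : ℂ} (hμ : ‖μ‖ = 1)
    (h0 : ∀ i, ∑' N : ℤ, μ ^ N * a i N = 0) : RapidDecay (solution μ a) := of_bound fun K => by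
  have hμ0 : μ ≠ 0 := norm_ne_zero_iff.1 (by rw [hμ]; norm_num)
  obtain ⟨C, hC0, hC⟩ := ha.exists_pos (K + 2)
  refine ⟨C * ∑' j : ℕ, ((1 + (j : ℝ)) ^ 2)⁻¹, fun i N => ?_⟩
  rcases le_or_gt 0 N with hN | hN
  · refine norm_tsum_nat_le hC0 (abs_nonneg _) fun j => ?_
    rw [norm_mul, norm_pow, hμ, one_pow, one_mul]
    refine (hC i _).trans (le_of_eq ?_)
    have h1 : (0 : ℝ) ≤ N := by exact_mod_cast hN
    push_cast
    rw [abs_of_nonneg h1, abs_of_nonneg (by positivity)]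
  · have h1 : Summable fun m : ℤ => μ ^ m * a i (N + m) := by
      refine Summable.of_norm_bounded (g := fun m : ℤ => ‖a i (N + m)‖)
        ((ha.summable i).norm.comp_injective (add_right_injective N)) fun m => ?_
      rw [norm_mul, norm_zpow, hμ, one_zpow, one_mul]
    have h2 : ∑' m : ℤ, μ ^ m * a i (N + m) = 0 := by
      have h3 := (Equiv.addLeft N).tsum_eq fun m : ℤ => μ ^ m * a i m
      rw [h0 i] at h3
      have h4 : ∀ m : ℤ, μ ^ m * a i (N + m) =
          μ ^ (-N) * (μ ^ (Equiv.addLeft N m) * a i (Equiv.addLeft N m)) := fun m => by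
        rw [Equiv.coe_addLeft, ← mul_assoc, ← zpow_add₀ hμ0, neg_add_cancel_left]
      simp only [h4]
      rw [tsum_mul_left, h3, mul_zero]
    -- The full sum over `ℤ` is zero, so the sum over `j ≥ 0` is minus the sum over `j ≤ -1`.
    have h5 : solution μ a i N = -∑' j : ℕ, μ ^ (-((j : ℤ) + 1)) * a i (N + -((j : ℤ) + 1)) := by
      have hn1 : Summable fun j : ℕ => μ ^ (j : ℤ) * a i (N + j) :=
        h1.comp_injective Nat.cast_injective
      have hn2 : Summable fun j : ℕ => μ ^ (-((j : ℤ) + 1)) * a i (N + -((j : ℤ) + 1)) :=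
        h1.comp_injective (i := fun j : ℕ => -((j : ℤ) + 1)) fun p q h => by simpa using h
      have := tsum_of_nat_of_neg_add_one (f := fun m : ℤ => μ ^ m * a i (N + m)) hn1 hn2
      rw [h2] at this
      rw [solution]
      simp only [zpow_natCast] at this
      linear_combination -this
    rw [h5, norm_neg]
    refine norm_tsum_nat_le hC0 (abs_nonneg _) fun j => ?_
    rw [norm_mul, norm_zpow, hμ, one_zpow, one_mul]
    refine (hC i _).trans ?_
    have h1 : (N : ℝ) < 0 := by exact_mod_cast hN
    push_cast
    have hj : (0 : ℝ) ≤ j := j.cast_nonneg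
    rw [abs_of_neg h1, abs_of_neg (a := (N : ℝ) + -((j : ℝ) + 1)) (by linarith)]
    exact mul_le_mul_of_nonneg_left (inv_anti₀ (pow_pos (by linarith) _)
      (pow_le_pow_left₀ (by linarith) (by linarith) _)) hC0

theorem tsum_zpow_shift {μ : ℂ} (hμ : μ ≠ 0) (u : ℤ → ℂ) :
    ∑' N : ℤ, μ ^ N * u (N + 1) = μ⁻¹ * ∑' N : ℤ, μ ^ N * u N := by
  rw [← tsum_mul_left, ← (Equiv.addRight (1 : ℤ)).tsum_eq fun N : ℤ => μ⁻¹ * (μ ^ N * u N)]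
  congr 1
  funext N
  rw [Equiv.coe_addRight, zpow_add_one₀ hμ]
  field_simp

theorem summable_zpow_mul (ha : RapidDecay a) {μ : ℂ} (hμ : ‖μ‖ = 1) (i : ι) :
    Summable fun N : ℤ => μ ^ N * a i N := by
  refine Summable.of_norm_bounded (ha.summable i).norm fun m => ?_
  rw [norm_mul, norm_zpow, hμ, one_zpow, one_mul]

/-- The second-order operator is the composition of two first-order ones. -/
theorem second_order_eq {μ : ℂ} (hμ : μ ≠ 0) {e : ℂ} (he : e ≠ 0) {κ₁ κ₂ : ℤ → ℂ} {α : ℤ → ℂ}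
    (h1 : ∀ N, κ₁ N - μ * κ₁ (N + 1) = α N) (h2 : ∀ N, κ₂ N - μ * κ₂ (N - 1) = κ₁ N) (N : ℤ) :
    e * ((-(μ / e) * κ₂ (N + 1)) + (-(μ / e) * κ₂ (N - 1)) -
      (μ + μ⁻¹) * (-(μ / e) * κ₂ N)) = α N := by
  rw [← h1, ← h2, ← h2, add_sub_cancel_right]
  field_simp
  ring

/-- With `S` the shift, `S + S⁻¹ - (μ + μ⁻¹) = -μ⁻¹ (1 - μS)(1 - μS⁻¹)`. The first factor is
inverted by summing forward, the second by doing the same after reflection. -/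
theorem exists_second_order_of_norm_lt_one (ha : RapidDecay a) {μ : ℂ} (hμ0 : μ ≠ 0)
    (hμ : ‖μ‖ < 1) {e : ℂ} (he : e ≠ 0) : ∃ κ : ι → ℤ → ℂ, RapidDecay κ ∧
      ∀ i N, e * (κ i (N + 1) + κ i (N - 1) - (μ + μ⁻¹) * κ i N) = a i N := by
  have h1 := ha.solution_of_norm_lt_one hμ
  have h2 := h1.reflect.solution_of_norm_lt_one hμ
  refine ⟨fun i N => -(μ / e) * solution μ (fun i m => solution μ a i (-m)) i (-N),
    h2.reflect.const_mul (B := ‖-(μ / e)‖) fun _ => le_rfl, fun i N => ?_⟩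
  refine second_order_eq hμ0 he (κ₂ := fun N => solution μ (fun i m => solution μ a i (-m)) i (-N))
    (ha.solution_sub hμ.le i) (fun N => ?_) N
  have := h1.reflect.solution_sub hμ.le i (-N)
  rw [neg_neg] at this
  rw [← this, show -(N - 1) = -N + 1 by ring]

/-- The same factorization on the unit circle, where each factor costs one vanishing moment. -/
theorem exists_second_order_of_moments (ha : RapidDecay a) {μ : ℂ} (hμ : ‖μ‖ = 1) (hμ2 : μ ^ 2 ≠ 1)
    (hp : ∀ i, ∑' N : ℤ, μ ^ N * a i N = 0) (hm : ∀ i, ∑' N : ℤ, μ⁻¹ ^ N * a i N = 0)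
    {e : ℂ} (he : e ≠ 0) : ∃ κ : ι → ℤ → ℂ, RapidDecay κ ∧
      ∀ i N, e * (κ i (N + 1) + κ i (N - 1) - (μ + μ⁻¹) * κ i N) = a i N := by
  have hμ0 : μ ≠ 0 := norm_ne_zero_iff.1 (by rw [hμ]; norm_num)
  have hμi : ‖μ⁻¹‖ = 1 := by rw [norm_inv, hμ, inv_one]
  have h1 := ha.solution_of_moment hμ hp
  -- Applying `1 - μS` multiplies the moment at `μ⁻¹` by `1 - μ²`. This is nonzero, so the second
  -- condition passes to the intermediate solution.
  have hm1 : ∀ i, ∑' N : ℤ, μ ^ N * solution μ a i (-N) = 0 := fun i => by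
    have e1 : ∀ N : ℤ, μ⁻¹ ^ N * a i N = μ⁻¹ ^ N * solution μ a i N -
        μ * (μ⁻¹ ^ N * solution μ a i (N + 1)) := fun N => by
      rw [← ha.solution_sub hμ.le i N]; ring
    have h2 := hm i
    simp only [e1] at h2
    have hs2 := (h1.shift 1).summable_zpow_mul hμi i
    rw [(h1.summable_zpow_mul hμi i).tsum_sub (hs2.mul_left μ), tsum_mul_left,
      tsum_zpow_shift (inv_ne_zero hμ0), inv_inv] at h2
    have h3 : (1 - μ ^ 2) * ∑' N : ℤ, μ⁻¹ ^ N * solution μ a i N = 0 := by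
      linear_combination h2
    have h4 := (mul_eq_zero.1 h3).resolve_left (sub_ne_zero.2 hμ2.symm)
    rw [← (Equiv.neg ℤ).tsum_eq] at h4
    rw [← h4]
    congr 1
    funext N
    simp
  have h2 := h1.reflect.solution_of_moment hμ hm1
  refine ⟨fun i N => -(μ / e) * solution μ (fun i m => solution μ a i (-m)) i (-N),
    h2.reflect.const_mul (B := ‖-(μ / e)‖) fun _ => le_rfl, fun i N => ?_⟩
  refine second_order_eq hμ0 he (κ₂ := fun N => solution μ (fun i m => solution μ a i (-m)) i (-N))
    (ha.solution_sub hμ.le i) (fun N => ?_) N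
  have := h1.reflect.solution_sub hμ.le i (-N)
  rw [neg_neg] at this
  rw [← this, show -(N - 1) = -N + 1 by ring]

end RapidDecay

/-! ### Pairings with Laguerre functions and the gain of a power of ħ -/

/-- The Laguerre functions, extended by zero to negative degrees. -/
def laguerreInt (d : ℕ) (y : ℝ) (N : ℤ) : ℝ := if 0 ≤ N then laguerreFun d y N.toNat else 0

theorem laguerreInt_natCast (d : ℕ) (y : ℝ) (n : ℕ) : laguerreInt d y n = laguerreFun d y n := by
  simp [laguerreInt]

theorem laguerreInt_of_neg (d : ℕ) (y : ℝ) {N : ℤ} (hN : N < 0) : laguerreInt d y N = 0 :=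
  if_neg (not_le.2 hN)

/-- Extension by zero is compatible with the recurrence because the leading coefficient `N + 1`
vanishes at `N = -1`. Hence summation by parts over `ℤ` has no boundary terms. -/
theorem laguerreInt_recurrence (d : ℕ) (y : ℝ) (N : ℤ) :
    ((N : ℝ) + 1) * laguerreInt d y (N + 1) + (N + d - 1) * laguerreInt d y (N - 1) +
      (2 * N + d - y) * laguerreInt d y N = 0 := by
  rcases lt_trichotomy N (-1) with hN | rfl | hN
  · rw [laguerreInt_of_neg _ _ (by omega), laguerreInt_of_neg _ _ (by omega),
      laguerreInt_of_neg _ _ (by omega)]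
    ring
  · rw [laguerreInt_of_neg d y (N := -1 - 1) (by omega), laguerreInt_of_neg d y (N := -1) (by omega)]
    push_cast
    ring
  · obtain ⟨n, rfl⟩ := Int.eq_ofNat_of_zero_le (show 0 ≤ N by omega)
    rcases n with _ | n
    · rw [laguerreInt_of_neg d y (N := ((0 : ℕ) : ℤ) - 1) (by simp),
        show ((0 : ℕ) : ℤ) + 1 = ((1 : ℕ) : ℤ) by simp, laguerreInt_natCast, laguerreInt_natCast,
        laguerreFun, laguerreFun]
      push_cast
      ring
    · rw [show ((n + 1 : ℕ) : ℤ) + 1 = ((n + 2 : ℕ) : ℤ) by push_cast; ring,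
        show ((n + 1 : ℕ) : ℤ) - 1 = ((n : ℕ) : ℤ) by push_cast; ring]
      simp only [laguerreInt_natCast]
      have := laguerreFun_succ d y n
      push_cast
      linear_combination this

theorem abs_laguerreInt_le (d : ℕ) {y : ℝ} (hy : 0 ≤ y) (N m : ℤ) :
    |laguerreInt d y (N + m)| ≤ 3 * (|(N : ℝ)| + 2) ^ d * (1 + |(m : ℝ)|) ^ d := by
  rcases lt_or_ge (N + m) 0 with h | h
  · rw [laguerreInt_of_neg d y h, abs_zero]
    positivity
  · obtain ⟨n, hn⟩ := Int.eq_ofNat_of_zero_le h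
    rw [hn, laguerreInt_natCast, mul_assoc, ← mul_pow]
    refine (abs_laguerreFun_le d hy n).trans ?_
    have h1 : (n : ℝ) = N + m := by exact_mod_cast hn.symm
    rw [h1]
    have h2 : (0 : ℝ) ≤ N + m := h1 ▸ n.cast_nonneg
    gcongr
    nlinarith [le_abs_self (N : ℝ), le_abs_self (m : ℝ), abs_nonneg (N : ℝ), abs_nonneg (m : ℝ)]

/-- The range of Planck's constant. -/
abbrev Planck : Type := Set.Ioc (0 : ℝ) 1

theorem Planck.pos (i : Planck) : 0 < (i : ℝ) := i.2.1

theorem Planck.le_one (i : Planck) : (i : ℝ) ≤ 1 := i.2.2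

/-- The integer part of the spectral parameter `E/ħ - d/2`. -/
def center (d : ℕ) (E ħ : ℝ) : ℤ := ⌊E / ħ - d / 2⌋

/-- The fractional part of the spectral parameter `E/ħ - d/2`. -/
def offset (d : ℕ) (E ħ : ℝ) : ℝ := Int.fract (E / ħ - d / 2)

theorem center_add_offset (d : ℕ) (E ħ : ℝ) : (center d E ħ : ℝ) + offset d E ħ = E / ħ - d / 2 :=
  Int.floor_add_fract _

theorem abs_offset_le (d : ℕ) (E ħ : ℝ) : |offset d E ħ| ≤ 1 := by
  rw [offset, Int.abs_fract]
  exact (Int.fract_lt_one _).le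

/-- The pairing of a family of sequences, centred at the spectral parameter, with the Laguerre
functions. -/
def pairing {ι : Type*} (d : ℕ) (E H : ℝ) (ħ : ι → ℝ) (a : ι → ℤ → ℂ) (i : ι) : ℂ :=
  ∑' m : ℤ, a i m * laguerreInt d (4 * H / ħ i) (center d E (ħ i) + m)

section

variable {ι : Type*} {d : ℕ} {E H : ℝ} {ħ : ι → ℝ} {a b : ι → ℤ → ℂ}

theorem norm_laguerreInt_le (d : ℕ) {y : ℝ} (hy : 0 ≤ y) (N m : ℤ) :
    ‖((laguerreInt d y (N + m) : ℝ) : ℂ)‖ ≤ 3 * (|(N : ℝ)| + 2) ^ d * (1 + |(m : ℝ)|) ^ d := by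
  rw [Complex.norm_real]
  exact abs_laguerreInt_le d hy N m

theorem RapidDecay.summable_pairing (ha : RapidDecay a) (hH : 0 ≤ H) (hħ : ∀ i, 0 < ħ i) (i : ι) :
    Summable fun m : ℤ => a i m * laguerreInt d (4 * H / ħ i) (center d E (ħ i) + m) :=
  ha.summable_mul i (norm_laguerreInt_le d (by have := hħ i; positivity) _)

theorem pairing_add (ha : RapidDecay a) (hb : RapidDecay b) (hH : 0 ≤ H) (hħ : ∀ i, 0 < ħ i)
    (i : ι) : pairing d E H ħ (fun i m => a i m + b i m) i =
      pairing d E H ħ a i + pairing d E H ħ b i := by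
  rw [pairing, pairing, pairing,
    ← (ha.summable_pairing hH hħ i).tsum_add (hb.summable_pairing hH hħ i)]
  simp only [add_mul]

theorem pairing_const_mul (c : ι → ℂ) (i : ι) :
    pairing d E H ħ (fun i m => c i * a i m) i = c i * pairing d E H ħ a i := by
  rw [pairing, pairing, ← tsum_mul_left]
  simp only [mul_assoc]

theorem pairing_neg (i : ι) : pairing d E H ħ (fun i m => -a i m) i = -pairing d E H ħ a i := by
  simp only [pairing, neg_mul, tsum_neg]

theorem pairing_conj (i : ι) : pairing d E H ħ (fun i m => (starRingEnd ℂ) (a i m)) i =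
    (starRingEnd ℂ) (pairing d E H ħ a i) := by
  rw [pairing, pairing, Complex.conj_tsum]
  simp

/-- The centre is `O(1/ħ)` and the Laguerre functions grow at most like the `d`-th power of the
degree. This crude bound starts every iteration. -/
theorem norm_pairing_le (hE : 0 ≤ E) (hH : 0 ≤ H) {a : Planck → ℤ → ℂ} (ha : RapidDecay a) :
    ∃ C : ℝ, 0 ≤ C ∧ ∀ i : Planck, ‖pairing d E H (↑) a i‖ ≤ C / (i : ℝ) ^ d := by
  obtain ⟨C, hC0, hC⟩ := ha.norm_tsum_mul_le d
  refine ⟨C * (3 * (E + d / 2 + 3) ^ d), by positivity, fun i => ?_⟩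
  have hi := i.pos
  have h1 := hC i (fun m => laguerreInt d (4 * H / i) (center d E i + m))
    (3 * (|(center d E i : ℝ)| + 2) ^ d) (by positivity)
    (norm_laguerreInt_le d (by positivity) _)
  refine h1.trans ?_
  rw [mul_div_assoc, mul_div_assoc, ← div_pow]
  gcongr
  rw [le_div_iff₀ hi]
  have h2 : |(center d E i : ℝ)| ≤ E / i + d / 2 + 1 := by
    rw [eq_sub_of_add_eq (center_add_offset d E i)]
    have h3 := abs_offset_le d E i
    have h4 : 0 ≤ E / (i : ℝ) := by positivity
    rw [abs_le] at h3 ⊢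
    constructor <;> linarith [(Nat.cast_nonneg d : (0 : ℝ) ≤ d)]
  have h5 : E / (i : ℝ) * i = E := div_mul_cancel₀ _ hi.ne'
  have h6 := i.le_one
  calc (|(center d E i : ℝ)| + 2) * i ≤ (E / i + d / 2 + 1 + 2) * i := by gcongr
    _ = E + (d / 2 + 3) * i := by linear_combination h5
    _ ≤ E + (d / 2 + 3) * 1 := by gcongr
    _ = _ := by ring

theorem tsum_mul_laguerreInt_shift (u : ℤ → ℂ) (y : ℝ) (c k : ℤ) :
    ∑' m : ℤ, u m * laguerreInt d y (c + m + k) =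
      ∑' m : ℤ, u (m - k) * laguerreInt d y (c + m) := by
  rw [← (Equiv.addRight k).tsum_eq fun m => u (m - k) * laguerreInt d y (c + m)]
  simp [add_assoc]

/-- Summation by parts against the three-term recurrence: the second-order operator gains a power
of `ħ`. -/
theorem pairing_second_order (hH : 0 ≤ H) (hħ : ∀ i, 0 < ħ i) {κ : ι → ℤ → ℂ}
    (hκ : RapidDecay κ) : ∃ κ' : ι → ℤ → ℂ, RapidDecay κ' ∧ ∀ i,
      pairing d E H ħ (fun i m => E * (κ i (m + 1) + κ i (m - 1)) + (2 * E - 4 * H) * κ i m) i =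
        ħ i * pairing d E H ħ κ' i := by
  set u : ι → ℤ → ℂ := fun i m => m * κ i m - offset d E (ħ i) * κ i m with hu_def
  have hu : RapidDecay u := hκ.int_mul.sub (hκ.const_mul (B := 1) fun i => by
    rw [Complex.norm_real]; exact abs_offset_le d E (ħ i))
  -- At degree `N = n₀ + m` the coefficients `N + 1` and `N + d - 1` equal `E/ħ + (m - ε) ± (1 -
  -- d/2)`, with ε the offset.
  set c : ℂ := 1 - d / 2 with hc_def
  set p : ι → ℤ → ℂ := fun i m => u i m + c * κ i m with hp_def
  set q : ι → ℤ → ℂ := fun i m => u i m + -c * κ i m with hq_def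
  have hp : RapidDecay p := hu.add (hκ.const_mul (c := fun _ => c) fun _ => le_rfl)
  have hq : RapidDecay q := hu.add (hκ.const_mul (c := fun _ => -c) fun _ => le_rfl)
  have h2u : RapidDecay fun i m => 2 * u i m := hu.const_mul (c := fun _ => 2) fun _ => le_rfl
  have hκ' := ((hp.shift (-1)).add ((hq.shift 1).add h2u)).neg
  refine ⟨_, hκ', fun i => ?_⟩
  have hi := hħ i
  have hy : 0 ≤ 4 * H / ħ i := by positivity
  set L : ℤ → ℂ := fun m => ((laguerreInt d (4 * H / ħ i) m : ℝ) : ℂ)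
  set n₀ := center d E (ħ i)
  have hsum : ∀ {v : ι → ℤ → ℂ}, RapidDecay v → ∀ k : ℤ, Summable fun m : ℤ => v i m * L (n₀ + m + k) :=
    fun {v} hv k => by
      have := hv.summable_mul i (norm_laguerreInt_le d hy (n₀ + k))
      refine this.congr fun m => ?_
      simp only [L]
      rw [show n₀ + k + m = n₀ + m + k by ring]
  have hn₀ : (ħ i : ℂ) * n₀ = E - ħ i * d / 2 - ħ i * offset d E (ħ i) := by
    have h1 := center_add_offset d E (ħ i)
    have h2 : ħ i * (n₀ : ℝ) = E - ħ i * d / 2 - ħ i * offset d E (ħ i) := by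
      rw [eq_sub_of_add_eq h1]
      field_simp
    exact_mod_cast congrArg Complex.ofReal h2
  -- The recurrence at `n₀ + m`, multiplied by `ħ κ(m)`, split into its constant-coefficient part
  -- and the part carrying an explicit ħ.
  have hrec : ∀ m : ℤ, (E * κ i m + ħ i * p i m) * L (n₀ + m + 1) +
      (E * κ i m + ħ i * q i m) * L (n₀ + m + (-1)) +
      ((2 * E - 4 * H) * κ i m + ħ i * (2 * u i m)) * L (n₀ + m + 0) = 0 := fun m => by
    have h1 := congrArg Complex.ofReal (laguerreInt_recurrence d (4 * H / ħ i) (n₀ + m))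
    have h2 : (ħ i : ℂ) ≠ 0 := by exact_mod_cast hi.ne'
    have h3 : (ħ i : ℂ) * (4 * H / ħ i) = 4 * H := by field_simp
    push_cast at h1
    simp only [L, hp_def, hq_def, hu_def, hc_def]
    rw [add_zero, ← sub_eq_add_neg]
    linear_combination (κ i m * ħ i) * h1 + κ i m * L (n₀ + m) * h3 - κ i m *
      (L (n₀ + m + 1) + L (n₀ + m - 1) + 2 * L (n₀ + m)) * hn₀
  have hEκ : RapidDecay fun i m => (E : ℂ) * κ i m := hκ.const_mul (c := fun _ => (E : ℂ)) fun _ => le_rfl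
  have hEHκ : RapidDecay fun i m => (2 * E - 4 * H : ℂ) * κ i m :=
    hκ.const_mul (c := fun _ => (2 * E - 4 * H : ℂ)) fun _ => le_rfl
  have hshift : ∀ (v : ι → ℤ → ℂ) (k : ℤ), pairing d E H ħ (fun i m => v i (m + k)) i =
      ∑' m : ℤ, v i m * L (n₀ + m + -k) := fun v k => by
    have := tsum_mul_laguerreInt_shift (d := d) (v i) (4 * H / ħ i) n₀ (-k)
    simp only [sub_neg_eq_add] at this
    exact this.symm
  have hzero : ∀ v : ι → ℤ → ℂ, pairing d E H ħ v i = ∑' m : ℤ, v i m * L (n₀ + m + 0) := fun v => by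
    simp only [add_zero]
    rfl
  have htot : (∑' m : ℤ, (E : ℂ) * κ i m * L (n₀ + m + 1)) + ħ i * (∑' m : ℤ, p i m * L (n₀ + m + 1)) +
      ((∑' m : ℤ, (E : ℂ) * κ i m * L (n₀ + m + -1)) + ħ i * ∑' m : ℤ, q i m * L (n₀ + m + -1)) +
      ((∑' m : ℤ, (2 * E - 4 * H) * κ i m * L (n₀ + m + 0)) +
        ħ i * ∑' m : ℤ, 2 * u i m * L (n₀ + m + 0)) = 0 := by
    rw [← tsum_mul_left, ← tsum_mul_left, ← tsum_mul_left,
      ← (hsum hEκ 1).tsum_add ((hsum hp 1).mul_left _),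
      ← (hsum hEκ (-1)).tsum_add ((hsum hq (-1)).mul_left _),
      ← (hsum hEHκ 0).tsum_add ((hsum h2u 0).mul_left _),
      ← ((hsum hEκ 1).add ((hsum hp 1).mul_left _)).tsum_add
        ((hsum hEκ (-1)).add ((hsum hq (-1)).mul_left _)),
      ← (((hsum hEκ 1).add ((hsum hp 1).mul_left _)).add
        ((hsum hEκ (-1)).add ((hsum hq (-1)).mul_left _))).tsum_add
        ((hsum hEHκ 0).add ((hsum h2u 0).mul_left _))]
    rw [← tsum_zero (α := ℂ) (β := ℤ)]
    congr 1
    funext m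
    rw [← hrec m]
    ring
  have eL : pairing d E H ħ (fun i m => E * (κ i (m + 1) + κ i (m - 1)) + (2 * E - 4 * H) * κ i m) i =
      pairing d E H ħ (fun i m => E * κ i (m + 1)) i + pairing d E H ħ (fun i m => E * κ i (m + -1)) i +
        pairing d E H ħ (fun i m => (2 * E - 4 * H) * κ i m) i := by
    rw [← pairing_add (hEκ.shift 1) (hEκ.shift (-1)) hH hħ,
      ← pairing_add ((hEκ.shift 1).add (hEκ.shift (-1))) hEHκ hH hħ]
    simp only [mul_add, sub_eq_add_neg]
  have eR : pairing d E H ħ (fun i m => -(p i (m + -1) + (q i (m + 1) + 2 * u i m))) i =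
      -(pairing d E H ħ (fun i m => p i (m + -1)) i + (pairing d E H ħ (fun i m => q i (m + 1)) i +
        pairing d E H ħ (fun i m => 2 * u i m) i)) := by
    rw [← pairing_add (hq.shift 1) h2u hH hħ,
      ← pairing_add (hp.shift (-1)) ((hq.shift 1).add h2u) hH hħ, pairing_neg]
  rw [eL, eR, hshift (fun i m => E * κ i m), hshift (fun i m => E * κ i m), hshift p, hshift q, hzero,
    hzero, neg_neg]
  linear_combination htot

theorem norm_tsum_zpow_le {a : ι → ℤ → ℂ} (ha : RapidDecay a) {μ : ℂ} (hμ : ‖μ‖ = 1) :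
    ∃ C : ℝ, 0 ≤ C ∧ ∀ i, ‖∑' m : ℤ, μ ^ m * a i m‖ ≤ C := by
  obtain ⟨C, hC0, hC⟩ := ha.norm_tsum_mul_le 0
  refine ⟨C, hC0, fun i => ?_⟩
  have := hC i (fun m => μ ^ m) 1 zero_le_one fun m => by simp [norm_zpow, hμ]
  simpa [mul_comm] using this

/-- Iterating an estimate that gains a power of `ħ`. -/
theorem norm_pairing_le_of_gain (hE : 0 ≤ E) (hH : 0 ≤ H) {β : Planck → ℝ} (hβ : ∀ i, 0 ≤ β i)
    (hgain : ∀ a : Planck → ℤ → ℂ, RapidDecay a → ∃ a' : Planck → ℤ → ℂ, RapidDecay a' ∧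
      ∃ C : ℝ, ∀ i, ‖pairing d E H (↑) a i‖ ≤ C * β i + i * ‖pairing d E H (↑) a' i‖)
    (M : ℕ) {a : Planck → ℤ → ℂ} (ha : RapidDecay a) :
    ∃ C : ℝ, 0 ≤ C ∧ ∀ i : Planck,
      ‖pairing d E H (↑) a i‖ ≤ C * (β i + (i : ℝ) ^ M / (i : ℝ) ^ d) := by
  induction M generalizing a with
  | zero =>
    obtain ⟨C, hC0, hC⟩ := norm_pairing_le (d := d) hE hH ha
    refine ⟨C, hC0, fun i => (hC i).trans ?_⟩
    rw [div_eq_mul_inv, pow_zero, one_div]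
    gcongr
    linarith [hβ i]
  | succ M ih =>
    obtain ⟨a', ha', C₁, hC₁⟩ := hgain a ha
    obtain ⟨C₂, hC₂0, hC₂⟩ := ih ha'
    refine ⟨|C₁| + C₂, by positivity, fun i => (hC₁ i).trans ?_⟩
    have hi := i.pos
    have h1 := i.le_one
    have hb := hβ i
    calc C₁ * β i + i * ‖pairing d E H (↑) a' i‖
        ≤ |C₁| * β i + i * (C₂ * (β i + (i : ℝ) ^ M / (i : ℝ) ^ d)) := by
          gcongr
          · exact le_abs_self _
          · exact hC₂ i
      _ = |C₁| * β i + (i * (C₂ * β i) + C₂ * ((i : ℝ) ^ (M + 1) / (i : ℝ) ^ d)) := by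
        rw [pow_succ]; ring
      _ ≤ |C₁| * β i + (1 * (C₂ * β i) + C₂ * ((i : ℝ) ^ (M + 1) / (i : ℝ) ^ d)) := by gcongr
      _ ≤ (|C₁| + C₂) * (β i + (i : ℝ) ^ (M + 1) / (i : ℝ) ^ d) := by
        have : 0 ≤ |C₁| * ((i : ℝ) ^ (M + 1) / (i : ℝ) ^ d) := by positivity
        linarith

/-! ### The forbidden region -/

/-- In the forbidden region every pairing is `O(ħ^∞)`. -/
theorem norm_pairing_le_of_forbidden (hE : 0 < E) (hEH : E < H) (M : ℕ) {a : Planck → ℤ → ℂ}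
    (ha : RapidDecay a) :
    ∃ C : ℝ, 0 ≤ C ∧ ∀ i : Planck, ‖pairing d E H (↑) a i‖ ≤ C * ((i : ℝ) ^ M / (i : ℝ) ^ d) := by
  have hH : 0 < H := hE.trans hEH
  -- The characteristic equation is `μ + μ⁻¹ = 2c`. Here `c > 1`, so the roots `c ± √(c² - 1)` are
  -- real and the smaller one lies inside the unit disc.
  set c : ℝ := 2 * H / E - 1 with hc
  have hc1 : 1 < c := by
    rw [hc, lt_sub_iff_add_lt, lt_div_iff₀ hE]; linarith
  set s : ℝ := √(c ^ 2 - 1)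
  have hs2 : s ^ 2 = c ^ 2 - 1 := Real.sq_sqrt (by nlinarith)
  have hs0 : 0 ≤ s := Real.sqrt_nonneg _
  have hsc : s < c := by nlinarith
  have hinv : (c - s)⁻¹ = c + s := by
    rw [inv_eq_one_div, div_eq_iff (by linarith)]; linear_combination hs2
  set μ : ℂ := ((c - s : ℝ) : ℂ) with hμ_def
  have hμ1 : c - s < 1 := by nlinarith
  have hμn : ‖μ‖ < 1 := by
    rw [hμ_def, Complex.norm_real, Real.norm_eq_abs, abs_of_pos (by linarith)]; exact hμ1
  have hμ0 : μ ≠ 0 := by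
    rw [hμ_def]; exact_mod_cast (sub_pos.2 hsc).ne'
  have hμs : μ + μ⁻¹ = 2 * c := by
    rw [hμ_def, ← Complex.ofReal_inv, hinv]; push_cast; ring
  have hE0 : (E : ℂ) ≠ 0 := by exact_mod_cast hE.ne'
  have := norm_pairing_le_of_gain (d := d) hE.le hH.le (β := fun _ => 0) (fun _ => le_rfl)
    (fun a ha => ?_) M ha
  · simpa using this
  · obtain ⟨κ, hκ, hκa⟩ := ha.exists_second_order_of_norm_lt_one hμ0 hμn hE0
    obtain ⟨κ', hκ', h⟩ := pairing_second_order (d := d) (E := E) hH.le (fun i : Planck => i.pos) hκ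
    refine ⟨κ', hκ', 0, fun i => ?_⟩
    have e : a = fun i m => (E : ℂ) * (κ i (m + 1) + κ i (m - 1)) + (2 * E - 4 * H) * κ i m := by
      funext i m
      rw [← hκa, hμs, hc]
      push_cast
      field_simp
      ring
    rw [e, h i, norm_mul, Complex.norm_real, Real.norm_of_nonneg i.pos.le, zero_mul, zero_add]

end

/-! ### The allowed region: reduction to a test family -/

section

variable {d : ℕ} {E H : ℝ} {b : Planck → ℤ → ℂ} {μ : ℂ}

/-- The Fourier coefficients of a family of sequences at the frequency `μ`. -/
def moment (μ : ℂ) (a : Planck → ℤ → ℂ) (i : Planck) : ℂ := ∑' m : ℤ, μ ^ m * a i m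

theorem moment_conj (hμ : ‖μ‖ = 1) (a : Planck → ℤ → ℂ) (i : Planck) :
    moment μ (fun i m => (starRingEnd ℂ) (a i m)) i = (starRingEnd ℂ) (moment μ⁻¹ a i) := by
  have h1 : (starRingEnd ℂ) μ⁻¹ = μ := by
    rw [Complex.inv_def, Complex.normSq_eq_norm_sq, hμ]; simp
  rw [moment, moment, Complex.conj_tsum]
  congr 1
  funext m
  rw [map_mul, map_zpow₀, h1]

theorem moment_sub_add (hμ : ‖μ‖ = 1) {a b b' : Planck → ℤ → ℂ} (ha : RapidDecay a)
    (hb : RapidDecay b) (hb' : RapidDecay b') (c c' : Planck → ℂ) (i : Planck) :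
    moment μ (fun i m => a i m - (c i * b i m + c' i * b' i m)) i =
      moment μ a i - (c i * moment μ b i + c' i * moment μ b' i) := by
  have h0 := ha.summable_zpow_mul hμ i
  have h1 := (hb.summable_zpow_mul hμ i).mul_left (c i)
  have h2 := (hb'.summable_zpow_mul hμ i).mul_left (c' i)
  rw [moment, moment, moment, moment, ← tsum_mul_left, ← tsum_mul_left, ← h1.tsum_add h2,
    ← h0.tsum_sub (h1.add h2)]
  congr 1
  funext m
  ring

/-- After subtraction of a combination of `b` and its conjugate with the same moments at `μ` and
`μ⁻¹`, the remainder is in the range of the second-order operator, so its pairing gains ħ.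
Conjugation commutes with pairing because the Laguerre functions are real. -/
theorem pairing_reduce_of_coeff (hE : 0 < E) (hH : 0 < H) (hμ : ‖μ‖ = 1) (hμ2 : μ ^ 2 ≠ 1)
    (hμE : E * (μ + μ⁻¹) = 4 * H - 2 * E) (hb : RapidDecay b)
    {a : Planck → ℤ → ℂ} (ha : RapidDecay a) {c₁ c₂ : Planck → ℂ} {B₁ B₂ : ℝ}
    (hc₁ : ∀ i, ‖c₁ i‖ ≤ B₁) (hc₂ : ∀ i, ‖c₂ i‖ ≤ B₂)
    (h₁ : ∀ i, moment μ a i = c₁ i * moment μ b i + c₂ i * (starRingEnd ℂ) (moment μ⁻¹ b i))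
    (h₂ : ∀ i, moment μ⁻¹ a i = c₁ i * moment μ⁻¹ b i + c₂ i * (starRingEnd ℂ) (moment μ b i)) :
    ∃ a' : Planck → ℤ → ℂ, RapidDecay a' ∧ ∀ i, pairing d E H (↑) a i =
      c₁ i * pairing d E H (↑) b i +
      c₂ i * (starRingEnd ℂ) (pairing d E H (↑) b i) + i * pairing d E H (↑) a' i := by
  have hμi : ‖μ⁻¹‖ = 1 := by rw [norm_inv, hμ, inv_one]
  have r1 : RapidDecay fun i m => c₁ i * b i m := hb.const_mul hc₁
  have r2 : RapidDecay fun i m => c₂ i * (starRingEnd ℂ) (b i m) := hb.conj.const_mul hc₂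
  have hr : RapidDecay fun i m => a i m - (c₁ i * b i m + c₂ i * (starRingEnd ℂ) (b i m)) :=
    ha.sub (r1.add r2)
  have hE0 : (E : ℂ) ≠ 0 := by exact_mod_cast hE.ne'
  obtain ⟨κ, hκ, hκr⟩ := hr.exists_second_order_of_moments hμ hμ2
    (fun i => by
      refine (moment_sub_add hμ ha hb hb.conj c₁ c₂ i).trans ?_
      rw [moment_conj hμ, h₁, sub_self])
    (fun i => by
      refine (moment_sub_add hμi ha hb hb.conj c₁ c₂ i).trans ?_
      rw [moment_conj hμi, h₂, inv_inv, sub_self])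
    hE0
  obtain ⟨κ', hκ', h⟩ := pairing_second_order (d := d) (E := E) hH.le (fun i : Planck => i.pos) hκ
  refine ⟨κ', hκ', fun i => ?_⟩
  have ea : a = fun i m => (c₁ i * b i m + c₂ i * (starRingEnd ℂ) (b i m)) +
      (E * (κ i (m + 1) + κ i (m - 1)) + (2 * E - 4 * H) * κ i m) := by
    funext i m
    linear_combination -hκr i m - κ i m * hμE
  have hκ'' : RapidDecay fun i m =>
      (E : ℂ) * (κ i (m + 1) + κ i (m - 1)) + (2 * E - 4 * H) * κ i m := by
    refine RapidDecay.add (hκ.shift 1 |>.add (hκ.shift (-1)) |>.const_mul (c := fun _ => (E : ℂ))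
      fun _ => le_rfl) (hκ.const_mul (c := fun _ => (2 * E - 4 * H : ℂ)) fun _ => le_rfl)
  rw [← h i, ← pairing_const_mul, ← pairing_conj, ← pairing_const_mul,
    ← pairing_add r1 r2 hH.le (fun i : Planck => i.pos),
    ← pairing_add (r1.add r2) hκ'' hH.le (fun i : Planck => i.pos), ← ea]

/-- As `b` has a moment only at `μ` and its conjugate only at `μ⁻¹`, the two linear conditions
decouple and the coefficients are quotients of moments. -/
theorem pairing_reduce (hE : 0 < E) (hH : 0 < H) (hμ : ‖μ‖ = 1) (hμ2 : μ ^ 2 ≠ 1)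
    (hμE : E * (μ + μ⁻¹) = 4 * H - 2 * E) (hb : RapidDecay b)
    (hb0 : ∀ i, moment μ⁻¹ b i = 0) {B : ℝ} (hB : 0 < B) (hb1 : ∀ i, ‖moment μ b i‖ = B)
    {a : Planck → ℤ → ℂ} (ha : RapidDecay a) :
    ∃ a' : Planck → ℤ → ℂ, RapidDecay a' ∧ ∀ i, pairing d E H (↑) a i =
      moment μ a i / moment μ b i * pairing d E H (↑) b i +
      moment μ⁻¹ a i / (starRingEnd ℂ) (moment μ b i) *
        (starRingEnd ℂ) (pairing d E H (↑) b i) + i * pairing d E H (↑) a' i := by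
  have hμi : ‖μ⁻¹‖ = 1 := by rw [norm_inv, hμ, inv_one]
  have hne : ∀ i, moment μ b i ≠ 0 := fun i => norm_ne_zero_iff.1 (by rw [hb1 i]; exact hB.ne')
  have hne' : ∀ i, (starRingEnd ℂ) (moment μ b i) ≠ 0 := fun i => by simpa using hne i
  obtain ⟨C₁, -, hC₁⟩ := norm_tsum_zpow_le ha hμ
  obtain ⟨C₂, -, hC₂⟩ := norm_tsum_zpow_le ha hμi
  refine pairing_reduce_of_coeff hE hH hμ hμ2 hμE hb ha (B₁ := C₁ / B) (B₂ := C₂ / B)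
    (fun i => ?_) (fun i => ?_) (fun i => ?_) fun i => ?_
  · rw [norm_div, hb1]
    exact div_le_div_of_nonneg_right (hC₁ i) hB.le
  · rw [norm_div, RCLike.norm_conj, hb1]
    exact div_le_div_of_nonneg_right (hC₂ i) hB.le
  · rw [hb0, map_zero, mul_zero, add_zero, div_mul_cancel₀ _ (hne i)]
  · rw [hb0, mul_zero, zero_add, div_mul_cancel₀ _ (hne' i)]

/-- In the allowed region, pairings reduce to those of a test family. -/
theorem norm_pairing_sub_le (hE : 0 < E) (hH : 0 < H) (hμ : ‖μ‖ = 1) (hμ2 : μ ^ 2 ≠ 1)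
    (hμE : E * (μ + μ⁻¹) = 4 * H - 2 * E) (hb : RapidDecay b)
    (hb0 : ∀ i, moment μ⁻¹ b i = 0) {B : ℝ} (hB : 0 < B) (hb1 : ∀ i, ‖moment μ b i‖ = B)
    {D : ℝ} (hD : ∀ i : Planck, ‖pairing d E H (↑) b i‖ ≤ D * √i)
    {a : Planck → ℤ → ℂ} (ha : RapidDecay a) :
    ∃ C : ℝ, 0 ≤ C ∧ ∀ i : Planck, ‖pairing d E H (↑) a i -
      (moment μ a i / moment μ b i * pairing d E H (↑) b i +
      moment μ⁻¹ a i / (starRingEnd ℂ) (moment μ b i) *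
        (starRingEnd ℂ) (pairing d E H (↑) b i))‖ ≤ C * (i * √i) := by
  have hμi : ‖μ⁻¹‖ = 1 := by rw [norm_inv, hμ, inv_one]
  obtain ⟨a', ha', h⟩ := pairing_reduce (d := d) hE hH hμ hμ2 hμE hb hb0 hB hb1 ha
  -- The remainder `a'` is bounded by the size of the test pairing plus an error. With `d + 1`
  -- iterations that error is `ħ^{d+1}/ħ^d = ħ ≤ √ħ`.
  have hgain := norm_pairing_le_of_gain (d := d) hE.le hH.le
    (β := fun i : Planck => ‖pairing d E H (↑) b i‖) (fun i => norm_nonneg _) (fun a ha => ?_)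
    (d + 1) ha'
  · obtain ⟨C, hC0, hC⟩ := hgain
    refine ⟨C * (|D| + 1), by positivity, fun i => ?_⟩
    have hi := i.pos
    have h1 := i.le_one
    rw [h i, add_sub_cancel_left, norm_mul, Complex.norm_real, Real.norm_of_nonneg hi.le]
    have h2 : (i : ℝ) ^ (d + 1) / (i : ℝ) ^ d ≤ √i := by
      rw [pow_succ, mul_div_assoc, mul_div_cancel₀ _ (by positivity)]
      exact Real.le_sqrt_of_sq_le (by nlinarith)
    calc (i : ℝ) * ‖pairing d E H (↑) a' i‖
        ≤ i * (C * (|D| * √i + √i)) := by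
          gcongr
          refine (hC i).trans ?_
          gcongr
          refine (hD i).trans ?_
          gcongr
          exact le_abs_self _
      _ = _ := by ring
  · obtain ⟨a', ha', h⟩ := pairing_reduce (d := d) hE hH hμ hμ2 hμE hb hb0 hB hb1 ha
    obtain ⟨C₁, -, hC₁⟩ := norm_tsum_zpow_le ha hμ
    obtain ⟨C₂, -, hC₂⟩ := norm_tsum_zpow_le ha hμi
    refine ⟨a', ha', C₁ / B + C₂ / B, fun i => ?_⟩
    rw [h i]
    refine (norm_add₃_le).trans ?_
    rw [norm_mul, norm_mul, norm_mul, norm_div, norm_div, RCLike.norm_conj, RCLike.norm_conj, hb1,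
      Complex.norm_real, Real.norm_of_nonneg i.pos.le, add_mul]
    gcongr
    · exact hC₁ i
    · exact hC₂ i

end

/-! ### Fourier inversion and Poisson summation -/

open scoped FourierTransform

theorem fourierHat_eq_fourier (f : 𝓢(ℝ, ℂ)) (t : ℝ) :
    fourierHat f t = 𝓕 f (t / (2 * Real.pi)) := by
  rw [SchwartzMap.fourier_coe, Real.fourier_real_eq_integral_exp_smul, fourierHat]
  congr 1
  funext s
  rw [smul_eq_mul, mul_comm]
  congr 2
  have : (Real.pi : ℂ) ≠ 0 := by exact_mod_cast Real.pi_ne_zero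
  push_cast
  field_simp

/-- The lattice samples of a Schwartz function. -/
theorem rapidDecay_schwartz {ι : Type*} (g : 𝓢(ℝ, ℂ)) {c : ι → ℝ} {B : ℝ} (hc : ∀ i, |c i| ≤ B) :
    RapidDecay fun i (m : ℤ) => g (c i - m) := fun K => by
  obtain ⟨C, hC⟩ : ∃ C : ℝ, ∀ s : ℝ, (1 + ‖s‖) ^ K * ‖g s‖ ≤ C := by
    have := fun s => SchwartzMap.one_add_le_sup_seminorm_apply (𝕜 := ℝ) (m := (K, 0)) le_rfl le_rfl g s
    simp only [norm_iteratedFDeriv_zero] at this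
    exact ⟨_, this⟩
  refine ⟨(1 + B) ^ K * C, fun i m => ?_⟩
  have hB : 0 ≤ B := (abs_nonneg _).trans (hc i)
  have h1 : 1 + |(m : ℝ)| ≤ (1 + B) * (1 + ‖c i - m‖) := by
    have h2 : |(m : ℝ)| ≤ |c i| + |c i - m| := by
      have := abs_sub (c i) (c i - m)
      rwa [sub_sub_cancel] at this
    rw [Real.norm_eq_abs]
    nlinarith [hc i, abs_nonneg (c i - m)]
  calc ‖g (c i - m)‖ * (1 + |(m : ℝ)|) ^ K
      ≤ ‖g (c i - m)‖ * ((1 + B) * (1 + ‖c i - m‖)) ^ K := by gcongr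
    _ = (1 + B) ^ K * ((1 + ‖c i - m‖) ^ K * ‖g (c i - m)‖) := by rw [mul_pow]; ring
    _ ≤ (1 + B) ^ K * C := by gcongr; exact hC _

theorem summable_fourierHat_shift (g : 𝓢(ℝ, ℂ)) (τ : ℝ) :
    Summable fun k : ℤ => fourierHat g (τ + 2 * Real.pi * k) := by
  have := (rapidDecay_schwartz (𝓕 g) (c := fun _ : Unit => τ / (2 * Real.pi))
    fun _ => le_rfl).reflect.summable ()
  refine this.congr fun k => ?_
  rw [fourierHat_eq_fourier]
  congr 1
  have := Real.pi_ne_zero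
  push_cast
  field_simp
  ring

/-- Poisson summation with a frequency shift. -/
theorem tsum_exp_mul_schwartz (g : 𝓢(ℝ, ℂ)) (ε τ : ℝ) :
    ∑' m : ℤ, Complex.exp (Complex.I * m * τ) * g (ε - m) =
      ∑' k : ℤ, fourierHat g (τ + 2 * Real.pi * k) *
        Complex.exp (Complex.I * ε * (τ + 2 * Real.pi * k)) := by
  -- The modulation by `e^{-isτ}` shifts the dual lattice to `τ + 2πℤ`, so ordinary Poisson
  -- summation applies.
  set G : ℝ → ℂ := fun s => g s * Complex.exp (-(Complex.I * s * τ)) with hG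
  have hGF : ∀ k : ℤ, 𝓕 G k = fourierHat g (τ + 2 * Real.pi * k) := fun k => by
    rw [Real.fourier_real_eq_integral_exp_smul, fourierHat]
    congr 1
    funext s
    rw [smul_eq_mul, hG, mul_comm, mul_assoc, ← Complex.exp_add]
    congr 2
    push_cast
    ring
  have hGc : Continuous G := g.continuous.mul (by fun_prop)
  have hGO : G =O[cocompact ℝ] fun s : ℝ => |s| ^ (-2 : ℝ) := by
    have hO := g.isBigO_cocompact_rpow (-2)
    simp only [Real.norm_eq_abs] at hO
    refine IsBigO.trans (IsBigO.of_norm_le fun s => le_of_eq ?_) hO.norm_left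
    rw [hG, norm_mul, show -(Complex.I * s * τ) = ((-(s * τ) : ℝ) : ℂ) * Complex.I by push_cast; ring,
      Complex.norm_exp_ofReal_mul_I, mul_one]
  have h := Real.tsum_eq_tsum_fourier_of_rpow_decay_of_summable hGc one_lt_two hGO
    ((summable_fourierHat_shift g τ).congr fun k => (hGF k).symm) ε
  have h1 : ∑' m : ℤ, Complex.exp (Complex.I * m * τ) * g (ε - m) =
      Complex.exp (Complex.I * ε * τ) * ∑' n : ℤ, G (ε + n) := by
    rw [← (Equiv.neg ℤ).tsum_eq fun n : ℤ => G (ε + n), ← tsum_mul_left]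
    congr 1
    funext m
    simp only [hG, Equiv.neg_apply, Int.cast_neg, ← sub_eq_add_neg]
    rw [mul_left_comm, mul_comm, ← Complex.exp_add]
    congr 2
    push_cast
    ring
  rw [h1, h, ← tsum_mul_left]
  congr 1
  funext k
  rw [hGF, fourier_coe_apply, mul_left_comm, ← Complex.exp_add]
  congr 2
  push_cast
  ring

theorem exists_schwartz_fourierHat_eq {b : ℝ → ℂ} (hb : ContDiff ℝ (⊤ : ℕ∞) b)
    (hbs : HasCompactSupport b) : ∃ g : 𝓢(ℝ, ℂ), (∀ t, fourierHat g t = b t) ∧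
      ∀ s, g s = (2 * Real.pi : ℂ)⁻¹ * ∫ t : ℝ, b t * Complex.exp (Complex.I * s * t) := by
  have hpi : 0 < 2 * Real.pi := by positivity
  have hb' : ContDiff ℝ (⊤ : ℕ∞) fun t => b (t * (2 * Real.pi)) := hb.comp (by fun_prop)
  have hbs' : HasCompactSupport fun t => b (t * (2 * Real.pi)) :=
    hbs.comp_homeomorph (Homeomorph.mulRight₀ (2 * Real.pi) hpi.ne')
  set B : 𝓢(ℝ, ℂ) := hbs'.toSchwartzMap hb' with hB
  have hBt : ∀ t, B t = b (t * (2 * Real.pi)) := fun t => rfl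
  refine ⟨𝓕⁻ B, fun t => ?_, fun s => ?_⟩
  · rw [fourierHat_eq_fourier, FourierTransform.fourier_fourierInv_eq, hBt, div_mul_cancel₀ _ hpi.ne']
  · rw [SchwartzMap.fourierInv_coe, Real.fourierInv_eq_fourier_neg,
      Real.fourier_real_eq_integral_exp_smul]
    have := Measure.integral_comp_mul_right (fun t : ℝ => b t * Complex.exp (Complex.I * s * t)) (2 * Real.pi)
    rw [abs_of_pos (inv_pos.2 hpi)] at this
    rw [show (2 * Real.pi : ℂ)⁻¹ = (((2 * Real.pi)⁻¹ : ℝ) : ℂ) by push_cast; rfl]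
    rw [← Complex.real_smul, ← this]
    congr 1
    funext t
    rw [hBt, smul_eq_mul, mul_comm]
    congr 2
    push_cast
    ring

/-! ### Fresnel integrals and the Morse coordinate -/

theorem norm_cexp_ofReal_mul_I_sub_one_le (θ : ℝ) : ‖Complex.exp (θ * Complex.I) - 1‖ ≤ |θ| := by
  have := Real.norm_exp_I_mul_ofReal_sub_one_le (x := θ)
  rwa [mul_comm, Real.norm_eq_abs] at this

theorem integral_mul_gaussian (η : 𝓢(ℝ, ℂ)) {b : ℂ} (hb : 0 < b.re) :
    ∫ s : ℝ, 𝓕 η s * Complex.exp (-b * s ^ 2) =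
      (Real.pi / b) ^ (1 / 2 : ℂ) * ∫ t : ℝ, η t * Complex.exp (-Real.pi ^ 2 / b * t ^ 2) := by
  have hpi : (Real.pi : ℂ) ≠ 0 := by exact_mod_cast Real.pi_ne_zero
  have hb0 : b ≠ 0 := by rintro rfl; simp at hb
  have hG : Integrable fun s : ℝ => Complex.exp (-b * s ^ 2) := integrable_cexp_neg_mul_sq hb
  have h1 := VectorFourier.integral_fourierIntegral_smul_eq_flip (L := innerₗ ℝ) (μ := volume)
    (ν := volume) Real.continuous_fourierChar continuous_inner η.integrable hG
  have hF : ∀ t : ℝ, 𝓕 (fun s : ℝ => Complex.exp (-b * s ^ 2)) t =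
      (Real.pi / b) ^ (1 / 2 : ℂ) * Complex.exp (-Real.pi ^ 2 / b * t ^ 2) := fun t => by
    have h2 : 0 < (b / Real.pi).re := by
      rw [Complex.div_ofReal_re]; exact div_pos hb Real.pi_pos
    have h3 := congrFun (fourier_gaussian_pi h2) t
    rw [show (fun x : ℝ => Complex.exp (-Real.pi * (b / Real.pi) * (x : ℂ) ^ 2)) =
      fun s : ℝ => Complex.exp (-b * s ^ 2) by
        funext x; congr 2; field_simp] at h3
    rw [h3]
    congr 1
    · rw [← inv_div (b : ℂ), Complex.inv_cpow, one_div]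
      intro h
      have := (Complex.arg_eq_pi_iff.1 h).1
      linarith
    · congr 2
      field_simp
  rw [← integral_const_mul]
  calc _ = ∫ t : ℝ, η t • 𝓕 (fun s : ℝ => Complex.exp (-b * s ^ 2)) t := by
        refine Eq.trans ?_ (h1.trans ?_)
        · rfl
        · rw [flip_innerₗ]; rfl
    _ = _ := by
      congr 1
      funext t
      rw [hF, smul_eq_mul]
      ring

/-- The Fresnel integral of a Schwartz function, to leading order. -/
theorem fresnel (χ : 𝓢(ℝ, ℂ)) : ∃ C : ℝ, ∀ l : ℝ, 0 < l →
    ‖(∫ s : ℝ, χ s * Complex.exp (-(l * s ^ 2 / 2 : ℝ) * Complex.I)) -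
      (Real.sqrt (2 * Real.pi / l) : ℝ) * Complex.exp (-(Real.pi / 4 : ℝ) * Complex.I) * χ 0‖ ≤
      C * (Real.sqrt (2 * Real.pi / l) / l) := by
  set η : 𝓢(ℝ, ℂ) := 𝓕⁻ χ with hη
  have hχ : 𝓕 η = χ := FourierTransform.fourier_fourierInv_eq χ
  have hpi := Real.pi_pos
  have hpic : (Real.pi : ℂ) ≠ 0 := by exact_mod_cast Real.pi_ne_zero
  have hint : Integrable fun t : ℝ => ‖t‖ ^ 2 * ‖η t‖ := η.integrable_pow_mul volume 2
  refine ⟨2 * Real.pi ^ 2 * ∫ t : ℝ, ‖t‖ ^ 2 * ‖η t‖, fun l hl => ?_⟩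
  have hlc : (l : ℂ) ≠ 0 := by exact_mod_cast hl.ne'
  -- The imaginary Gaussian is not integrable; a real part ε is added, Parseval is applied, and ε
  -- tends to 0.
  set b : ℝ → ℂ := fun ε => ε + (l / 2 : ℝ) * Complex.I with hb
  have hbre : ∀ ε, (b ε).re = ε := fun ε => by simp [hb]
  have hbc : Continuous b := by fun_prop
  have hb0 : b 0 = (l / 2 : ℝ) * Complex.I := by simp [hb]
  have hbne : b 0 ≠ 0 := by
    rw [hb0]; exact mul_ne_zero (by exact_mod_cast (half_pos hl).ne') Complex.I_ne_zero
  have hroot : (Real.pi / b 0) ^ (1 / 2 : ℂ) = (Real.sqrt (2 * Real.pi / l) : ℝ) *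
      Complex.exp (-(Real.pi / 4 : ℝ) * Complex.I) := by
    -- `π/b(0)` is a positive number times `-i`, whose principal square root supplies the factor
    -- `e^{-iπ/4}`.
    have e1 : (Real.pi : ℂ) / b 0 = ((2 * Real.pi / l : ℝ) : ℂ) * (-Complex.I) := by
      rw [hb0]
      push_cast
      field_simp
      rw [Complex.I_sq]; ring
    have hr : 0 < 2 * Real.pi / l := by positivity
    rw [e1, Complex.cpow_def_of_ne_zero
      (mul_ne_zero (by exact_mod_cast hr.ne') (neg_ne_zero.2 Complex.I_ne_zero)),
      Complex.log_ofReal_mul hr (neg_ne_zero.2 Complex.I_ne_zero), Complex.log_neg_I,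
      Real.sqrt_eq_rpow, Real.rpow_def_of_pos hr, Complex.ofReal_exp, ← Complex.exp_add]
    congr 1
    push_cast
    ring
  have hlim : (∫ s : ℝ, χ s * Complex.exp (-b 0 * s ^ 2)) =
      (Real.pi / b 0) ^ (1 / 2 : ℂ) * ∫ t : ℝ, η t * Complex.exp (-Real.pi ^ 2 / b 0 * t ^ 2) := by
    have hL : Tendsto (fun ε => ∫ s : ℝ, χ s * Complex.exp (-b ε * s ^ 2)) (𝓝[>] 0)
        (𝓝 (∫ s : ℝ, χ s * Complex.exp (-b 0 * s ^ 2))) := by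
      refine tendsto_integral_filter_of_dominated_convergence (fun s => ‖χ s‖)
        (Eventually.of_forall fun ε => by
          exact (χ.continuous.mul (by fun_prop)).aestronglyMeasurable) ?_ χ.integrable.norm
        (Eventually.of_forall fun s => ?_)
      · filter_upwards [self_mem_nhdsWithin] with ε hε
        refine Eventually.of_forall fun s => ?_
        rw [norm_mul, Complex.norm_exp]
        refine mul_le_of_le_one_right (norm_nonneg _) (Real.exp_le_one_iff.2 ?_)
        rw [← Complex.ofReal_pow, Complex.re_mul_ofReal, Complex.neg_re, hbre]
        have : 0 < ε := hε
        nlinarith [mul_nonneg this.le (sq_nonneg s)]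
      · exact ((continuous_const.mul (by fun_prop :
          Continuous fun ε => Complex.exp (-b ε * s ^ 2))).tendsto 0).mono_left nhdsWithin_le_nhds
    have hR : Tendsto (fun ε => (Real.pi / b ε) ^ (1 / 2 : ℂ) *
        ∫ t : ℝ, η t * Complex.exp (-Real.pi ^ 2 / b ε * t ^ 2)) (𝓝[>] 0)
        (𝓝 ((Real.pi / b 0) ^ (1 / 2 : ℂ) *
          ∫ t : ℝ, η t * Complex.exp (-Real.pi ^ 2 / b 0 * t ^ 2))) := by
      refine Tendsto.mul ?_ (tendsto_integral_filter_of_dominated_convergence (fun s => ‖η s‖)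
        (Eventually.of_forall fun ε => by
          exact (η.continuous.mul (by fun_prop)).aestronglyMeasurable) ?_ η.integrable.norm
        (Eventually.of_forall fun s => ?_))
      · have hslit : (Real.pi : ℂ) / b 0 ∈ Complex.slitPlane := by
          right
          rw [hb0]
          simp [Complex.div_im, hl.ne', hpi.ne']
        have : ContinuousAt (fun ε => ((Real.pi : ℂ) / b ε) ^ (1 / 2 : ℂ)) 0 :=
          (continuousAt_const.div hbc.continuousAt hbne).cpow continuousAt_const hslit
        exact this.tendsto.mono_left nhdsWithin_le_nhds
      · filter_upwards [self_mem_nhdsWithin] with ε hε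
        refine Eventually.of_forall fun s => ?_
        rw [norm_mul, Complex.norm_exp]
        refine mul_le_of_le_one_right (norm_nonneg _) (Real.exp_le_one_iff.2 ?_)
        have : 0 < ε := hε
        rw [← Complex.ofReal_pow s, Complex.re_mul_ofReal, neg_div, Complex.neg_re, ← Complex.ofReal_pow,
          Complex.div_re, Complex.ofReal_re, Complex.ofReal_im, hbre]
        have := Complex.normSq_nonneg (b ε)
        rw [neg_mul, neg_nonpos]
        simp only [zero_mul, zero_div, add_zero]
        positivity
      · have h1 : ContinuousAt (fun ε => η s * Complex.exp (-Real.pi ^ 2 / b ε * s ^ 2)) 0 :=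
          continuousAt_const.mul (Complex.continuous_exp.continuousAt.comp
            ((continuousAt_const.div hbc.continuousAt hbne).mul continuousAt_const))
        exact h1.tendsto.mono_left nhdsWithin_le_nhds
    refine tendsto_nhds_unique (hL.congr' ?_) hR
    filter_upwards [self_mem_nhdsWithin] with ε hε
    rw [← hχ]
    exact integral_mul_gaussian η (by rw [hbre]; exact hε)
  have e1 : ∫ s : ℝ, χ s * Complex.exp (-(l * s ^ 2 / 2 : ℝ) * Complex.I) =
      ∫ s : ℝ, χ s * Complex.exp (-b 0 * s ^ 2) := by
    congr 1
    funext s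
    rw [hb0]
    congr 2
    push_cast
    ring
  have e2 : ∀ t : ℝ, -(Real.pi : ℂ) ^ 2 / b 0 * t ^ 2 = (2 * Real.pi ^ 2 * t ^ 2 / l : ℝ) * Complex.I := by
    intro t
    rw [hb0]
    push_cast
    field_simp
    rw [Complex.I_sq]; ring
  have e3 : χ 0 = ∫ t : ℝ, η t := by
    rw [← hχ, SchwartzMap.fourier_coe, Real.fourier_real_eq_integral_exp_smul]
    simp
  rw [e1, hlim, hroot, e3, ← mul_sub, ← integral_sub, norm_mul, norm_mul, Complex.norm_real,
    Real.norm_of_nonneg (Real.sqrt_nonneg _),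
    show -((Real.pi / 4 : ℝ) : ℂ) * Complex.I = ((-(Real.pi / 4) : ℝ) : ℂ) * Complex.I by push_cast; ring,
    Complex.norm_exp_ofReal_mul_I, mul_one]
  · calc Real.sqrt (2 * Real.pi / l) *
        ‖∫ t : ℝ, (η t * Complex.exp (-Real.pi ^ 2 / b 0 * t ^ 2) - η t)‖
        ≤ Real.sqrt (2 * Real.pi / l) * ∫ t : ℝ, 2 * Real.pi ^ 2 / l * (‖t‖ ^ 2 * ‖η t‖) := by
          gcongr
          refine norm_integral_le_of_norm_le (hint.const_mul _) (Eventually.of_forall fun t => ?_)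
          rw [e2, ← mul_sub_one, norm_mul]
          have := norm_cexp_ofReal_mul_I_sub_one_le (2 * Real.pi ^ 2 * t ^ 2 / l)
          rw [abs_of_nonneg (by positivity)] at this
          calc _ ≤ ‖η t‖ * (2 * Real.pi ^ 2 * t ^ 2 / l) := by gcongr
            _ = _ := by rw [Real.norm_eq_abs, sq_abs]; ring
      _ = _ := by rw [integral_const_mul]; ring
  · simp only [e2]
    refine η.integrable.mono (η.continuous.mul (by fun_prop)).aestronglyMeasurable
      (Eventually.of_forall fun t => ?_)
    rw [norm_mul, Complex.norm_exp_ofReal_mul_I, mul_one]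
  · exact η.integrable

/-- The Morse lemma on the line at a maximum: the coordinate `σ` with `φ = φ t₀ - σ²/2`. -/
theorem exists_morse_coordinate {φ : ℝ → ℝ} {t₀ w : ℝ} (hφ : AnalyticAt ℝ φ t₀)
    (h1 : deriv φ t₀ = 0) (h2 : deriv (deriv φ) t₀ = -w) (hw : 0 < w) :
    ∃ σ : ℝ → ℝ, AnalyticAt ℝ σ t₀ ∧ σ t₀ = 0 ∧ deriv σ t₀ = √w ∧
      ∀ᶠ t in 𝓝 t₀, φ t = φ t₀ - σ t ^ 2 / 2 := by
  have hψ : AnalyticAt ℝ (fun z => φ (t₀ + z)) 0 :=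
    AnalyticAt.fun_comp (g := φ) (by simpa using hφ) (by fun_prop)
  -- With `z = t - t₀`, Taylor's formula reads `φ = φ(t₀) - (z²/2)(w - 2zG(z))`. The bracket is
  -- positive near `t₀`, so `σ = z √(w - 2zG(z))`.
  obtain ⟨G, hG, hGt⟩ := hψ.exists_eventuallyEq_sum_add_pow_mul 3
  have hsub : Tendsto (fun t => t - t₀) (𝓝 t₀) (𝓝 0) := by
    have : ContinuousAt (fun t => t - t₀) t₀ := by fun_prop
    simpa [ContinuousAt] using this
  have hr : AnalyticAt ℝ (fun t => w - 2 * ((t - t₀) * G (t - t₀))) t₀ := by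
    have : AnalyticAt ℝ (fun t => G (t - t₀)) t₀ :=
      AnalyticAt.fun_comp (g := G) (by simpa using hG) (by fun_prop)
    have h' : AnalyticAt ℝ (fun t => t - t₀) t₀ := by fun_prop
    exact analyticAt_const.fun_sub (analyticAt_const.fun_mul (h'.fun_mul this))
  have hr0 : w - 2 * ((t₀ - t₀) * G (t₀ - t₀)) = w := by simp
  have hs : AnalyticAt ℝ (fun t => √(w - 2 * ((t - t₀) * G (t - t₀)))) t₀ := by
    rw [← analyticWithinAt_univ, ← contDiffWithinAt_omega_iff_analyticWithinAt, contDiffWithinAt_univ] at hr ⊢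
    exact hr.sqrt (by rw [hr0]; exact hw.ne')
  refine ⟨fun t => (t - t₀) * √(w - 2 * ((t - t₀) * G (t - t₀))),
    AnalyticAt.fun_mul (by fun_prop) hs, by simp, ?_, ?_⟩
  · have := ((hasDerivAt_id t₀).sub_const t₀).mul hs.differentiableAt.hasDerivAt
    refine this.deriv.trans ?_
    simp
  · have hrpos : ∀ᶠ t in 𝓝 t₀, 0 < w - 2 * ((t - t₀) * G (t - t₀)) :=
      hr.continuousAt.eventually (lt_mem_nhds (by simpa using hw))
    filter_upwards [hsub.eventually hGt, hrpos] with t ht hp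
    rw [mul_pow, Real.sq_sqrt hp.le]
    simp only [Finset.sum_range_succ, Finset.sum_range_zero, iteratedDeriv_comp_const_add,
      iteratedDeriv_zero, iteratedDeriv_one, add_zero, add_sub_cancel] at ht
    rw [ht, show iteratedDeriv 2 φ t₀ = -w by rw [iteratedDeriv_succ, iteratedDeriv_one, h2], h1]
    simp [Nat.factorial]
    ring

/-- Here the amplitude is chosen rather than given: with `b = c(σ) σ'` for a bump `c`, the
substitution `u = σ(t)` makes the oscillatory integral exactly a Fresnel integral, with no remainder
from the amplitude. -/
theorem exists_morse_amplitude {φ : ℝ → ℝ} {t₀ w : ℝ} (hφ : AnalyticAt ℝ φ t₀)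
    (h1 : deriv φ t₀ = 0) (h2 : deriv (deriv φ) t₀ = -w) (hw : 0 < w) {s : Set ℝ} (hs : s ∈ 𝓝 t₀) :
    ∃ b : ℝ → ℂ, ContDiff ℝ (⊤ : ℕ∞) b ∧ HasCompactSupport b ∧ tsupport b ⊆ s ∧ b t₀ = (√w : ℝ) ∧
      ∃ χ : 𝓢(ℝ, ℂ), χ 0 = 1 ∧ ∀ l : ℝ, ∫ t, b t * Complex.exp ((l * φ t : ℝ) * Complex.I) =
        Complex.exp ((l * φ t₀ : ℝ) * Complex.I) *
          ∫ u : ℝ, χ u * Complex.exp (-(l * u ^ 2 / 2 : ℝ) * Complex.I) := by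
  obtain ⟨σ, hσ, hσ0, hσ1, hσφ⟩ := exists_morse_coordinate hφ h1 h2 hw
  have hder : ∀ᶠ t in 𝓝 t₀, 0 < deriv σ t :=
    hσ.deriv.continuousAt.eventually (by rw [hσ1]; exact lt_mem_nhds (Real.sqrt_pos.2 hw))
  obtain ⟨ρ, hρ, hP⟩ := Metric.nhds_basis_closedBall.eventually_iff.1
    (hσφ.and (hder.and (hσ.eventually_analyticAt.and (eventually_mem_set.2 hs))))
  simp only [Real.closedBall_eq_Icc] at hP
  set α := t₀ - ρ
  set β := t₀ + ρ
  have hαt : α < t₀ := sub_lt_self _ hρ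
  have htβ : t₀ < β := lt_add_of_pos_right _ hρ
  have hαβ : α < β := hαt.trans htβ
  have hcont : ContinuousOn σ (Set.Icc α β) := fun t ht =>
    (hP ht).2.2.1.continuousAt.continuousWithinAt
  have hmono : StrictMonoOn σ (Set.Icc α β) :=
    strictMonoOn_of_deriv_pos (convex_Icc _ _) hcont fun t ht => (hP (interior_subset ht)).2.1
  have hσα : σ α < 0 := hσ0 ▸ hmono ⟨le_rfl, hαβ.le⟩ ⟨hαt.le, htβ.le⟩ hαt
  have hσβ : 0 < σ β := hσ0 ▸ hmono ⟨hαt.le, htβ.le⟩ ⟨hαβ.le, le_rfl⟩ htβ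
  -- The image of the interval contains `[-e, e]`, so a bump of radius `e/2` vanishes near both
  -- endpoint values.
  set e := min (-σ α) (σ β) with he
  have he0 : 0 < e := lt_min (neg_pos.2 hσα) hσβ
  have heα : e ≤ -σ α := min_le_left _ _
  have heβ : e ≤ σ β := min_le_right _ _
  let c : ContDiffBump (0 : ℝ) := ⟨e / 3, e / 2, by positivity, by linarith⟩
  have hc0 : ∀ u, e / 2 ≤ |u| → c u = 0 := fun u hu => c.zero_of_le_dist (by simpa using hu)
  have hcs : ∀ u, c u ≠ 0 → |u| < e / 2 := fun u hu => lt_of_not_ge fun h => hu (hc0 u h)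
  have hCd : ContDiff ℝ (⊤ : ℕ∞) fun u => (c u : ℂ) := Complex.ofRealCLM.contDiff.comp c.contDiff
  have hCs : HasCompactSupport fun u => (c u : ℂ) := c.hasCompactSupport.comp_left Complex.ofReal_zero
  set B : ℝ → ℂ := fun t => (c (σ t) : ℂ) * (deriv σ t : ℝ) with hB
  -- The Morse coordinate is controlled only on the interval. Extension by zero stays smooth because
  -- `c(σ)` already vanishes near the endpoints.
  set b : ℝ → ℂ := (Set.Ioo α β).indicator B with hb
  have hzero : ∀ t, e / 2 < |σ t| → ContinuousAt σ t → b =ᶠ[𝓝 t] 0 := fun t ht htc => by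
    filter_upwards [htc.abs.eventually (lt_mem_nhds ht)] with u hu
    simp [hb, Set.indicator, hB, hc0 _ hu.le]
  have hαmem : α ∈ Set.Icc α β := ⟨le_rfl, hαβ.le⟩
  have hβmem : β ∈ Set.Icc α β := ⟨hαβ.le, le_rfl⟩
  have hσα' : e / 2 < |σ α| := by rw [abs_of_neg hσα]; linarith
  have hσβ' : e / 2 < |σ β| := by rw [abs_of_pos hσβ]; linarith
  have hbB : ∀ t ∈ Set.Icc α β, b t = B t := fun t ht => by
    by_cases h : t ∈ Set.Ioo α β
    · exact Set.indicator_of_mem h _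
    · have : t = α ∨ t = β := by
        by_contra! hne
        exact h ⟨lt_of_le_of_ne ht.1 hne.1.symm, lt_of_le_of_ne ht.2 hne.2⟩
      rw [hb, Set.indicator_of_notMem h, hB]
      rcases this with rfl | rfl
      · simp [hc0 _ hσα'.le]
      · simp [hc0 _ hσβ'.le]
  have hsub : Function.support b ⊆ Set.Ioo α β := Set.support_indicator_subset
  have hsub' : Function.support b ⊆ Set.Icc α β := hsub.trans Set.Ioo_subset_Icc_self
  refine ⟨b, contDiff_iff_contDiffAt.2 fun t => ?_,
    HasCompactSupport.of_support_subset_isCompact isCompact_Icc hsub',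
    (closure_minimal hsub' isClosed_Icc).trans fun t ht => (hP ht).2.2.2, ?_,
    hCs.toSchwartzMap hCd, ?_, fun l => ?_⟩
  · by_cases hIoo : t ∈ Set.Ioo α β
    · have han := (hP (Set.Ioo_subset_Icc_self hIoo)).2.2.1
      have hBd : ContDiffAt ℝ (⊤ : ℕ∞) B t :=
        (hCd.contDiffAt.comp t han.contDiffAt).mul
          (Complex.ofRealCLM.contDiff.contDiffAt.comp t han.deriv.contDiffAt)
      refine hBd.congr_of_eventuallyEq ?_
      filter_upwards [isOpen_Ioo.mem_nhds hIoo] with u hu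
      exact Set.indicator_of_mem hu _
    · have : b =ᶠ[𝓝 t] 0 := by
        rcases eq_or_ne t α with rfl | hne
        · exact hzero _ hσα' (hP hαmem).2.2.1.continuousAt
        rcases eq_or_ne t β with rfl | hne'
        · exact hzero _ hσβ' (hP hβmem).2.2.1.continuousAt
        have hIcc : t ∉ Set.Icc α β := fun h =>
          hIoo ⟨lt_of_le_of_ne h.1 hne.symm, lt_of_le_of_ne h.2 hne'⟩
        filter_upwards [isClosed_Icc.isOpen_compl.mem_nhds hIcc] with u hu
        exact Function.notMem_support.1 fun h => hu (hsub' h)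
      exact contDiffAt_const.congr_of_eventuallyEq this
  · rw [hbB t₀ ⟨hαt.le, htβ.le⟩, hB]
    simp only [hσ0, hσ1]
    rw [c.one_of_mem_closedBall (by simp [c.rIn_pos.le])]
    simp
  · change ((c 0 : ℝ) : ℂ) = 1
    rw [c.one_of_mem_closedBall (by simp [c.rIn_pos.le])]
    simp
  · rw [← integral_const_mul]
    have hsupp : Function.support (fun t => b t * Complex.exp ((l * φ t : ℝ) * Complex.I)) ⊆
        Set.Ioc α β := fun t ht => Set.Ioo_subset_Ioc_self (hsub (left_ne_zero_of_mul ht))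
    set g : ℝ → ℂ := fun u => Complex.exp ((l * φ t₀ : ℝ) * Complex.I) *
      ((c u : ℂ) * Complex.exp (-(l * u ^ 2 / 2 : ℝ) * Complex.I)) with hg
    have hgc : Continuous g := by
      have := hCd.continuous
      fun_prop
    have hgsupp : Function.support g ⊆ Set.Ioc (σ α) (σ β) := fun u hu => by
      have h := hcs u fun h => hu (by simp [hg, h])
      rw [abs_lt] at h
      exact ⟨by linarith, by linarith⟩
    calc ∫ t, b t * Complex.exp ((l * φ t : ℝ) * Complex.I)
        = ∫ t in α..β, b t * Complex.exp ((l * φ t : ℝ) * Complex.I) :=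
          (intervalIntegral.integral_eq_integral_of_support_subset hsupp).symm
      _ = ∫ t in α..β, deriv σ t • (g ∘ σ) t := by
        refine intervalIntegral.integral_congr fun t ht => ?_
        rw [Set.uIcc_of_le hαβ.le] at ht
        simp only [Function.comp_apply, hg]
        have hexp : Complex.exp ((l * φ t : ℝ) * Complex.I) = Complex.exp ((l * φ t₀ : ℝ) * Complex.I) *
            Complex.exp (-(l * σ t ^ 2 / 2 : ℝ) * Complex.I) := by
          rw [(hP ht).1, ← Complex.exp_add]
          congr 1
          push_cast
          ring
        rw [hbB t ht, hexp, Complex.real_smul]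
        simp only [hB]
        ring
      _ = ∫ u in σ α..σ β, g u := by
        refine intervalIntegral.integral_deriv_smul_comp (fun t ht => ?_) (fun t ht => ?_) hgc
        · rw [Set.uIcc_of_le hαβ.le] at ht
          exact (hP ht).2.2.1.differentiableAt.hasDerivAt
        · rw [Set.uIcc_of_le hαβ.le] at ht
          exact (hP ht).2.2.1.deriv.continuousAt.continuousWithinAt
      _ = ∫ u, g u := intervalIntegral.integral_eq_integral_of_support_subset hgsupp

/-! ### Abel summation on the boundary of the disc -/

theorem hasSum_nat_iff_int {F : ℤ → ℂ} (hF : ∀ n < 0, F n = 0) (c : ℤ) (s : ℂ) :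
    HasSum (fun n : ℕ => F n) s ↔ HasSum (fun m : ℤ => F (c + m)) s := by
  have h1 : HasSum (F ∘ fun n : ℕ => (n : ℤ)) s ↔ HasSum F s :=
    Nat.cast_injective.hasSum_iff fun n hn => hF n (by
      by_contra! h
      exact hn ⟨n.toNat, Int.toNat_of_nonneg h⟩)
  exact h1.trans ((Equiv.addLeft c).hasSum_iff (f := F)).symm

theorem RapidDecay.hasSum_nat {ι : Type*} {d : ℕ} {E H : ℝ} {ħ : ι → ℝ} {a : ι → ℤ → ℂ}
    (ha : RapidDecay a) (hH : 0 ≤ H) (hħ : ∀ i, 0 < ħ i) (i : ι) :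
    HasSum (fun n : ℕ => a i (n - center d E (ħ i)) * laguerreFun d (4 * H / ħ i) n)
      (pairing d E H ħ a i) := by
  have h := (hasSum_nat_iff_int (F := fun N => a i (N - center d E (ħ i)) *
    laguerreInt d (4 * H / ħ i) N) (fun N hN => by simp [laguerreInt_of_neg _ _ hN])
    (center d E (ħ i)) (pairing d E H ħ a i)).2 (by
      simpa only [add_sub_cancel_left, pairing] using (ha.summable_pairing hH hħ i).hasSum)
  simpa only [laguerreInt_natCast] using h

/-- The left side is the imaginary part of `e^{it} + r`, whatever `r` is. This keeps the generating
function bounded uniformly as `r → 1` on compact subsets of `(0, π)`. -/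
theorem abs_sin_le_norm_one_add (r t : ℝ) :
    |Real.sin t| ≤ ‖1 + r * Complex.exp (-(Complex.I * t))‖ := by
  have h : 1 + r * Complex.exp (-(Complex.I * t)) =
      Complex.exp (((-t : ℝ) : ℂ) * Complex.I) * (Complex.exp (t * Complex.I) + r) := by
    rw [mul_add, ← Complex.exp_add]
    push_cast
    rw [show -(t : ℂ) * Complex.I + t * Complex.I = 0 by ring, Complex.exp_zero,
      show -(Complex.I * (t : ℂ)) = -t * Complex.I by ring]
    ring
  rw [h, norm_mul, Complex.norm_exp_ofReal_mul_I, one_mul]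
  refine le_trans (le_of_eq ?_) (Complex.abs_im_le_norm _)
  rw [Complex.add_im, Complex.exp_ofReal_mul_I_im, Complex.ofReal_im, add_zero]

theorem norm_exp_neg_I_mul (t : ℝ) : ‖Complex.exp (-(Complex.I * t))‖ = 1 := by
  rw [show -(Complex.I * (t : ℂ)) = ((-t : ℝ) : ℂ) * Complex.I by push_cast; ring,
    Complex.norm_exp_ofReal_mul_I]

section

variable {d : ℕ} {y : ℝ} {b : ℝ → ℂ}

theorem hasSum_integral_laguerre (hb : Continuous b) (hbs : HasCompactSupport b) (ν : ℝ) {r : ℝ}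
    (hr0 : 0 ≤ r) (hr : r < 1) :
    HasSum (fun n : ℕ => (∫ t : ℝ, b t * Complex.exp (Complex.I * (ν - n) * t)) *
        laguerreFun d y n * r ^ n)
      (∫ t : ℝ, b t * Complex.exp (Complex.I * ν * t) *
        laguerreGen d y (r * Complex.exp (-(Complex.I * t)))) := by
  have hz : ∀ t : ℝ, ‖(r : ℂ) * Complex.exp (-(Complex.I * t))‖ < 1 := fun t => by
    rw [norm_mul, norm_exp_neg_I_mul, mul_one, Complex.norm_real, Real.norm_of_nonneg hr0]
    exact hr
  have hν : ∀ t : ℝ, ‖Complex.exp (Complex.I * ν * t)‖ = 1 := fun t => by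
    rw [show Complex.I * ν * (t : ℂ) = ((ν * t : ℝ) : ℂ) * Complex.I by push_cast; ring,
      Complex.norm_exp_ofReal_mul_I]
  set F : ℕ → ℝ → ℂ := fun n t => b t * Complex.exp (Complex.I * ν * t) *
    (laguerreFun d y n * (r * Complex.exp (-(Complex.I * t))) ^ n) with hF
  have hFi : ∀ n, Integrable (F n) := fun n => by
    refine Continuous.integrable_of_hasCompactSupport (by fun_prop) ?_
    exact (hbs.mul_right).mul_right
  have hFn : ∀ n, ∫ t, ‖F n t‖ = (∫ t, ‖b t‖) * ‖(laguerreFun d y n : ℂ) * (r : ℂ) ^ n‖ := fun n => by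
    rw [← integral_mul_const]
    congr 1
    funext t
    rw [hF]
    simp only [norm_mul, norm_pow, hν, norm_exp_neg_I_mul, mul_one]
  have hs : Summable fun n => ∫ t, ‖F n t‖ := by
    simp only [hFn]
    refine Summable.mul_left _ (hasSum_laguerreFun (d := d) (y := y) (z := (r : ℂ)) ?_).summable.norm
    rw [Complex.norm_real, Real.norm_of_nonneg hr0]
    exact hr
  have h := hasSum_integral_of_summable_integral_norm hFi hs
  convert! h using 1
  · funext n
    rw [mul_assoc, ← integral_mul_const]
    congr 1
    funext t
    simp only [hF]
    rw [mul_pow, ← Complex.exp_nat_mul,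
      show Complex.I * (ν - n) * (t : ℂ) = Complex.I * ν * t + n * (-(Complex.I * t)) by ring,
      Complex.exp_add]
    ring
  · congr 1
    funext t
    simp only [hF]
    rw [tsum_mul_left, (hasSum_laguerreFun d y (hz t)).tsum_eq]

/-- Abel summation of the generating function at the boundary of the unit disc. -/
theorem tsum_integral_laguerre (hy : 0 ≤ y) (hb : Continuous b) (hbs : HasCompactSupport b)
    (hbπ : tsupport b ⊆ Set.Ioo 0 Real.pi) (ν : ℝ)
    (hsum : Summable fun n : ℕ => (∫ t : ℝ, b t * Complex.exp (Complex.I * (ν - n) * t)) *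
      laguerreFun d y n) :
    ∑' n : ℕ, (∫ t : ℝ, b t * Complex.exp (Complex.I * (ν - n) * t)) * laguerreFun d y n =
      ∫ t : ℝ, b t * Complex.exp (Complex.I * ν * t) *
        laguerreGen d y (Complex.exp (-(Complex.I * t))) := by
  have hν : ∀ t : ℝ, ‖Complex.exp (Complex.I * ν * t)‖ = 1 := fun t => by
    rw [show Complex.I * ν * (t : ℂ) = ((ν * t : ℝ) : ℂ) * Complex.I by push_cast; ring,
      Complex.norm_exp_ofReal_mul_I]
  -- The support is compact inside `(0, π)`, so `|sin|` has a positive minimum there; it bounds the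
  -- distance to the pole `z = -1`.
  obtain ⟨s₀, hs₀, hsin⟩ : ∃ s₀ : ℝ, 0 < s₀ ∧ ∀ t, b t ≠ 0 → s₀ ≤ |Real.sin t| := by
    rcases (tsupport b).eq_empty_or_nonempty with he | hne
    · exact ⟨1, one_pos, fun t ht => absurd (subset_tsupport b ht) (by simp [he])⟩
    · obtain ⟨t₁, ht₁, hmin⟩ := IsCompact.exists_isMinOn hbs hne
        (Real.continuous_sin.abs.continuousOn)
      exact ⟨|Real.sin t₁|, abs_pos.2 (Real.sin_pos_of_mem_Ioo (hbπ ht₁)).ne',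
        fun t ht => hmin (subset_tsupport b ht)⟩
  have hIoo : ∀ᶠ r : ℝ in 𝓝[<] 1, 0 ≤ r ∧ r < 1 := by
    filter_upwards [Ioo_mem_nhdsLT (zero_lt_one (α := ℝ))] with r hr
    exact ⟨hr.1.le, hr.2⟩
  have hL : Tendsto (fun r : ℝ => ∑' n : ℕ, (∫ t : ℝ, b t * Complex.exp (Complex.I * (ν - n) * t)) *
      laguerreFun d y n * r ^ n) (𝓝[<] 1)
      (𝓝 (∑' n : ℕ, (∫ t : ℝ, b t * Complex.exp (Complex.I * (ν - n) * t)) * laguerreFun d y n)) := by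
    refine tendsto_tsum_of_dominated_convergence hsum.norm (fun n => ?_) ?_
    · have : Continuous fun r : ℝ => (∫ t : ℝ, b t * Complex.exp (Complex.I * (ν - n) * t)) *
        laguerreFun d y n * (r : ℂ) ^ n := by fun_prop
      have h := (this.tendsto 1).mono_left (nhdsWithin_le_nhds (s := Set.Iio 1))
      simpa using h
    · filter_upwards [hIoo] with r hr n
      rw [norm_mul _ ((r : ℂ) ^ n), norm_pow, Complex.norm_real, Real.norm_of_nonneg hr.1]
      exact mul_le_of_le_one_right (norm_nonneg _) (pow_le_one₀ hr.1 hr.2.le)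
  have hR : Tendsto (fun r : ℝ => ∫ t : ℝ, b t * Complex.exp (Complex.I * ν * t) *
        laguerreGen d y (r * Complex.exp (-(Complex.I * t)))) (𝓝[<] 1)
      (𝓝 (∫ t : ℝ, b t * Complex.exp (Complex.I * ν * t) *
        laguerreGen d y (Complex.exp (-(Complex.I * t))))) := by
    refine tendsto_integral_filter_of_dominated_convergence (fun t => ‖b t‖ * (s₀ ^ d)⁻¹) ?_ ?_
      ((hb.integrable_of_hasCompactSupport hbs).norm.mul_const _) (Eventually.of_forall fun t => ?_)
    · refine Eventually.of_forall fun r => Measurable.aestronglyMeasurable ?_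
      have := hb.measurable
      unfold laguerreGen
      fun_prop
    · filter_upwards [hIoo] with r hr
      refine Eventually.of_forall fun t => ?_
      rw [norm_mul, norm_mul, hν, mul_one]
      by_cases h0 : b t = 0
      · simp [h0]
      gcongr
      refine (norm_laguerreGen_le d hy ?_).trans ?_
      · rw [norm_mul, norm_exp_neg_I_mul, mul_one, Complex.norm_real, Real.norm_of_nonneg hr.1]
        exact hr.2.le
      · gcongr
        exact (hsin t h0).trans (abs_sin_le_norm_one_add r t)
    · by_cases h0 : b t = 0
      · simp [h0]
      have hne : 1 + ((1 : ℝ) : ℂ) * Complex.exp (-(Complex.I * t)) ≠ 0 := by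
        rw [← norm_pos_iff]
        exact hs₀.trans_le ((hsin t h0).trans (abs_sin_le_norm_one_add 1 t))
      have hc : ContinuousAt (fun r : ℝ => b t * Complex.exp (Complex.I * ν * t) *
          laguerreGen d y (r * Complex.exp (-(Complex.I * t)))) 1 := by
        unfold laguerreGen
        have hn : ContinuousAt (fun r : ℝ => 1 + (r : ℂ) * Complex.exp (-(Complex.I * t))) 1 := by
          fun_prop
        have hm : ContinuousAt (fun r : ℝ => 1 - (r : ℂ) * Complex.exp (-(Complex.I * t))) 1 := by
          fun_prop
        exact continuousAt_const.mul ((Complex.continuous_exp.continuousAt.comp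
          (continuousAt_const.mul (hm.div hn hne))).mul ((hn.pow d).inv₀ (pow_ne_zero d hne)))
      have h := hc.tendsto.mono_left (nhdsWithin_le_nhds (s := Set.Iio 1))
      simpa using h
  refine tendsto_nhds_unique (hL.congr' ?_) hR
  filter_upwards [hIoo] with r hr
  exact (hasSum_integral_laguerre hb hbs ν hr.1 hr.2).tsum_eq

end

/-- For `z = e^{-it}` one has `(1-z)/(1+z) = i tan(t/2)` and `1 + z = 2 cos(t/2) e^{-it/2}`. The
shift `-d/2` of the spectral parameter cancels the phase of `(1+z)^{-d}`. -/
theorem laguerreGen_boundary (d : ℕ) (E H : ℝ) {ħ t : ℝ} (hħ : ħ ≠ 0) (ht : Real.cos (t / 2) ≠ 0) :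
    Complex.exp (Complex.I * (E / ħ - d / 2 : ℝ) * t) *
      laguerreGen d (4 * H / ħ) (Complex.exp (-(Complex.I * t))) =
    Complex.exp ((ħ⁻¹ * (E * t - 2 * H * Real.tan (t / 2)) : ℝ) * Complex.I) *
      (((2 * Real.cos (t / 2)) ^ d : ℝ) : ℂ)⁻¹ := by
  set w : ℂ := Complex.exp (-(Complex.I * (t / 2 : ℝ))) with hw
  have hw0 : w ≠ 0 := Complex.exp_ne_zero _
  have hc0 : ((Real.cos (t / 2) : ℝ) : ℂ) ≠ 0 := by exact_mod_cast ht
  have hwinv : w⁻¹ = Complex.exp (Complex.I * (t / 2 : ℝ)) := by rw [hw, ← Complex.exp_neg, neg_neg]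
  have hcos : ((Real.cos (t / 2) : ℝ) : ℂ) = (w⁻¹ + w) / 2 := by
    rw [hwinv, hw, Complex.ofReal_cos, Complex.cos]
    ring_nf
  have hsin : ((Real.sin (t / 2) : ℝ) : ℂ) * Complex.I = (w⁻¹ - w) / 2 := by
    rw [hwinv, hw, Complex.ofReal_sin, Complex.sin]
    rw [neg_mul, mul_comm Complex.I]
    linear_combination (Complex.exp (-((t / 2 : ℝ) * Complex.I)) -
      Complex.exp ((t / 2 : ℝ) * Complex.I)) / 2 * Complex.I_sq
  have he : Complex.exp (-(Complex.I * t)) = w ^ 2 := by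
    rw [hw, ← Complex.exp_nat_mul]
    congr 1
    push_cast
    ring
  have hp : 1 + w ^ 2 = w * (2 * Real.cos (t / 2) : ℝ) := by
    push_cast [-Complex.ofReal_cos]
    rw [hcos]
    field_simp
  have hm : 1 - w ^ 2 = w * (2 * (Real.sin (t / 2) * Complex.I)) := by
    rw [hsin]
    field_simp
  have hq : (1 - w ^ 2) / (1 + w ^ 2) = (Real.tan (t / 2) : ℝ) * Complex.I := by
    rw [hp, hm, Real.tan_eq_sin_div_cos]
    push_cast [-Complex.ofReal_cos, -Complex.ofReal_sin]
    field_simp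
  rw [laguerreGen, he, hq, hp, mul_pow, mul_inv, ← mul_assoc, ← Complex.exp_add, ← mul_assoc, hw,
    ← Complex.exp_nat_mul, ← Complex.exp_neg, ← Complex.exp_add]
  have hħ' : (ħ : ℂ) ≠ 0 := by exact_mod_cast hħ
  congr 1
  · congr 1
    push_cast
    field_simp
    ring
  · push_cast
    rfl

/-! ### The phase function and the test family -/

/-- The phase function of the Wigner-Weyl sum. -/
def phase (E H t : ℝ) : ℝ := E * t - 2 * H * Real.tan (t / 2)

theorem hasDerivAt_phase (E H : ℝ) {t : ℝ} (ht : Real.cos (t / 2) ≠ 0) :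
    HasDerivAt (phase E H) (E - H * (Real.cos (t / 2) ^ 2)⁻¹) t := by
  have h := ((hasDerivAt_id t).const_mul E).fun_sub
    (((Real.hasDerivAt_tan ht).comp t ((hasDerivAt_id t).div_const 2)).const_mul (2 * H))
  refine h.congr_deriv ?_
  ring

theorem hasDerivAt_deriv_phase (E H : ℝ) {t : ℝ} (ht : Real.cos (t / 2) ≠ 0) :
    HasDerivAt (deriv (phase E H)) (-(H * (Real.cos (t / 2) ^ 2)⁻¹ * Real.tan (t / 2))) t := by
  have hc : ContinuousAt (fun t : ℝ => Real.cos (t / 2)) t := by fun_prop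
  have he : deriv (phase E H) =ᶠ[𝓝 t] fun t => E - H * (Real.cos (t / 2) ^ 2)⁻¹ := by
    filter_upwards [hc.eventually_ne ht] with u hu
    exact (hasDerivAt_phase E H hu).deriv
  refine HasDerivAt.congr_of_eventuallyEq ?_ he
  have h := (((((Real.hasDerivAt_cos (t / 2)).comp t ((hasDerivAt_id t).div_const 2)).fun_pow 2).fun_inv
    (pow_ne_zero (M₀ := ℝ) 2 (show (Real.cos ∘ fun t => id t / 2) t ≠ 0 from ht))).const_mul H).const_sub E
  refine h.congr_deriv ?_
  rw [Real.tan_eq_sin_div_cos]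
  simp only [Function.comp, id]
  push_cast
  field_simp

theorem analyticAt_phase (E H : ℝ) {t : ℝ} (ht : Real.cos (t / 2) ≠ 0) :
    AnalyticAt ℝ (phase E H) t := by
  have h : AnalyticAt ℝ (fun t => E * t - 2 * H * (Real.sin (t / 2) / Real.cos (t / 2))) t := by
    have h2 : AnalyticAt ℝ (fun t : ℝ => t / 2) t := by fun_prop
    exact (analyticAt_const.fun_mul analyticAt_id).fun_sub (analyticAt_const.fun_mul
      ((Real.analyticAt_sin.comp h2).fun_div (Real.analyticAt_cos.comp h2) ht))
  refine h.congr (Eventually.of_forall fun u => ?_)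
  simp only [phase, Real.tan_eq_sin_div_cos]

section

variable {E H θ : ℝ}

/-- A family of sequences concentrated at the single frequency `2θ`, where `cos² θ = H/E`, together
with the leading asymptotics of its pairing. -/
theorem exists_test_family (d : ℕ) (hH : 0 < H) (hE : 0 < E) (hθ0 : 0 < θ) (hθ : θ < Real.pi / 2)
    (hcos : E * Real.cos θ ^ 2 = H) :
    ∃ b : Planck → ℤ → ℂ, RapidDecay b ∧
      (∀ i, moment (Complex.exp (Complex.I * (2 * θ : ℝ))) b i =
        ((√(E * Real.tan θ) * (2 * Real.cos θ) ^ d : ℝ) : ℂ) *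
          Complex.exp (Complex.I * offset d E i * (2 * θ : ℝ))) ∧
      (∀ i, moment (Complex.exp (Complex.I * (2 * θ : ℝ)))⁻¹ b i = 0) ∧
      ∃ C : ℝ, ∀ i : Planck, ‖pairing d E H (↑) b i - ((2 * Real.pi)⁻¹ * √(2 * Real.pi * i) : ℝ) *
        Complex.exp ((phase E H (2 * θ) / i - Real.pi / 4 : ℝ) * Complex.I)‖ ≤ C * (i * √i) := by
  have hpi := Real.pi_pos
  have hcpos : 0 < Real.cos θ := Real.cos_pos_of_mem_Ioo ⟨by linarith, hθ⟩
  have htan : 0 < Real.tan θ := Real.tan_pos_of_pos_of_lt_pi_div_two hθ0 hθ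
  have h2θ : 2 * θ / 2 = θ := by ring
  have hc2 : Real.cos (2 * θ / 2) ≠ 0 := by rw [h2θ]; exact hcpos.ne'
  have hEH : H * (Real.cos (2 * θ / 2) ^ 2)⁻¹ = E := by
    rw [h2θ, ← hcos]; field_simp
  obtain ⟨b₀, hb₀, hb₀s, hb₀π, hb₀v, χ, hχ0, hχ⟩ := exists_morse_amplitude (s := Set.Ioo 0 Real.pi)
    (analyticAt_phase E H hc2) (by rw [(hasDerivAt_phase E H hc2).deriv, hEH, sub_self])
    (by rw [(hasDerivAt_deriv_phase E H hc2).deriv, hEH, h2θ]) (mul_pos hE htan)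
    (Ioo_mem_nhds (by linarith) (by linarith))
  -- The extra factor cancels the denominator `(2 cos(t/2))^d` of the generating function, leaving
  -- exactly the Morse amplitude.
  set b : ℝ → ℂ := fun t => b₀ t * (((2 * Real.cos (t / 2)) ^ d : ℝ) : ℂ) with hb_def
  have hbd : ContDiff ℝ (⊤ : ℕ∞) b := by
    refine hb₀.mul (Complex.ofRealCLM.contDiff.comp ?_)
    exact ((contDiff_const.mul (Real.contDiff_cos.comp (contDiff_id.div_const 2))).pow d)
  have hbs : HasCompactSupport b := hb₀s.mul_right
  have hbsub : tsupport b ⊆ tsupport b₀ := closure_mono (Function.support_mul_subset_left _ _)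
  have hbπ : tsupport b ⊆ Set.Ioo 0 Real.pi := hbsub.trans hb₀π
  have hb0 : ∀ t, t ∉ Set.Ioo 0 Real.pi → b t = 0 := fun t ht =>
    image_eq_zero_of_notMem_tsupport fun h => ht (hbπ h)
  obtain ⟨g, hgF, hg⟩ := exists_schwartz_fourierHat_eq hbd hbs
  have hRD : RapidDecay fun (i : Planck) (m : ℤ) => g (offset d E i - m) :=
    rapidDecay_schwartz g fun i => abs_offset_le d E i
  have hmom : ∀ (τ : ℝ) (i : Planck), moment (Complex.exp (Complex.I * τ))
      (fun i m => g (offset d E i - m)) i = ∑' k : ℤ, b (τ + 2 * Real.pi * k) *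
        Complex.exp (Complex.I * offset d E i * (τ + 2 * Real.pi * k)) := fun τ i => by
    have := tsum_exp_mul_schwartz g (offset d E i) τ
    simp only [hgF] at this
    rw [moment, ← this]
    congr 1
    funext m
    rw [← Complex.exp_int_mul]
    congr 2
    ring
  refine ⟨_, hRD, fun i => ?_, fun i => ?_, ?_⟩
  -- By Poisson summation the moments sample the bump at `±2θ + 2πk`. Among `2θ + 2πk` only `k = 0`
  -- falls in `(0, π)`; among `-2θ + 2πk` none does.
  · rw [hmom, tsum_eq_single 0 fun k hk => ?_]
    · simp only [Int.cast_zero, mul_zero, add_zero, hb_def, hb₀v, h2θ]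
      push_cast
      simp
    · rw [hb0, zero_mul]
      rintro ⟨h1, h2⟩
      rcases lt_or_gt_of_ne hk with hk | hk
      · have : (k : ℝ) ≤ -1 := by exact_mod_cast Int.le_sub_one_of_lt hk
        nlinarith
      · have : (1 : ℝ) ≤ k := by exact_mod_cast hk
        nlinarith
  · rw [show (Complex.exp (Complex.I * (2 * θ : ℝ)))⁻¹ = Complex.exp (Complex.I * (-(2 * θ) : ℝ)) by
      rw [← Complex.exp_neg]; congr 1; push_cast; ring, hmom]
    refine (tsum_congr fun k => ?_).trans tsum_zero
    rw [hb0, zero_mul]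
    rintro ⟨h1, h2⟩
    rcases lt_or_ge k 1 with hk | hk
    · have : (k : ℝ) ≤ 0 := by exact_mod_cast Int.lt_add_one_iff.1 hk
      nlinarith
    · have : (1 : ℝ) ≤ k := by exact_mod_cast hk
      nlinarith
  · have hpair : ∀ i : Planck, pairing d E H (↑) (fun (i : Planck) (m : ℤ) => g (offset d E i - m)) i =
        (2 * Real.pi : ℂ)⁻¹ * (Complex.exp (((i : ℝ)⁻¹ * phase E H (2 * θ) : ℝ) * Complex.I) *
          ∫ u : ℝ, χ u * Complex.exp (-((i : ℝ)⁻¹ * u ^ 2 / 2 : ℝ) * Complex.I)) := fun i => by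
      have hi := i.pos
      have hy : 0 ≤ 4 * H / (i : ℝ) := by positivity
      have hsum := hRD.hasSum_nat (d := d) (E := E) hH.le (fun i : Planck => i.pos) i
      have hcoef : ∀ n : ℕ, g (offset d E i - ((n - center d E i : ℤ) : ℝ)) = (2 * Real.pi : ℂ)⁻¹ *
          ∫ t : ℝ, b t * Complex.exp (Complex.I * ((E / i - d / 2 : ℝ) - n) * t) := fun n => by
        rw [hg, ← center_add_offset]
        congr 2
        funext t
        congr 2
        push_cast
        ring
      simp only [hcoef, mul_assoc (2 * Real.pi : ℂ)⁻¹] at hsum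
      have hne : (2 * Real.pi : ℂ)⁻¹ ≠ 0 := by
        have : (Real.pi : ℂ) ≠ 0 := by exact_mod_cast hpi.ne'
        exact inv_ne_zero (mul_ne_zero two_ne_zero this)
      -- The support in `(0, π)` avoids `t = π`, where the boundary value is singular.
      rw [← hsum.tsum_eq, tsum_mul_left, tsum_integral_laguerre hy hbd.continuous hbs hbπ _
        ((summable_mul_left_iff hne).1 hsum.summable), ← hχ]
      congr 2
      funext t
      by_cases h0 : b₀ t = 0
      · simp [hb_def, h0]
      have ht := hb₀π (subset_tsupport b₀ h0)
      have hct : 0 < Real.cos (t / 2) :=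
        Real.cos_pos_of_mem_Ioo ⟨by linarith [ht.1], by linarith [ht.2]⟩
      have hpow : (((2 * Real.cos (t / 2)) ^ d : ℝ) : ℂ) ≠ 0 := by
        exact_mod_cast (pow_pos (mul_pos two_pos hct) d).ne'
      rw [mul_assoc (b t), laguerreGen_boundary d E H hi.ne' hct.ne']
      simp only [hb_def, phase]
      field_simp
    obtain ⟨C, hC⟩ := fresnel χ
    refine ⟨(2 * Real.pi)⁻¹ * (C * √(2 * Real.pi)), fun i => ?_⟩
    have hi := i.pos
    have h := hC (i : ℝ)⁻¹ (inv_pos.2 hi)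
    rw [div_inv_eq_mul, div_inv_eq_mul, hχ0, mul_one] at h
    rw [hpair]
    have e : Complex.exp ((phase E H (2 * θ) / i - Real.pi / 4 : ℝ) * Complex.I) =
        Complex.exp (((i : ℝ)⁻¹ * phase E H (2 * θ) : ℝ) * Complex.I) *
          Complex.exp (-(Real.pi / 4 : ℝ) * Complex.I) := by
      rw [← Complex.exp_add]
      congr 1
      push_cast
      ring
    rw [e, show ∀ A X Y : ℂ, (2 * Real.pi : ℂ)⁻¹ * (A * X) - ((2 * Real.pi)⁻¹ * √(2 * Real.pi * i) : ℝ) *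
      (A * Y) = ((2 * Real.pi)⁻¹ : ℝ) * (A * (X - (√(2 * Real.pi * i) : ℝ) * Y)) from fun A X Y => by
        push_cast; ring, norm_mul, norm_mul, Complex.norm_exp_ofReal_mul_I, one_mul, Complex.norm_real,
      Real.norm_of_nonneg (by positivity)]
    calc (2 * Real.pi)⁻¹ * _ ≤ (2 * Real.pi)⁻¹ * (C * (√(2 * Real.pi * i) * i)) := by gcongr
      _ = _ := by rw [Real.sqrt_mul (by positivity)]; ring

end

/-! ### The Weyl sum as a pairing; conclusion in the forbidden region -/

theorem hamiltonian_nonneg {d : ℕ} (x ξ : Config d) : 0 ≤ hamiltonian x ξ := by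
  unfold hamiltonian
  positivity

/-- The Weyl sum as a pairing with the Laguerre functions. -/
theorem hasSum_weylTerm {ι : Type*} {d : ℕ} {E : ℝ} {ħ : ι → ℝ} (hħ : ∀ i, 0 < ħ i) (f : 𝓢(ℝ, ℂ))
    (x ξ : Config d) (i : ι) :
    HasSum (weylTerm d (ħ i) E f x ξ) ((((Real.pi * ħ i) ^ d)⁻¹ : ℝ) *
      pairing d E (hamiltonian x ξ) ħ (fun i m => f (offset d E (ħ i) - m)) i) := by
  have h := ((rapidDecay_schwartz f fun i => abs_offset_le d E (ħ i)).hasSum_nat (d := d) (E := E)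
    (hamiltonian_nonneg x ξ) hħ i).mul_left ((((Real.pi * ħ i) ^ d)⁻¹ : ℝ) : ℂ)
  refine h.congr_fun ?_
  intro n
  have hi := (hħ i).ne'
  rw [weylTerm, wigner_eq_laguerreFun (hħ i), show (ħ i)⁻¹ * (E - eigenvalue d (ħ i) n) =
    offset d E (ħ i) - ((n - center d E (ħ i) : ℤ) : ℝ) by
      push_cast
      have := center_add_offset d E (ħ i)
      rw [eigenvalue]
      field_simp
      field_simp at this
      linarith]
  push_cast
  ring

theorem isBigO_weylSum_of_forbidden {d : ℕ} {E : ℝ} (hE : 0 < E) (f : 𝓢(ℝ, ℂ)) {x ξ : Config d}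
    (h : E < hamiltonian x ξ) (M : ℕ) :
    (fun ħ : ℝ => weylSum d ħ E f x ξ) =O[𝓝[>] 0] fun ħ : ℝ => ħ ^ M := by
  -- One power `d` pays for the prefactor `(πħ)^{-d}`, the other for the crude bound at the start of
  -- the iteration.
  obtain ⟨C, hC0, hC⟩ := norm_pairing_le_of_forbidden (d := d) hE h (M + 2 * d)
    (rapidDecay_schwartz f fun i : Planck => abs_offset_le d E i)
  refine IsBigO.of_bound ((Real.pi ^ d)⁻¹ * C) ?_
  filter_upwards [Ioc_mem_nhdsGT (zero_lt_one (α := ℝ))] with ħ hħ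
  have h0 := hħ.1
  rw [weylSum, (hasSum_weylTerm (fun i : Planck => i.pos) f x ξ ⟨ħ, hħ⟩).tsum_eq, norm_mul,
    Complex.norm_real, Real.norm_of_nonneg (by have := Real.pi_pos; positivity), norm_pow,
    Real.norm_of_nonneg h0.le]
  calc ((Real.pi * ħ) ^ d)⁻¹ * _ ≤ ((Real.pi * ħ) ^ d)⁻¹ * (C * (ħ ^ (M + 2 * d) / ħ ^ d)) := by
        have := Real.pi_pos
        gcongr
        exact hC ⟨ħ, hħ⟩
    _ = (Real.pi ^ d)⁻¹ * C * ħ ^ M := by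
      rw [mul_pow, pow_add, pow_mul']
      field_simp

/-! ### Critical times and the asymptotics in the allowed region -/

theorem tsum_int_even_odd {F : ℤ → ℂ} (hF : Summable F) :
    ∑' k : ℤ, F k = ∑' j : ℤ, F (2 * j) + ∑' j : ℤ, F (2 * j + 1) := by
  have h2 : Function.Injective fun j : ℤ => 2 * j := mul_right_injective₀ two_ne_zero
  have h3 : Function.Injective fun j : ℤ => 2 * j + 1 := (add_left_injective 1).comp h2
  have he := h2.hasSum_range_iff.2 (hF.comp_injective h2).hasSum
  have ho := h3.hasSum_range_iff.2 (hF.comp_injective h3).hasSum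
  refine (he.add_isCompl ?_ ho).tsum_eq
  simpa [Function.comp_def] using Int.isCompl_even_odd

theorem norm_exp_I_mul_ofReal (θ : ℝ) : ‖Complex.exp (Complex.I * θ)‖ = 1 := by
  rw [mul_comm, Complex.norm_exp_ofReal_mul_I]

theorem criticalTime_one (h : ℝ) (σ : ℤˣ) (k : ℤ) : criticalTime h 1 σ k =
    ((σ : ℤ) : ℝ) * (2 * Real.arccos (√h)) + 2 * Real.pi * (2 * k : ℤ) := by
  rw [criticalTime, if_pos rfl]
  push_cast
  ring

theorem criticalTime_neg_one (h : ℝ) (σ : ℤˣ) (k : ℤ) : criticalTime h (-1) σ k =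
    ((σ : ℤ) : ℝ) * (2 * Real.arccos (√h)) + 2 * Real.pi * (2 * k + 1 : ℤ) := by
  rw [criticalTime, if_neg (by decide)]
  push_cast
  ring

theorem summable_criticalTerm (ħ E h : ℝ) (f : 𝓢(ℝ, ℂ)) (σ₁ σ₂ : ℤˣ) :
    Summable (criticalTerm ħ E h f σ₁ σ₂) := by
  have hs := (summable_fourierHat_shift f (((σ₂ : ℤ) : ℝ) * (2 * Real.arccos (√h)))).norm
  have h2 : Function.Injective fun j : ℤ => 2 * j := mul_right_injective₀ two_ne_zero
  have hn : ∀ k, ‖criticalTerm ħ E h f σ₁ σ₂ k‖ = ‖fourierHat f (criticalTime h σ₁ σ₂ k)‖ := fun k => by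
    rw [criticalTerm, norm_mul, show Complex.I * E / ħ * (criticalTime h σ₁ σ₂ k : ℂ) =
      Complex.I * ((E / ħ * criticalTime h σ₁ σ₂ k : ℝ) : ℂ) by push_cast; ring,
      norm_exp_I_mul_ofReal, mul_one]
  refine Summable.of_norm ?_
  simp only [hn]
  rcases Int.units_eq_one_or σ₁ with rfl | rfl
  · simp only [criticalTime_one]
    exact hs.comp_injective h2
  · simp only [criticalTime_neg_one]
    exact hs.comp_injective ((add_left_injective 1).comp h2)

/-- The offset differs from `E/ħ - d/2` by an integer, invisible to `e^{2πik·}`; the term `d/2`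
leaves the sign `(-1)^{kd}`, the source of `σ₁^d`. -/
theorem exp_offset (d : ℕ) (E ħ : ℝ) (k : ℤ) :
    Complex.exp (Complex.I * offset d E ħ * (2 * Real.pi * k)) =
      Complex.exp (Complex.I * E / ħ * (2 * Real.pi * k)) / ((-1) ^ k) ^ d := by
  have h1 : ((-1 : ℂ) ^ k) ^ d = Complex.exp (d * (k * (Real.pi * Complex.I))) := by
    rw [Complex.exp_nat_mul, Complex.exp_int_mul, Complex.exp_pi_mul_I]
  have h2 : (offset d E ħ : ℂ) = E / ħ - d / 2 - center d E ħ := by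
    have := congrArg Complex.ofReal (center_add_offset d E ħ)
    push_cast at this
    linear_combination this
  rw [h1, ← Complex.exp_sub, Complex.exp_eq_exp_iff_exists_int]
  refine ⟨-(center d E ħ * k), ?_⟩
  rw [h2]
  push_cast
  ring

/-- The Poisson sum over all frequencies, split according to parity, gives the sums over the
critical times. -/
theorem exp_mul_tsum_fourierHat (d : ℕ) (ħ E h : ℝ) (f : 𝓢(ℝ, ℂ)) (σ : ℤˣ) :
    Complex.exp (Complex.I * (E / ħ * (((σ : ℤ) : ℝ) * (2 * Real.arccos (√h))) : ℝ)) *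
      ∑' k : ℤ, fourierHat f (((σ : ℤ) : ℝ) * (2 * Real.arccos (√h)) + 2 * Real.pi * k) *
        Complex.exp (Complex.I * offset d E ħ * (2 * Real.pi * k)) =
    ∑ σ₁ : ℤˣ, (∑' k : ℤ, criticalTerm ħ E h f σ₁ σ k) / ((σ₁ : ℤ) : ℂ) ^ d := by
  set τ : ℝ := ((σ : ℤ) : ℝ) * (2 * Real.arccos (√h)) with hτ
  have hs : Summable fun k : ℤ => fourierHat f (τ + 2 * Real.pi * k) *
      Complex.exp (Complex.I * offset d E ħ * (2 * Real.pi * k)) := by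
    refine Summable.of_norm ((summable_fourierHat_shift f τ).norm.congr fun k => ?_)
    rw [norm_mul, show Complex.I * offset d E ħ * (2 * Real.pi * k) =
      Complex.I * ((offset d E ħ * (2 * Real.pi * k) : ℝ) : ℂ) by push_cast; ring,
      norm_exp_I_mul_ofReal, mul_one]
  have hpm : (Finset.univ : Finset ℤˣ) = {1, -1} := rfl
  rw [tsum_int_even_odd hs, mul_add, ← tsum_mul_left, ← tsum_mul_left, hpm,
    Finset.sum_pair (by decide), ← tsum_div_const, ← tsum_div_const]
  congr 1
  · refine tsum_congr fun k => ?_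
    rw [exp_offset, criticalTerm, criticalTime_one, ← hτ, zpow_mul, mul_left_comm, mul_div_assoc',
      ← Complex.exp_add]
    norm_num
    left
    congr 1
    ring
  · refine tsum_congr fun k => ?_
    rw [exp_offset, criticalTerm, criticalTime_neg_one, ← hτ, zpow_add₀ (by norm_num), zpow_mul,
      mul_left_comm, mul_div_assoc', ← Complex.exp_add, mul_div_assoc]
    norm_num
    rw [mul_div_assoc]
    congr 3
    ring

theorem moment_schwartz {d : ℕ} {E : ℝ} (f : 𝓢(ℝ, ℂ)) (τ : ℝ) (i : Planck) :
    moment (Complex.exp (Complex.I * τ)) (fun i m => f (offset d E i - m)) i =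
      Complex.exp (Complex.I * offset d E i * τ) * ∑' k : ℤ, fourierHat f (τ + 2 * Real.pi * k) *
        Complex.exp (Complex.I * offset d E i * (2 * Real.pi * k)) := by
  have h := tsum_exp_mul_schwartz f (offset d E i) τ
  rw [moment, ← tsum_mul_left]
  refine Eq.trans (tsum_congr fun m => ?_) (h.trans (tsum_congr fun k => ?_))
  · rw [← Complex.exp_int_mul]
    congr 2
    ring
  · rw [mul_add, Complex.exp_add]
    ring

section

variable {E H θ : ℝ}

/-- The amplitude is the Wigner prefactor times the stationary-phase size of the test pairing,
divided by the modulus of its moment; this uses `tan θ = √(h⁻¹ - 1)` and `cos θ = √h`. -/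
theorem amplitude_eq (d : ℕ) {ħ h : ℝ} (hħ : 0 < ħ) (hE : 0 < E) (hh : 0 < h) (hh1 : h < 1) :
    amplitude d ħ E h = ((Real.pi * ħ) ^ d)⁻¹ *
      ((2 * Real.pi)⁻¹ * √(2 * Real.pi * ħ) / (√(E * √(h⁻¹ - 1)) * (2 * √h) ^ d)) := by
  have hpi := Real.pi_pos
  have hc : 0 < h⁻¹ - 1 := sub_pos.2 ((one_lt_inv₀ hh).2 hh1)
  have e1 : (h⁻¹ - 1) ^ (1 / 4 : ℝ) = √(√(h⁻¹ - 1)) := by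
    rw [Real.sqrt_eq_rpow, Real.sqrt_eq_rpow, ← Real.rpow_mul hc.le]
    norm_num
  have e2 : h ^ ((d : ℝ) / 2) = √h ^ d := by
    rw [Real.sqrt_eq_rpow, ← Real.rpow_natCast, ← Real.rpow_mul hh.le]
    congr 1
    ring
  have e3 : ħ ^ (-(d : ℝ) + 1 / 2) = (ħ ^ d)⁻¹ * √ħ := by
    rw [Real.rpow_add hħ, Real.rpow_neg hħ.le, Real.rpow_natCast, Real.sqrt_eq_rpow]
  have e4 : (2 * Real.pi) ^ ((d : ℝ) + 1 / 2) = (2 * Real.pi) ^ d * √(2 * Real.pi) := by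
    rw [Real.rpow_add (by positivity), Real.rpow_natCast, Real.sqrt_eq_rpow]
  have e5 : 2 * Real.pi = √(2 * Real.pi) ^ 2 := (Real.sq_sqrt (by positivity)).symm
  rw [amplitude, e1, e2, e3, e4, ← Real.sqrt_eq_rpow, Real.sqrt_mul hE.le,
    Real.sqrt_mul (show 0 ≤ 2 * Real.pi by positivity) ħ, mul_pow _ √h, mul_pow, mul_pow]
  have h1 : 0 < √(2 * Real.pi) := by positivity
  have h2 : 0 < √E := by positivity
  have h3 : 0 < √h := by positivity
  have h4 : 0 < √(√(h⁻¹ - 1)) := by positivity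
  rw [show (2 * Real.pi)⁻¹ * (√(2 * Real.pi) * √ħ) = √ħ / √(2 * Real.pi) by
    nth_rewrite 1 [e5]; field_simp]
  field_simp

/-- The pairing of the sampled Schwartz function in the allowed region. -/
theorem norm_pairing_sub_criticalSum_le (d : ℕ) {h : ℝ} (hE : 0 < E) (hh : 0 < h) (hh1 : h < 1)
    (f : 𝓢(ℝ, ℂ)) :
    ∃ C : ℝ, ∀ i : Planck, ‖pairing d E (E * h) (↑) (fun i m => f (offset d E i - m)) i -
      ((2 * Real.pi)⁻¹ * √(2 * Real.pi * i) / (√(E * √(h⁻¹ - 1)) * (2 * √h) ^ d) : ℝ) *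
        criticalSum d i E h f‖ ≤ C * (i * √i) := by
  have hpi := Real.pi_pos
  set θ := Real.arccos √h with hθ_def
  have hsq : √h < 1 := by rw [Real.sqrt_lt' one_pos]; simpa using hh1
  have hs0 : 0 < √h := Real.sqrt_pos.2 hh
  have hcosθ : Real.cos θ = √h := Real.cos_arccos (by linarith) hsq.le
  have hθ0 : 0 < θ := Real.arccos_pos.2 hsq
  have hθ : θ < Real.pi / 2 := Real.arccos_lt_pi_div_two.2 hs0
  have htan : Real.tan θ = √(h⁻¹ - 1) := by
    rw [hθ_def, Real.tan_arccos, Real.sq_sqrt hh.le, ← Real.sqrt_div (by linarith)]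
    congr 1
    field_simp
  have hcos : E * Real.cos θ ^ 2 = E * h := by rw [hcosθ, Real.sq_sqrt hh.le]
  have hH : 0 < E * h := mul_pos hE hh
  obtain ⟨b, hb, hb1, hb0, C₀, hC₀⟩ := exists_test_family d hH hE hθ0 hθ hcos
  rw [htan, hcosθ] at hb1
  set B : ℝ := √(E * √(h⁻¹ - 1)) * (2 * √h) ^ d with hB_def
  have hc : 0 < h⁻¹ - 1 := sub_pos.2 ((one_lt_inv₀ hh).2 hh1)
  have hB : 0 < B := by positivity
  set μ : ℂ := Complex.exp (Complex.I * (2 * θ : ℝ)) with hμ_def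
  have hμ : ‖μ‖ = 1 := norm_exp_I_mul_ofReal _
  have hμi : μ⁻¹ = Complex.exp (Complex.I * (-(2 * θ) : ℝ)) := by
    rw [hμ_def, ← Complex.exp_neg]; congr 1; push_cast; ring
  have hμi1 : ‖μ⁻¹‖ = 1 := by rw [norm_inv, hμ, inv_one]
  -- The two frequencies are distinct because `0 < 4θ < 2π`.
  have hμ2 : μ ^ 2 ≠ 1 := by
    rw [hμ_def, ← Complex.exp_nat_mul, Ne, Complex.exp_eq_one_iff]
    rintro ⟨n, hn⟩
    have h1 := congrArg Complex.im hn
    simp at h1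
    have h2 : 0 < (n : ℝ) := by
      by_contra! hneg
      nlinarith
    have h3 : (n : ℝ) < 1 := by
      by_contra! hge
      nlinarith
    have h4 : 0 < n := by exact_mod_cast h2
    have h5 : n < 1 := by exact_mod_cast h3
    omega
  have hμE : E * (μ + μ⁻¹) = 4 * (E * h : ℝ) - 2 * E := by
    have h1 : μ + μ⁻¹ = 2 * (Real.cos (2 * θ) : ℝ) := by
      rw [hμi, hμ_def, Complex.ofReal_cos, Complex.cos]
      push_cast
      ring_nf
    rw [h1, Real.cos_two_mul, hcosθ, Real.sq_sqrt hh.le]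
    push_cast
    ring
  have hbn : ∀ i, ‖moment μ b i‖ = B := fun i => by
    rw [hb1, norm_mul, mul_assoc, ← Complex.ofReal_mul, norm_exp_I_mul_ofReal, mul_one,
      Complex.norm_real, Real.norm_of_nonneg hB.le]
  set P₀ : Planck → ℂ := fun i => ((2 * Real.pi)⁻¹ * √(2 * Real.pi * i) : ℝ) *
    Complex.exp ((phase E (E * h) (2 * θ) / i - Real.pi / 4 : ℝ) * Complex.I) with hP₀
  have hP₀n : ∀ i, ‖P₀ i‖ = (2 * Real.pi)⁻¹ * √(2 * Real.pi) * √(i : ℝ) := fun i => by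
    rw [hP₀, norm_mul, Complex.norm_exp_ofReal_mul_I, mul_one, Complex.norm_real,
      Real.norm_of_nonneg (by positivity), Real.sqrt_mul (by positivity), mul_assoc]
  have hD : ∀ i : Planck, ‖pairing d E (E * h) (↑) b i‖ ≤
      (|C₀| + (2 * Real.pi)⁻¹ * √(2 * Real.pi)) * √i := fun i => by
    have h1 := norm_le_norm_add_norm_sub' (pairing d E (E * h) (↑) b i) (P₀ i)
    have h2 := hC₀ i
    have h3 := i.le_one
    have h4 : C₀ * (i * √i) ≤ |C₀| * (1 * √i) := by
      have := i.pos.le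
      gcongr
      exact le_abs_self _
    rw [hP₀n] at h1
    linarith
  have ha := rapidDecay_schwartz f fun i : Planck => abs_offset_le d E i
  obtain ⟨C₁, -, hC₁⟩ := norm_pairing_sub_le hE hH hμ hμ2 hμE hb hb0 hB hbn hD ha
  obtain ⟨C₂, hC₂0, hC₂⟩ := norm_tsum_zpow_le ha hμ
  obtain ⟨C₃, hC₃0, hC₃⟩ := norm_tsum_zpow_le ha hμi1
  refine ⟨C₁ + (C₂ / B * C₀ + C₃ / B * C₀), fun i => ?_⟩
  set S₁ := moment μ (fun i m => f (offset d E i - m)) i / moment μ b i with hS₁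
  set S₂ := moment μ⁻¹ (fun i m => f (offset d E i - m)) i / (starRingEnd ℂ) (moment μ b i) with hS₂
  -- The common phase `e^{iε·2θ}` cancels in the quotients of moments. The stationary value of the
  -- phase then restores `e^{iE·2θ/ħ}`, so that each dual index carries `e^{iEt/ħ}` at its critical
  -- time.
  have hmain : ((2 * Real.pi)⁻¹ * √(2 * Real.pi * i) / B : ℝ) * criticalSum d i E h f =
      S₁ * P₀ i + S₂ * (starRingEnd ℂ) (P₀ i) := by
    set Φ := stationaryPhase i E h with hΦ
    have hQ : phase E (E * h) (2 * θ) / i - Real.pi / 4 = E / i * (2 * θ) - Φ := by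
      rw [hΦ, stationaryPhase, phase, mul_div_cancel_left₀ θ two_ne_zero, htan]
      ring
    have hBc : (B : ℂ) ≠ 0 := by exact_mod_cast hB.ne'
    have h₁ := exp_mul_tsum_fourierHat d i E h f 1
    have h₂ := exp_mul_tsum_fourierHat d i E h f (-1)
    simp only [Units.val_one, Int.cast_one, one_mul, ← hθ_def] at h₁
    simp only [Units.val_neg, Units.val_one, Int.cast_neg, Int.cast_one, neg_one_mul, ← hθ_def] at h₂
    have e₁ : S₁ = (∑' k : ℤ, fourierHat f (2 * θ + 2 * Real.pi * k) *
        Complex.exp (Complex.I * offset d E i * (2 * Real.pi * k))) / B := by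
      rw [hS₁, moment_schwartz, hb1, mul_comm (B : ℂ), mul_div_mul_left _ _ (Complex.exp_ne_zero _)]
    have e₂ : S₂ = (∑' k : ℤ, fourierHat f (-(2 * θ) + 2 * Real.pi * k) *
        Complex.exp (Complex.I * offset d E i * (2 * Real.pi * k))) / B := by
      have hconj : (starRingEnd ℂ) (moment μ b i) =
          Complex.exp (Complex.I * offset d E i * (-(2 * θ) : ℝ)) * B := by
        rw [hb1, map_mul, ← Complex.exp_conj, Complex.conj_ofReal, mul_comm]
        congr 2
        rw [map_mul, map_mul, Complex.conj_I, Complex.conj_ofReal, Complex.conj_ofReal]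
        push_cast
        ring
      rw [hS₂, hμi, moment_schwartz, hconj, mul_div_mul_left _ _ (Complex.exp_ne_zero _)]
    have p₁ : P₀ i = ((2 * Real.pi)⁻¹ * √(2 * Real.pi * i) : ℝ) *
        (Complex.exp (-(Complex.I * Φ)) * Complex.exp (Complex.I * (E / i * (2 * θ) : ℝ))) := by
      simp only [hP₀]
      rw [hQ, ← Complex.exp_add]
      congr 2
      push_cast
      ring
    have p₂ : (starRingEnd ℂ) (P₀ i) = ((2 * Real.pi)⁻¹ * √(2 * Real.pi * i) : ℝ) *
        (Complex.exp (Complex.I * Φ) * Complex.exp (Complex.I * (E / i * -(2 * θ) : ℝ))) := by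
      simp only [hP₀]
      rw [hQ, map_mul, Complex.conj_ofReal, ← Complex.exp_conj, ← Complex.exp_add, map_mul,
        Complex.conj_I, Complex.conj_ofReal]
      congr 2
      push_cast
      ring
    have hcs : criticalSum d i E h f = Complex.exp (-(Complex.I * Φ)) *
        (∑ σ₁ : ℤˣ, (∑' k : ℤ, criticalTerm i E h f σ₁ 1 k) / ((σ₁ : ℤ) : ℂ) ^ d) +
        Complex.exp (Complex.I * Φ) *
        (∑ σ₁ : ℤˣ, (∑' k : ℤ, criticalTerm i E h f σ₁ (-1) k) / ((σ₁ : ℤ) : ℂ) ^ d) := by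
      have hpm : (Finset.univ : Finset ℤˣ) = {1, -1} := rfl
      have hne : (1 : ℤˣ) ≠ -1 := by decide
      rw [criticalSum, hpm]
      simp only [Finset.sum_pair hne, Units.val_neg, Units.val_one, Int.cast_neg, Int.cast_one,
        neg_mul, one_mul, neg_neg, ← hΦ]
      ring
    rw [hcs, ← h₁, ← h₂, p₂, p₁, e₁, e₂]
    push_cast
    ring
  have hn₁ : ‖S₁‖ ≤ C₂ / B := by
    rw [hS₁, norm_div, hbn]
    exact div_le_div_of_nonneg_right (hC₂ i) hB.le
  have hn₂ : ‖S₂‖ ≤ C₃ / B := by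
    rw [hS₂, norm_div, RCLike.norm_conj, hbn]
    exact div_le_div_of_nonneg_right (hC₃ i) hB.le
  rw [hmain]
  set P := pairing d E (E * h) (↑) b i
  set A := pairing d E (E * h) (↑) (fun (i : Planck) m => f (offset d E i - m)) i
  have hP : ‖P - P₀ i‖ ≤ C₀ * (i * √i) := hC₀ i
  calc ‖A - (S₁ * P₀ i + S₂ * (starRingEnd ℂ) (P₀ i))‖
      = ‖(A - (S₁ * P + S₂ * (starRingEnd ℂ) P)) +
        (S₁ * (P - P₀ i) + S₂ * (starRingEnd ℂ) (P - P₀ i))‖ := by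
        rw [map_sub]; congr 1; ring
    _ ≤ C₁ * (i * √i) + (C₂ / B * (C₀ * (i * √i)) + C₃ / B * (C₀ * (i * √i))) := by
      refine (norm_add_le _ _).trans (add_le_add (hC₁ i) ((norm_add_le _ _).trans ?_))
      rw [norm_mul, norm_mul, RCLike.norm_conj]
      gcongr
    _ = _ := by ring

end

/-- The amplitude does not vanish, so the remainder is defined by division. Apart from the common
factor `(πħ)^{-d}`, an error of order `ħ^{3/2}` is divided by a quantity of order `ħ^{1/2}`, which
gives `O(ħ)`. -/
theorem exists_remainder {d : ℕ} {E : ℝ} (hE : 0 < E) (f : 𝓢(ℝ, ℂ)) {x ξ : Config d}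
    (hh : 0 < hamiltonian x ξ / E) (hh1 : hamiltonian x ξ / E < 1) :
    ∃ R : ℝ → ℂ, (∀ ħ : ℝ, 0 < ħ → weylSum d ħ E f x ξ = amplitude d ħ E (hamiltonian x ξ / E) *
      (criticalSum d ħ E (hamiltonian x ξ / E) f + R ħ)) ∧ R =O[𝓝[>] 0] fun ħ : ℝ => ħ := by
  have hpi := Real.pi_pos
  obtain ⟨C, hC⟩ := norm_pairing_sub_criticalSum_le d hE hh hh1 f
  rw [mul_div_cancel₀ _ hE.ne'] at hC
  set h := hamiltonian x ξ / E
  have hc : 0 < h⁻¹ - 1 := sub_pos.2 ((one_lt_inv₀ hh).2 hh1)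
  set B : ℝ := √(E * √(h⁻¹ - 1)) * (2 * √h) ^ d
  have hB : 0 < B := by positivity
  have hA : ∀ ħ : ℝ, 0 < ħ → (amplitude d ħ E h : ℂ) ≠ 0 := fun ħ hħ => by
    rw [amplitude_eq d hħ hE hh hh1]
    exact_mod_cast (show 0 < ((Real.pi * ħ) ^ d)⁻¹ *
      ((2 * Real.pi)⁻¹ * √(2 * Real.pi * ħ) / B) by positivity).ne'
  refine ⟨fun ħ => weylSum d ħ E f x ξ / amplitude d ħ E h - criticalSum d ħ E h f,
    fun ħ hħ => by rw [add_sub_cancel, mul_div_cancel₀ _ (hA ħ hħ)], ?_⟩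
  refine IsBigO.of_bound (C / ((2 * Real.pi)⁻¹ * √(2 * Real.pi) / B)) ?_
  filter_upwards [Ioc_mem_nhdsGT (zero_lt_one (α := ℝ))] with ħ hħ
  have h0 := hħ.1
  set A : ℝ := (2 * Real.pi)⁻¹ * √(2 * Real.pi * ħ) / B with hA_def
  have hA0 : 0 < A := by positivity
  have hAc : (A : ℂ) ≠ 0 := by exact_mod_cast hA0.ne'
  have hk : 0 < ((Real.pi * ħ) ^ d)⁻¹ := by positivity
  have hkc : ((((Real.pi * ħ) ^ d)⁻¹ : ℝ) : ℂ) ≠ 0 := by exact_mod_cast hk.ne'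
  have hCi := hC ⟨ħ, hħ⟩
  rw [weylSum, (hasSum_weylTerm (fun i : Planck => i.pos) f x ξ ⟨ħ, hħ⟩).tsum_eq,
    amplitude_eq d h0 hE hh hh1, Complex.ofReal_mul, mul_div_mul_left _ _ hkc, div_sub' hAc, norm_div,
    Complex.norm_real, Real.norm_of_nonneg hA0.le, Real.norm_of_nonneg h0.le, div_le_iff₀ hA0]
  refine hCi.trans (le_of_eq ?_)
  rw [hA_def, Real.sqrt_mul (show 0 ≤ 2 * Real.pi by positivity) ħ]
  have : 0 < √(2 * Real.pi) := by positivity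
  change C * (ħ * √ħ) = _
  field_simp

end WignerWeyl

end

/-! ### The main theorem -/

theorem theorem1p1 (d : ℕ) (hd : 1 ≤ d) (E : ℝ) (hE : 0 < E)
    (f : 𝓢(ℝ, ℂ)) (hf : ∀ s : ℝ, f (-s) = f s) (x ξ : WignerWeyl.Config d) :
    -- the kernels, the Wigner distributions and the Weyl sum are well defined
    (∀ ħ : ℝ, 0 < ħ →
      (∀ N : ℕ, (∃! K, WignerWeyl.IsContinuousKernel (WignerWeyl.eigenprojection d ħ N) K) ∧
        Integrable (WignerWeyl.wignerIntegrand d ħ N x ξ)) ∧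
      Summable (WignerWeyl.weylTerm d ħ E f x ξ)) ∧
    -- the forbidden region
    (E < WignerWeyl.hamiltonian x ξ →
      ∀ M : ℕ, (fun ħ : ℝ => WignerWeyl.weylSum d ħ E f x ξ) =O[𝓝[>] 0] fun ħ : ℝ => ħ ^ M) ∧
    -- the allowed region
    (0 < WignerWeyl.hamiltonian x ξ → WignerWeyl.hamiltonian x ξ < E →
      (∀ ħ : ℝ, 0 < ħ → ∀ σ₁ σ₂ : ℤˣ,
        Summable (WignerWeyl.criticalTerm ħ E (WignerWeyl.hamiltonian x ξ / E) f σ₁ σ₂)) ∧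
      ∀ δ : ℝ, 0 < δ → ∃ R : ℝ → ℂ,
        R =O[𝓝[>] 0] (fun ħ : ℝ => ħ ^ (1 - δ)) ∧
        ∀ ħ : ℝ, 0 < ħ →
          WignerWeyl.weylSum d ħ E f x ξ =
            WignerWeyl.amplitude d ħ E (WignerWeyl.hamiltonian x ξ / E) *
              (WignerWeyl.criticalSum d ħ E (WignerWeyl.hamiltonian x ξ / E) f + R ħ)) := by
  refine ⟨fun ħ hħ => ⟨fun N => ⟨WignerWeyl.existsUnique_isContinuousKernel hħ N,
    WignerWeyl.integrable_wignerIntegrand hħ N x ξ⟩,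
    -- A one-element family covers every fixed `ħ > 0`, including values above 1.
    (WignerWeyl.hasSum_weylTerm (ι := Unit) (fun _ => hħ) f x ξ ()).summable⟩,
    WignerWeyl.isBigO_weylSum_of_forbidden hE f, fun hH hHE =>
    ⟨fun ħ _ σ₁ σ₂ => WignerWeyl.summable_criticalTerm ħ E _ f σ₁ σ₂, fun δ hδ => ?_⟩⟩
  have hh : 0 < WignerWeyl.hamiltonian x ξ / E := div_pos hH hE
  have hh1 : WignerWeyl.hamiltonian x ξ / E < 1 := (div_lt_one hE).2 hHE
  obtain ⟨R, hR, hRO⟩ := WignerWeyl.exists_remainder hE f hh hh1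
  -- The remainder is `O(ħ)`, which is stronger than `O(ħ^{1-δ})` once `ħ ≤ 1`; the same `R` serves
  -- every δ.
  refine ⟨R, hRO.trans ?_, hR⟩
  refine IsBigO.of_bound 1 ?_
  filter_upwards [Ioc_mem_nhdsGT (zero_lt_one (α := ℝ))] with ħ hħ
  rw [Real.norm_of_nonneg hħ.1.le, Real.norm_of_nonneg (Real.rpow_nonneg hħ.1.le _), one_mul]
  simpa using Real.rpow_le_rpow_of_exponent_ge hħ.1 hħ.2 (show 1 - δ ≤ 1 by linarith)
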